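/- Let $n\ge 2$ and $\zeta=\exp(\pi\sqrt{-1}/n)$. **Notation.** For $\boldsymbol k=(k_1,\dots,k_{n-1})\in\mathbb{Z}_{\ge 0}^{n-1}$ put $D_0(\boldsymbol k)=-\frac1n\sum_{i=1}^{n-1}(n-i)k_i$ and $D_n(\boldsymbol k)=-\frac1n\sum_{i=1}^{n-1}i\,k_i$, write $\langle q\rangle$ for the fractional part of $q$, and for $1\le r<n$ let $$f^r(x)=\sum_{\boldsymbol k:\ \langle -D_n(\boldsymbol k)\rangle=r/n}\frac{x_1^{k_1}\cdots x_{n-1}^{k_{n-1}}}{k_1!\cdots k_{n-1}!}\,\frac{\Gamma(\langle D_0(\boldsymbol k)\rangle)}{\Gamma(1+D_0(\boldsymbol k))}\,\frac{\Gamma(\langle D_n(\boldsymbol k)\rangle)}{\Gamma(1+D_n(\boldsymbol k))}.$$ The mirror map is $(x_0,\dots,x_{n-1})\mapsto(\tau^0,\dots,\tau^{n-1})$ with $\tau^0=x_0$ and $\tau^r=f^r(x_1,\dots,x_{n-1})$ for $1\le r<n$. Let $M$ be the $(n-1)\times(n+1)$ integer matrix with rows $i=1,\dots,n-1$, columns $j=0,\dots,n$,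 and $M_{i,i-1}=1$, $M_{i,i}=-2$, $M_{i,i+1}=1$, all other entries $0$. Put $y_i=\prod_{j=1}^{n-1}x_j^{M_{ij}}$ (that is, $y_i=x_{i-1}x_i^{-2}x_{i+1}$ with $x_0,x_n$ read as $1$ here), $\gimel_j=\sum_{i}M_{ij}\,y_i\frac{\partial}{\partial y_i}$ and $D'_j(d)=\sum_i M_{ij}d_i$ for $0\le j\le n$. The GKZ system consists of the equations $$\Big(\prod_{j:D'_j(d)>0}\ \prod_{m=0}^{D'_j(d)-1}(\gimel_j-m)\Big)f=y_1^{d_1}\cdots y_{n-1}^{d_{n-1}}\Big(\prod_{j:D'_j(d)<0}\ \prod_{m=0}^{-D'_j(d)-1}(\gimel_j-m)\Big)f\qquad(d\in\mathbb{Z}^{n-1}).$$ A holomorphic function of $x=(x_1,\dots,x_{n-1})$ on an open set is called a solution if it satisfies these equations, as a (multi-valued) function of $y$, wherever no $x_i$ vanishes. **Proposition.** (a) Let $\kappa_0(x),\dots,\kappa_{n-1}(x)$ be, for $x$ near $0$, the roots (with multiplicity) of $$W(\kappa)=\kappa^n+x_{n-1}\kappa^{n-1}+\cdots+x_1\kappa+1,$$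 numbered such that $\kappa_i(x)\to\zeta^{2i+1}$ as $x\to0$; such a numbering exists. Then there is a polydisc $U$ around $0$ in $\mathbb{C}^{n-1}$ on which each $\kappa_i$ has a holomorphic logarithm $\log\kappa_i$ with value $(2i+1)\pi\sqrt{-1}/n$ at $x=0$, and on which the following hold. 1. For every non-empty connected open $W'\subseteq U$, the constant function $1$ together with the functions $\log\kappa_i-\log\kappa_{i-1}$, $1\le i<n$, is a basis of the complex vector space of solutions of the GKZ system on $W'$. 2. The series $f^1(x),\dots,f^{n-1}(x)$ converge absolutely for $x\in U$, and for $0\le i<n$ $$\log\kappa_i(x)=\frac{(2i+1)\pi\sqrt{-1}}{n}+\frac1n\sum_{k=1}^{n-1}\zeta^{(2i+1)k}f^k(x).$$ 3. For $x\in U$ and $1\le i<n$ one has $x_i=(-1)^{n-i}e_{n-i}(\kappa_0(x),\dots,\kappa_{n-1}(x))$, where $e_j$ is the $j$-th elementary symmetric function. (b) The mirror map is inverted near $x_1=\dots=x_{n-1}=0$ by $x_0=\tau^0$ and, for $1\le i<n$, $$x_i=(-1)^{n-i}e_{n-i}(\kappa_0(\tau),\dots,\kappa_{n-1}(\tau)),\qquad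 \kappa_k(\tau)=\zeta^{2k+1}\prod_{r=1}^{n-1}\exp\Big(\frac1n\zeta^{(2k+1)r}\tau^r\Big).$$ That is, there is $r_0>0$ such that the series $f^k$ converge absolutely and mapping $x\mapsto\tau\mapsto x$ gives the identity whenever $|x_1|,\dots,|x_{n-1}|<r_0$; and there is $\rho>0$ such that, whenever $|\tau^1|,\dots,|\tau^{n-1}|<\rho$, the point $x$ given by these formulas has $|x_1|,\dots,|x_{n-1}|<r_0$ and the mirror map sends it back to $\tau$. -/

import Mathlib

open Filter Topology Polynomial

namespace TypeAMirror

noncomputable section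

/-- Gale dual matrix `M`, of size `(n-1) × (n+1)`, with rows `(…, 0, 1, -2, 1, 0, …)`.
The row `i : Fin (n - 1)` is the row with number `i + 1 ∈ {1, …, n-1}`; columns are numbered
`0, …, n`. -/
def galeMatrix (n : ℕ) (i : Fin (n - 1)) (j : Fin (n + 1)) : ℤ :=
  if (j : ℕ) = i then 1 else if (j : ℕ) = i + 1 then -2 else if (j : ℕ) = i + 2 then 1 else 0

/-- `D'_j(d) = d_{j-1} - 2 d_j + d_{j+1}`, terms with index outside `{1, …, n-1}` being dropped. -/
def dualDegree (n : ℕ) (d : Fin (n - 1) → ℤ) (j : Fin (n + 1)) : ℤ :=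
  ∑ i, galeMatrix n i j * d i

/-- The change of co-ordinates `y_i = x_{i-1} x_i⁻² x_{i+1}` (with `x_0 = x_n = 1`).
Here `x i` stands for `x_{i+1}` and `y i` for `y_{i+1}`. -/
def yOfX (n : ℕ) (x : Fin (n - 1) → ℂ) : Fin (n - 1) → ℂ :=
  fun i => ∏ j : Fin (n - 1), x j ^ galeMatrix n i ⟨j + 1, by omega⟩

/-- The torus where all co-ordinates are nonzero. -/
def torus (n : ℕ) : Set (Fin (n - 1) → ℂ) := {y | ∀ i, y i ≠ 0}

/-- The operator `y_i ∂/∂y_i`. -/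
def eulerOp {m : ℕ} (i : Fin m) (F : (Fin m → ℂ) → ℂ) : (Fin m → ℂ) → ℂ :=
  fun y => y i * fderiv ℂ F y (Pi.single i 1)

/-- The operator `ℷ_j = ∑_i M_{ij} y_i ∂/∂y_i`, for `0 ≤ j ≤ n`. -/
def gimel (n : ℕ) (j : Fin (n + 1)) (F : (Fin (n - 1) → ℂ) → ℂ) : (Fin (n - 1) → ℂ) → ℂ :=
  fun y => ∑ i, (galeMatrix n i j : ℂ) * eulerOp i F y

/-- `∏_{m=0}^{p-1} (ℷ_j - m)` applied to `F`. -/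
def fallingGimel (n : ℕ) (j : Fin (n + 1)) :
    ℕ → ((Fin (n - 1) → ℂ) → ℂ) → (Fin (n - 1) → ℂ) → ℂ
  | 0, F => F
  | p + 1, F => fun y =>
      gimel n j (fallingGimel n j p F) y - (p : ℂ) * fallingGimel n j p F y

/-- `∏_{j=0}^{n} ∏_{m=0}^{p_j-1} (ℷ_j - m)` applied to `F`. The factors commute on holomorphic
functions. -/
def gimelProd (n : ℕ) (p : Fin (n + 1) → ℕ) (F : (Fin (n - 1) → ℂ) → ℂ) :
    (Fin (n - 1) → ℂ) → ℂ :=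
  (List.finRange (n + 1)).foldr (fun j G => fallingGimel n j (p j) G) F

/-- `F` is a holomorphic solution on `V` of the GKZ system, in the co-ordinates
`y_1, …, y_{n-1}`: one equation for every `d ∈ ℤ^{n-1}`. The exponents `toNat` select the indices
`j` with `D'_j(d) > 0` on the left and those with `D'_j(d) < 0` on the right. -/
def IsGKZSolutionY (n : ℕ) (V : Set (Fin (n - 1) → ℂ)) (F : (Fin (n - 1) → ℂ) → ℂ) : Prop :=
  DifferentiableOn ℂ F V ∧
    ∀ d : Fin (n - 1) → ℤ, ∀ y ∈ V,
      gimelProd n (fun j => (dualDegree n d j).toNat) F y =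
        (∏ i, y i ^ d i) * gimelProd n (fun j => (-dualDegree n d j).toNat) F y

/-- A function `g` of `x_1, …, x_{n-1}`, holomorphic on the open set `W`, is a solution of the GKZ
system if, as a (multi-valued) function of `y`, it satisfies the equations wherever `y` is a
co-ordinate system, that is, where no `x_i` vanishes: for every holomorphic local branch
`x = s(y)` of the inverse of `x ↦ y`, with values in `W`, the function `g ∘ s` is a solution. -/
def IsGKZSolution (n : ℕ) (W : Set (Fin (n - 1) → ℂ)) (g : (Fin (n - 1) → ℂ) → ℂ) : Prop :=
  DifferentiableOn ℂ g W ∧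
    ∀ (V : Set (Fin (n - 1) → ℂ)) (s : (Fin (n - 1) → ℂ) → (Fin (n - 1) → ℂ)),
      IsOpen V → V ⊆ torus n → DifferentiableOn ℂ s V → Set.MapsTo s V W →
      (∀ y ∈ V, yOfX n (s y) = y) → IsGKZSolutionY n V (g ∘ s)

/-- The family `φ`, restricted to `W`, is a basis of the solutions on `W` of the GKZ system. -/
def IsBasisOfGKZSolutions (n : ℕ) (W : Set (Fin (n - 1) → ℂ))
    (φ : Fin n → (Fin (n - 1) → ℂ) → ℂ) : Prop :=
  LinearIndependent ℂ (fun i => W.domRestrict (φ i)) ∧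
    (Submodule.span ℂ (Set.range fun i => W.domRestrict (φ i)) : Set (W → ℂ)) =
      {h | ∃ g, IsGKZSolution n W g ∧ W.domRestrict g = h}

/-- `ζ = exp(π√-1/n)`. -/
def zeta (n : ℕ) : ℂ := Complex.exp (Real.pi * Complex.I / n)

/-- `W(κ) = κ^n + x_{n-1} κ^{n-1} + ⋯ + x_1 κ + 1`. -/
def mirrorPoly (n : ℕ) (x : Fin (n - 1) → ℂ) : ℂ[X] :=
  X ^ n + ∑ i : Fin (n - 1), C (x i) * X ^ ((i : ℕ) + 1) + 1

/-- `κ_0(x), …, κ_{n-1}(x)` are, for `x` near `0`, the roots of `W` with multiplicity, numbered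
such that `κ_i(x) → ζ^{2i+1}` as `x → 0`. -/
def IsRootNumbering (n : ℕ) (κ : Fin n → (Fin (n - 1) → ℂ) → ℂ) : Prop :=
  (∀ᶠ x in 𝓝 (0 : Fin (n - 1) → ℂ),
      (mirrorPoly n x).roots = Finset.univ.val.map fun i => κ i x) ∧
    ∀ i : Fin n, Tendsto (κ i) (𝓝 0) (𝓝 (zeta n ^ (2 * (i : ℕ) + 1)))

/-- `L_i` is, for each `i`, the holomorphic branch on `U` of `log κ_i` with value
`(2i+1)π√-1/n` at `x = 0`. -/
def IsLogBranch (n : ℕ) (U : Set (Fin (n - 1) → ℂ)) (κ L : Fin n → (Fin (n - 1) → ℂ) → ℂ) : Prop :=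
  ∀ i : Fin n, DifferentiableOn ℂ (L i) U ∧ (∀ x ∈ U, Complex.exp (L i x) = κ i x) ∧
    L i 0 = (2 * (i : ℕ) + 1) * Real.pi * Complex.I / n

/-- The constant function `1` (index `0`) and the functions `L_i - L_{i-1}`, `1 ≤ i < n`. -/
def oneAndDifferences (n : ℕ) (L : Fin n → (Fin (n - 1) → ℂ) → ℂ) :
    Fin n → (Fin (n - 1) → ℂ) → ℂ :=
  fun i x => if (i : ℕ) = 0 then 1 else L i x - L ⟨i - 1, by omega⟩ x

/-- `D_0(k) = -(1/n) ∑_{i=1}^{n-1} (n-i) k_i`. -/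
def degZero (n : ℕ) (k : Fin (n - 1) → ℕ) : ℚ :=
  -(1 / n) * ∑ i : Fin (n - 1), ((n : ℚ) - ((i : ℕ) + 1)) * k i

/-- `D_n(k) = -(1/n) ∑_{i=1}^{n-1} i k_i`. -/
def degLast (n : ℕ) (k : Fin (n - 1) → ℕ) : ℚ :=
  -(1 / n) * ∑ i : Fin (n - 1), (((i : ℕ) : ℚ) + 1) * k i

/-- The term of index `k` in the series `f^r(x)`, which is present if `⟨-D_n(k)⟩ = r/n`. -/
def mirrorTerm (n r : ℕ) (x : Fin (n - 1) → ℂ) (k : Fin (n - 1) → ℕ) : ℂ :=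
  if Int.fract (-degLast n k) = (r : ℚ) / n then
    (∏ i, x i ^ k i / ((k i).factorial : ℂ)) *
      ((Real.Gamma (Int.fract (degZero n k) : ℚ) / Real.Gamma (1 + degZero n k : ℚ) : ℝ) : ℂ) *
      ((Real.Gamma (Int.fract (degLast n k) : ℚ) / Real.Gamma (1 + degLast n k : ℚ) : ℝ) : ℂ)
  else 0

/-- The hypergeometric flat co-ordinate `f^r(x)`, `1 ≤ r < n`. -/
def mirrorSeries (n r : ℕ) (x : Fin (n - 1) → ℂ) : ℂ :=
  ∑' k : Fin (n - 1) → ℕ, mirrorTerm n r x k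

/-- `(x_0, x_1, …, x_{n-1}) ↦ (x_1, …, x_{n-1})`. -/
def dropZero (n : ℕ) (x : Fin n → ℂ) : Fin (n - 1) → ℂ := fun i => x ⟨i + 1, by omega⟩

/-- The mirror map `(x_0, …, x_{n-1}) ↦ (τ^0, …, τ^{n-1})`, `τ^0 = x_0` and `τ^r = f^r(x)`. -/
def mirrorMap (n : ℕ) (x : Fin n → ℂ) : Fin n → ℂ :=
  fun r => if (r : ℕ) = 0 then x r else mirrorSeries n r (dropZero n x)

/-- `κ_k(τ) = ζ^{2k+1} ∏_{r=1}^{n-1} exp(ζ^{(2k+1)r} τ^r / n)`. -/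
def kappaOfTau (n : ℕ) (τ : Fin n → ℂ) (k : Fin n) : ℂ :=
  zeta n ^ (2 * (k : ℕ) + 1) *
    ∏ r : Fin (n - 1),
      Complex.exp (1 / n * zeta n ^ ((2 * (k : ℕ) + 1) * ((r : ℕ) + 1)) * dropZero n τ r)

/-- The elementary symmetric function `e_m(c_0, …, c_{n-1})`. -/
def elemSymm {n : ℕ} (m : ℕ) (c : Fin n → ℂ) : ℂ := (Finset.univ.val.map c).esymm m

/-- The map `τ ↦ x`, `x_0 = τ^0` and `x_i = (-1)^{n-i} e_{n-i}(κ_0(τ), …, κ_{n-1}(τ))`. -/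
def inverseMirrorMap (n : ℕ) (τ : Fin n → ℂ) : Fin n → ℂ :=
  fun i => if (i : ℕ) = 0 then τ i else (-1) ^ (n - i : ℕ) * elemSymm (n - i) (kappaOfTau n τ)

end

end TypeAMirror

/-!
The argument rests on the fact that the logarithms of the roots of the mirror polynomial and the
hypergeometric series `1, f^1, …, f^{n-1}` satisfy one and the same holonomic system of rank `n`.

*The system.* In the co-ordinates `x` the operators `ℷ_j` are diagonal on monomials
(`IsBranch.gimelProd_comp`), and with `d = -(e_a + ⋯ + e_b)` the GKZ equations say that
`∂_a ∂_b = ∂_{a-1} ∂_{b+1}`, where the derivatives along `x_0 = 1` and `x_n = 1` are those of the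
homogeneous extension. So `∂_a ∂_b` depends only on `a + b`, and homogeneity gives a linear system
for these quantities, `JetSystem`, which for `|x_i| < 1 / (2n)` is diagonally dominant. Hence the
second derivatives of a solution are bounded by the first ones, and a solution on a connected open
set is determined by its value and its gradient at one point (`eqOn_of_jet_eq`). In particular there
are at most `n` independent solutions.

*The solutions.* The coefficients of `f^r` satisfy the recursion that expresses the GKZ system, by
the functional equation of `Γ` (`mirrorCoeff_rel`), and the series converge for `|x_i| < 1/n`
(`norm_mirrorCoeff_le`). Their linear terms are `x_r`, so that `1, f^1, …, f^{n-1}` have independent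
jets at `0`, hence at every point, and every solution is a combination of them
(`exists_eqOn_solSer`).

*The logarithms.* By the implicit function theorem the roots near `ζ^{2i+1}` have holomorphic
logarithms (`exists_rootLogs`). Implicit differentiation shows that they satisfy `JetSystem`
(`IsRootLog.secondOrder`). Comparison of jets at `0` expresses them by the `f^r`
(`IsRootLog.eqOn_solSer`), and a Vandermonde determinant shows that `1` and the differences of
consecutive logarithms form a basis (`isBasisOfGKZSolutions_oneAndDifferences`).

*The inverse.* The formulas for `x` in terms of the roots are Vieta's. Conversely, for small `τ` the
numbers `κ_k(τ)` have product `(-1)^n`, so they are the roots of the mirror polynomial at the point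
`x` given by Vieta's formulas; by local uniqueness their logarithms are those found above, and the
Vandermonde determinant recovers `τ` (`eventually_flatCoord_coordOfRoots`).
-/

namespace TypeAMirror

noncomputable section

/-! ### Holomorphic functions of several variables -/

open MeasureTheory Metric in
/-- Cauchy's estimate along complex lines bounds the Fréchet derivative. -/
theorem norm_fderiv_le_of_bounded_ball {m : ℕ} {F : (Fin m → ℂ) → ℂ} {y : Fin m → ℂ} {ε C : ℝ}
    (hε : 0 < ε) (hF : DifferentiableOn ℂ F (ball y ε)) (hC : ∀ z ∈ ball y ε, ‖F z‖ ≤ C) :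
    ‖fderiv ℂ F y‖ ≤ C / (ε / 2) := by
  have hC0 : 0 ≤ C := (norm_nonneg _).trans (hC y (mem_ball_self hε))
  refine ContinuousLinearMap.opNorm_le_of_unit_norm (by positivity) fun v hv => ?_
  have hline : ∀ t : ℂ, t ∈ ball (0 : ℂ) ε → y + t • v ∈ ball y ε := by
    intro t ht
    simpa [dist_eq_norm, norm_smul, hv] using ht
  have hd : DifferentiableOn ℂ (fun t : ℂ => F (y + t • v)) (ball 0 ε) :=
    hF.comp (by fun_prop) hline
  have hderiv : HasDerivAt (fun t : ℂ => F (y + t • v)) (fderiv ℂ F y v) 0 := by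
    have h1 : HasFDerivAt F (fderiv ℂ F y) (y + (0 : ℂ) • v) := by
      simpa using (hF.differentiableAt (ball_mem_nhds y hε)).hasFDerivAt
    have h2 : HasDerivAt (fun t : ℂ => y + t • v) v 0 := by
      simpa using ((hasDerivAt_id (0 : ℂ)).smul_const v).const_add y
    exact h1.comp_hasDerivAt 0 h2
  rw [← hderiv.deriv]
  refine Complex.norm_deriv_le_of_forall_mem_sphere_norm_le (half_pos hε) ?_ ?_
  · refine (hd.mono ?_).diffContOnCl
    exact closure_ball_subset_closedBall.trans (closedBall_subset_ball (half_lt_self hε))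
  · intro z hz
    exact hC _ (hline z (closedBall_subset_ball (half_lt_self hε) (sphere_subset_closedBall hz)))

open MeasureTheory Metric in
/-- Directional derivatives of holomorphic functions of several variables are holomorphic: Cauchy's
formula on a circle in the direction `v` is differentiated under the integral sign. -/
theorem differentiableOn_fderiv_apply {m : ℕ} {F : (Fin m → ℂ) → ℂ} {O : Set (Fin m → ℂ)}
    (hO : IsOpen O) (hF : DifferentiableOn ℂ F O) (v : Fin m → ℂ) :
    DifferentiableOn ℂ (fun x => fderiv ℂ F x v) O := by
  intro x₀ hx₀
  refine DifferentiableAt.differentiableWithinAt ?_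
  obtain ⟨ε, hε, hball, C, hC⟩ : ∃ ε > 0, ball x₀ (3 * ε) ⊆ O ∧ ∃ C, ∀ z ∈ ball x₀ (3 * ε),
      ‖F z‖ ≤ C := by
    have hc : ContinuousAt F x₀ := (hF.differentiableAt (hO.mem_nhds hx₀)).continuousAt
    have h1 : ∀ᶠ z in 𝓝 x₀, ‖F z‖ ≤ ‖F x₀‖ + 1 := by
      have := hc.norm.eventually (gt_mem_nhds (lt_add_one ‖F x₀‖))
      exact this.mono fun _ h => h.le
    obtain ⟨δ, hδ, h⟩ := Metric.eventually_nhds_iff_ball.1 (h1.and (hO.eventually_mem hx₀))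
    refine ⟨δ / 3, by positivity, fun z hz => (h z ?_).2, ‖F x₀‖ + 1, fun z hz => (h z ?_).1⟩ <;>
    · convert hz using 2; ring
  have hC0 : 0 ≤ C := (norm_nonneg _).trans (hC x₀ (mem_ball_self (by positivity)))
  set R : ℝ := ε / (‖v‖ + 1) with hR
  have hv : 0 < ‖v‖ + 1 := by positivity
  have hR0 : 0 < R := by positivity
  have hRv : R * ‖v‖ < ε := by
    rw [hR, div_mul_eq_mul_div, div_lt_iff₀ hv]
    nlinarith [norm_nonneg v]
  have hmem : ∀ x ∈ ball x₀ ε, ∀ t : ℂ, ‖t‖ ≤ R → x + t • v ∈ ball x₀ (2 * ε) := by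
    intro x hx t ht
    rw [mem_ball, dist_eq_norm] at hx ⊢
    calc ‖x + t • v - x₀‖ = ‖(x - x₀) + t • v‖ := by congr 1; abel
      _ ≤ ‖x - x₀‖ + ‖t • v‖ := norm_add_le _ _
      _ < ε + ε := by
        refine add_lt_add hx (lt_of_le_of_lt ?_ hRv)
        rw [norm_smul]; gcongr
      _ = 2 * ε := by ring
  have hsub23 : ball x₀ (2 * ε) ⊆ ball x₀ (3 * ε) := ball_subset_ball (by linarith)
  have hdiff : ∀ z ∈ ball x₀ (2 * ε), DifferentiableAt ℂ F z := fun z hz =>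
    hF.differentiableAt (hO.mem_nhds (hball (hsub23 hz)))
  have hbd : ∀ z ∈ ball x₀ (2 * ε), ‖fderiv ℂ F z‖ ≤ C / (ε / 2) := by
    intro z hz
    have hzz : ball z ε ⊆ ball x₀ (3 * ε) := by
      refine ball_subset_ball' ?_
      rw [mem_ball] at hz
      linarith
    exact norm_fderiv_le_of_bounded_ball hε (hF.mono (hzz.trans hball)) fun w hw => hC w (hzz hw)
  -- Cauchy's formula for the derivative in the direction `v`, near `x₀`
  have hcauchy : ∀ x ∈ ball x₀ ε, fderiv ℂ F x v =
      (2 * Real.pi * Complex.I : ℂ)⁻¹ • ∫ θ in (0 : ℝ)..2 * Real.pi,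
        (deriv (circleMap 0 R) θ * ((circleMap 0 R θ) ^ 2)⁻¹) • F (x + circleMap 0 R θ • v) := by
    intro x hx
    have hU : IsOpen {t : ℂ | x + t • v ∈ ball x₀ (2 * ε)} :=
      isOpen_ball.preimage (by fun_prop)
    have hx2 : x ∈ ball x₀ (2 * ε) := ball_subset_ball (by linarith) hx
    have hderiv : HasDerivAt (fun t : ℂ => F (x + t • v)) (fderiv ℂ F x v) 0 := by
      have h1 : HasFDerivAt F (fderiv ℂ F x) (x + (0 : ℂ) • v) := by
        simpa using (hdiff x hx2).hasFDerivAt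
      have h2 : HasDerivAt (fun t : ℂ => x + t • v) v 0 := by
        simpa using ((hasDerivAt_id (0 : ℂ)).smul_const v).const_add x
      exact h1.comp_hasDerivAt 0 h2
    have := Complex.two_pi_I_inv_smul_circleIntegral_sub_sq_inv_smul_of_differentiable
      (f := fun t : ℂ => F (x + t • v)) (c := 0) (w₀ := 0) (R := R) hU
      (fun t ht => hmem x hx t (by simpa using ht)) (fun t ht =>
        ((hdiff _ ht).comp t (f := fun t : ℂ => x + t • v) (by fun_prop)).differentiableWithinAt)
      (mem_ball_self hR0)
    rw [hderiv.deriv] at this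
    rw [← this]
    simp only [circleIntegral, sub_zero, smul_smul]
  have hev : (fun x => fderiv ℂ F x v) =ᶠ[𝓝 x₀] fun x => (2 * Real.pi * Complex.I : ℂ)⁻¹ •
      ∫ θ in (0 : ℝ)..2 * Real.pi,
        (deriv (circleMap 0 R) θ * ((circleMap 0 R θ) ^ 2)⁻¹) • F (x + circleMap 0 R θ • v) := by
    filter_upwards [ball_mem_nhds x₀ hε] with x hx using hcauchy x hx
  refine DifferentiableAt.congr_of_eventuallyEq ?_ hev
  suffices h : DifferentiableAt ℂ (fun x => ∫ θ in (0 : ℝ)..2 * Real.pi,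
      (deriv (circleMap 0 R) θ * ((circleMap 0 R θ) ^ 2)⁻¹) • F (x + circleMap 0 R θ • v)) x₀ from
    h.const_smul ((2 * Real.pi * Complex.I : ℂ)⁻¹)
  have hcm : Continuous (circleMap 0 R) := continuous_circleMap 0 R
  have hne : ∀ θ : ℝ, circleMap 0 R θ ≠ 0 := fun θ => circleMap_ne_center hR0.ne'
  have hk : Continuous fun θ : ℝ => deriv (circleMap 0 R) θ * ((circleMap 0 R θ) ^ 2)⁻¹ := by
    simp only [deriv_circleMap]
    exact (hcm.mul continuous_const).mul ((hcm.pow 2).inv₀ fun θ => pow_ne_zero 2 (hne θ))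
  have hcont : ∀ x ∈ ball x₀ ε, Continuous fun θ : ℝ =>
      (deriv (circleMap 0 R) θ * ((circleMap 0 R θ) ^ 2)⁻¹) • F (x + circleMap 0 R θ • v) := by
    intro x hx
    refine hk.smul (continuous_iff_continuousAt.2 fun θ => ?_)
    have hz := hdiff _ (hmem x hx (circleMap 0 R θ) (by simp [abs_of_pos hR0]))
    exact ContinuousAt.comp (f := fun θ : ℝ => x + circleMap 0 R θ • v) hz.continuousAt
      (by fun_prop)
  have hmeas : Measurable (fderiv ℂ F) := measurable_fderiv ℂ F
  refine (intervalIntegral.hasFDerivAt_integral_of_dominated_of_fderiv_le (𝕜 := ℂ)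
    (F' := fun x θ => (deriv (circleMap 0 R) θ * ((circleMap 0 R θ) ^ 2)⁻¹) •
      fderiv ℂ F (x + circleMap 0 R θ • v)) (s := ball x₀ ε)
    (bound := fun θ => ‖deriv (circleMap 0 R) θ * ((circleMap 0 R θ) ^ 2)⁻¹‖ * (C / (ε / 2)))
    (ball_mem_nhds x₀ hε) ?_ ?_ ?_ ?_ ?_ ?_).differentiableAt
  · filter_upwards [ball_mem_nhds x₀ hε] with x hx using (hcont x hx).aestronglyMeasurable
  · exact (hcont x₀ (mem_ball_self hε)).intervalIntegrable _ _
  · refine hk.aestronglyMeasurable.smul ?_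
    have h2 : Measurable fun θ : ℝ => x₀ + circleMap 0 R θ • v :=
      Continuous.measurable (by fun_prop)
    exact (hmeas.comp h2).aestronglyMeasurable
  · refine .of_forall fun θ _ x hx => ?_
    rw [norm_smul]
    gcongr
    exact hbd _ (hmem x hx _ (by simp [abs_of_pos hR0]))
  · exact (hk.norm.mul continuous_const).intervalIntegrable _ _
  · refine .of_forall fun θ _ x hx => ?_
    have hz := (hdiff _ (hmem x hx (circleMap 0 R θ) (by simp [abs_of_pos hR0]))).hasFDerivAt
    have := hz.comp x ((hasFDerivAt_id (𝕜 := ℂ) x).add_const (circleMap 0 R θ • v))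
    simpa using! this.const_smul (deriv (circleMap 0 R) θ * ((circleMap 0 R θ) ^ 2)⁻¹)

/-- The partial derivative `∂F/∂x_i`. -/
def pder {m : ℕ} (i : Fin m) (F : (Fin m → ℂ) → ℂ) (x : Fin m → ℂ) : ℂ :=
  fderiv ℂ F x (Pi.single i 1)

theorem pder_differentiableOn {m : ℕ} {F : (Fin m → ℂ) → ℂ} {O : Set (Fin m → ℂ)}
    (hO : IsOpen O) (hF : DifferentiableOn ℂ F O) (i : Fin m) :
    DifferentiableOn ℂ (pder i F) O :=
  differentiableOn_fderiv_apply hO hF _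

theorem fderiv_apply_eq_sum_pder {m : ℕ} (F : (Fin m → ℂ) → ℂ) (x v : Fin m → ℂ) :
    fderiv ℂ F x v = ∑ i, v i * pder i F x := by
  conv_lhs => rw [pi_eq_sum_univ' v]
  simp only [map_sum, pder]
  refine Finset.sum_congr rfl fun i _ => ?_
  rw [← smul_eq_mul, ← map_smul]

theorem fderiv_eq_sum_pder {m : ℕ} (F : (Fin m → ℂ) → ℂ) (x : Fin m → ℂ) :
    fderiv ℂ F x = ∑ i, pder i F x • ContinuousLinearMap.proj (R := ℂ) (φ := fun _ => ℂ) i := by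
  ext v
  rw [fderiv_apply_eq_sum_pder]
  simp [mul_comm]

theorem pder_congr {m : ℕ} {F G : (Fin m → ℂ) → ℂ} {x : Fin m → ℂ} (h : F =ᶠ[𝓝 x] G) (i : Fin m) :
    pder i F x = pder i G x := by
  rw [pder, pder, h.fderiv_eq]

theorem pder_comm {m : ℕ} {F : (Fin m → ℂ) → ℂ} {O : Set (Fin m → ℂ)}
    (hO : IsOpen O) (hF : DifferentiableOn ℂ F O) {x : Fin m → ℂ} (hx : x ∈ O) (i j : Fin m) :
    pder i (pder j F) x = pder j (pder i F) x := by
  have hd : DifferentiableAt ℂ (fderiv ℂ F) x := by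
    have : fderiv ℂ F = fun x => ∑ i, pder i F x •
        ContinuousLinearMap.proj (R := ℂ) (φ := fun _ : Fin m => ℂ) i :=
      funext fun x => fderiv_eq_sum_pder F x
    rw [this]
    exact DifferentiableAt.fun_sum fun i _ => ((pder_differentiableOn hO hF i).differentiableAt
      (hO.mem_nhds hx)).smul_const _
  have hev : ∀ᶠ y in 𝓝 x, HasFDerivAt F (fderiv ℂ F y) y := by
    filter_upwards [hO.mem_nhds hx] with y hy
    exact (hF.differentiableAt (hO.mem_nhds hy)).hasFDerivAt
  have hs := second_derivative_symmetric_of_eventually hev hd.hasFDerivAt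
  have key : ∀ i j : Fin m, pder i (pder j F) x =
      fderiv ℂ (fderiv ℂ F) x (Pi.single i 1) (Pi.single j 1) := by
    intro i j
    have : pder j F = fun y => fderiv ℂ F y (Pi.single j 1) := rfl
    rw [this, pder, fderiv_clm_apply hd (differentiableAt_const _)]
    simp
  rw [key, key]
  exact hs _ _

/-- Identity theorem in several variables, proved along complex lines. -/
theorem eqOn_zero_of_eventuallyEq_zero {m : ℕ} {F : (Fin m → ℂ) → ℂ} {W : Set (Fin m → ℂ)}
    (hW : IsOpen W) (hc : IsPreconnected W) (hF : DifferentiableOn ℂ F W) {p : Fin m → ℂ}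
    (hp : p ∈ W) (h0 : F =ᶠ[𝓝 p] 0) : Set.EqOn F 0 W := by
  set A : Set (Fin m → ℂ) := {x | F =ᶠ[𝓝 x] 0} with hA
  have hAo : IsOpen A := isOpen_iff_mem_nhds.2 fun x hx => hx.eventually_nhds
  -- the set where `F` vanishes locally is open, and closed in `W`
  suffices hsub : W ⊆ A by
    intro x hx
    exact (hsub hx).eq_of_nhds
  refine hc.subset_of_closure_inter_subset hAo ⟨p, hp, h0⟩ ?_
  rintro x ⟨hxc, hxW⟩
  obtain ⟨ε, hε, hball⟩ := Metric.isOpen_iff.1 hW x hxW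
  obtain ⟨q, hqA, hq⟩ := Metric.mem_closure_iff.1 hxc ε hε
  have hqb : q ∈ Metric.ball x ε := by rwa [Metric.mem_ball, dist_comm]
  change F =ᶠ[𝓝 x] 0
  filter_upwards [Metric.ball_mem_nhds x hε] with r hr
  -- the one-variable identity theorem on the complex line through `q` and `r`
  set ℓ : ℂ → (Fin m → ℂ) := fun t => q + t • (r - q) with hℓ
  have hℓd : Differentiable ℂ ℓ := by fun_prop
  have hT : IsOpen (ℓ ⁻¹' Metric.ball x ε) := Metric.isOpen_ball.preimage hℓd.continuous
  have hTc : Convex ℝ (ℓ ⁻¹' Metric.ball x ε) := by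
    intro s hs t ht a b ha hb hab
    have : ℓ (a • s + b • t) = a • ℓ s + b • ℓ t := by
      have ha' : (a : ℂ) + b = 1 := by exact_mod_cast hab
      ext i
      simp only [hℓ, Pi.add_apply, Pi.smul_apply, Pi.sub_apply, smul_eq_mul, Complex.real_smul]
      linear_combination (-(q i)) * ha'
    rw [Set.mem_preimage, this]
    exact convex_ball x ε hs ht ha hb hab
  have han : AnalyticOnNhd ℂ (F ∘ ℓ) (ℓ ⁻¹' Metric.ball x ε) :=
    (hF.comp hℓd.differentiableOn fun t ht => hball ht).analyticOnNhd hT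
  have h0T : (0 : ℂ) ∈ ℓ ⁻¹' Metric.ball x ε := by simpa [hℓ] using hqb
  have hz : (F ∘ ℓ) =ᶠ[𝓝 0] 0 := by
    have : Tendsto ℓ (𝓝 0) (𝓝 q) := by
      have := hℓd.continuous.tendsto 0
      simpa [hℓ] using this
    exact this.eventually hqA
  have := han.eqOn_zero_of_preconnected_of_eventuallyEq_zero hTc.isPreconnected h0T hz
    (x := 1) (by simpa [hℓ] using hr)
  simpa [hℓ] using this

/-! ### The GKZ operators in the co-ordinates `x` -/

/-- The coefficients of `ℷ_j` in terms of the operators `x_l ∂/∂x_l`. They are also the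
coefficients of the linear forms `D_j`, see `deg`. -/
def wt (n : ℕ) (j : Fin (n + 1)) (l : Fin (n - 1)) : ℚ :=
  if (j : ℕ) = 0 then -((n : ℚ) - ((l : ℕ) + 1)) / n
  else if (j : ℕ) = n then -(((l : ℕ) : ℚ) + 1) / n
  else if (j : ℕ) = l + 1 then 1 else 0

/-- A row of `M`, paired with a function vanishing at both ends, is a second difference. -/
theorem sum_galeMatrix_mul {K : Type*} [CommRing K] {n : ℕ} (i : Fin (n - 1)) (φ : ℕ → K) :
    ∑ l : Fin (n - 1), (galeMatrix n i ⟨l + 1, by omega⟩ : K) * φ (l + 1) =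
      φ i - 2 * φ (i + 1) + φ (i + 2) - (if (i : ℕ) = 0 then φ 0 else 0)
        - (if (i : ℕ) + 2 = n then φ n else 0) := by
  set f : ℕ → K := fun j => (if j = i then 1 else if j = i + 1 then -2 else
    if j = i + 2 then 1 else 0) * φ j with hf
  have h1 : ∑ l : Fin (n - 1), (galeMatrix n i ⟨l + 1, by omega⟩ : K) * φ (l + 1) =
      ∑ l ∈ Finset.range (n - 1), f (l + 1) := by
    rw [← Fin.sum_univ_eq_sum_range (fun l => f (l + 1)) (n - 1)]
    refine Finset.sum_congr rfl fun l _ => ?_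
    simp only [galeMatrix, hf]
    push_cast
    rfl
  have h2 : ∑ j ∈ Finset.range (n + 1), f j = φ i - 2 * φ (i + 1) + φ (i + 2) := by
    have hsplit : ∀ j, f j = (if j = (i : ℕ) then φ j else 0) + (if j = (i : ℕ) + 1 then -2 * φ j
        else 0) + (if j = (i : ℕ) + 2 then φ j else 0) := by
      intro j
      simp only [hf]
      split_ifs <;> first | omega | ring
    simp only [hsplit, Finset.sum_add_distrib, Finset.sum_ite_eq', Finset.mem_range]
    have := i.2
    rw [if_pos (by omega), if_pos (by omega), if_pos (by omega)]
    ring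
  have hn : n + 1 = (n - 1 + 1) + 1 := by have := i.2; omega
  rw [hn, Finset.sum_range_succ, Finset.sum_range_succ'] at h2
  have e0 : f 0 = if (i : ℕ) = 0 then φ 0 else 0 := by
    by_cases h : (i : ℕ) = 0
    · simp [hf, h]
    · simp [hf, h, Ne.symm h]
  have en : f (n - 1 + 1) = if (i : ℕ) + 2 = n then φ n else 0 := by
    have := i.2
    rw [show n - 1 + 1 = n by omega]
    simp only [hf]
    split_ifs <;> first | omega | ring
  rw [h1, ← h2, e0, en]
  ring

/-- The rows of `M` annihilate the affine functions of `j`; hence the columns `0` and `n` of `M`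
are determined by the others. -/
theorem galeMatrix_eq_sum {n : ℕ} (i : Fin (n - 1)) (j : Fin (n + 1)) :
    (galeMatrix n i j : ℚ) =
      ∑ l : Fin (n - 1), (galeMatrix n i ⟨l + 1, by omega⟩ : ℚ) * wt n j l := by
  have hi := i.2
  have hn : (n : ℚ) ≠ 0 := by
    have : n ≠ 0 := by omega
    exact_mod_cast this
  rcases eq_or_ne (j : ℕ) 0 with h0 | h0
  · have := sum_galeMatrix_mul (K := ℚ) i (fun l => -((n : ℚ) - l) / n)
    simp only [wt, h0, if_true]
    push_cast at this
    rw [this]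
    simp only [galeMatrix, h0]
    by_cases hi0 : (i : ℕ) = 0
    · simp [hi0]; field_simp; ring
    · rw [if_neg (by omega), if_neg (by omega), if_neg (by omega)]
      simp [hi0]; field_simp; ring
  rcases eq_or_ne (j : ℕ) n with hj | hj
  · have := sum_galeMatrix_mul (K := ℚ) i (fun l => -(l : ℚ) / n)
    have h0' : n ≠ 0 := by omega
    simp only [wt, hj, h0', if_true, if_false]
    push_cast at this
    rw [this]
    simp only [galeMatrix, hj]
    by_cases hi0 : (i : ℕ) + 2 = n
    · rw [if_neg (by omega), if_neg (by omega), if_pos (by omega)]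
      simp [hi0]; field_simp; ring
    · rw [if_neg (by omega), if_neg (by omega), if_neg (by omega)]
      simp [hi0]; field_simp; ring
  · have hj2 := j.2
    rw [Finset.sum_eq_single ⟨j - 1, by omega⟩]
    · have : (j : ℕ) - 1 + 1 = j := by omega
      simp [wt, h0, hj, this]
    · intro l _ hl
      have : (j : ℕ) ≠ l + 1 := by
        intro h
        apply hl
        ext
        simp [h]
      simp [wt, h0, hj, this]
    · simp

theorem dualDegree_eq_sum {n : ℕ} (d : Fin (n - 1) → ℤ) (j : Fin (n + 1)) :
    (dualDegree n d j : ℚ) =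
      ∑ l : Fin (n - 1), wt n j l * (dualDegree n d ⟨l + 1, by omega⟩ : ℚ) := by
  simp only [dualDegree]
  push_cast
  simp_rw [Finset.mul_sum]
  rw [Finset.sum_comm]
  refine Finset.sum_congr rfl fun i _ => ?_
  rw [galeMatrix_eq_sum, Finset.sum_mul]
  refine Finset.sum_congr rfl fun l _ => ?_
  ring

/-- The `(n-1) × (n-1)` block of `M` formed by the columns `1, …, n-1`. -/
def innerMatrix (n : ℕ) : Matrix (Fin (n - 1)) (Fin (n - 1)) ℂ :=
  fun i l => galeMatrix n i ⟨l + 1, by omega⟩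

/-- A vector in the kernel is a sequence with vanishing second differences, hence affine, and it
vanishes at `0` and `n`. -/
theorem innerMatrix_det_ne_zero (n : ℕ) : (innerMatrix n).det ≠ 0 := by
  rw [Ne, ← Matrix.exists_mulVec_eq_zero_iff]
  rintro ⟨v, hv0, hv⟩
  apply hv0
  set φ : ℕ → ℂ := fun j => if h : 1 ≤ j ∧ j < n then v ⟨j - 1, by omega⟩ else 0 with hφ
  have hφ0 : φ 0 = 0 := by simp [hφ]
  have hφn : φ n = 0 := by simp [hφ]
  have hφv : ∀ l : Fin (n - 1), φ (l + 1) = v l := by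
    intro l
    have := l.2
    simp only [hφ]
    rw [dif_pos (by omega)]
    rfl
  have hrec : ∀ i, i + 2 ≤ n → φ i - 2 * φ (i + 1) + φ (i + 2) = 0 := by
    intro i hi
    have h1 := sum_galeMatrix_mul (K := ℂ) (n := n) ⟨i, by omega⟩ φ
    have h2 := congrFun hv ⟨i, by omega⟩
    simp only [Matrix.mulVec, dotProduct, innerMatrix, Pi.zero_apply] at h2
    simp only [hφv, h2, hφ0, hφn, ite_self, sub_zero] at h1
    exact h1.symm
  have hlin : ∀ i, i + 1 ≤ n → φ i = i * φ 1 ∧ φ (i + 1) = (i + 1) * φ 1 := by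
    intro i
    induction i with
    | zero => intro _; simp [hφ0]
    | succ i ih =>
      intro hi
      obtain ⟨h1, h2⟩ := ih (by omega)
      refine ⟨by push_cast; exact h2, ?_⟩
      have := hrec i (by omega)
      push_cast
      linear_combination this - h1 + 2 * h2
  funext l
  have hl := l.2
  have hn := (hlin (n - 1) (by omega)).2
  rw [show n - 1 + 1 = n by omega, hφn] at hn
  have hne : (((n - 1 : ℕ) : ℂ) + 1) ≠ 0 := by exact_mod_cast Nat.succ_ne_zero (n - 1)
  have h1 : φ 1 = 0 := by
    rcases mul_eq_zero.1 hn.symm with h | h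
    · exact absurd h hne
    · exact h
  rw [← hφv, (hlin l (by omega)).2, h1]
  simp

/-- The operator `ℷ_j` in the co-ordinates `x`. -/
def opX (n : ℕ) (j : Fin (n + 1)) (g : (Fin (n - 1) → ℂ) → ℂ) : (Fin (n - 1) → ℂ) → ℂ :=
  fun x => ∑ l, (wt n j l : ℂ) * (x l * pder l g x)

/-- `∏_{m=0}^{p-1} (ℷ_j - m)` in the co-ordinates `x`. -/
def fallingX (n : ℕ) (j : Fin (n + 1)) :
    ℕ → ((Fin (n - 1) → ℂ) → ℂ) → (Fin (n - 1) → ℂ) → ℂ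
  | 0, F => F
  | p + 1, F => fun x => opX n j (fallingX n j p F) x - (p : ℂ) * fallingX n j p F x

/-- `∏_j ∏_{m=0}^{p_j-1} (ℷ_j - m)` in the co-ordinates `x`. -/
def prodX (n : ℕ) (p : Fin (n + 1) → ℕ) (F : (Fin (n - 1) → ℂ) → ℂ) :
    (Fin (n - 1) → ℂ) → ℂ :=
  (List.finRange (n + 1)).foldr (fun j G => fallingX n j (p j) G) F

theorem opX_differentiableOn {n : ℕ} {g : (Fin (n - 1) → ℂ) → ℂ} {W : Set (Fin (n - 1) → ℂ)}
    (hW : IsOpen W) (hg : DifferentiableOn ℂ g W) (j : Fin (n + 1)) :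
    DifferentiableOn ℂ (opX n j g) W := by
  unfold opX
  refine DifferentiableOn.fun_sum fun l _ => DifferentiableOn.const_mul ?_ _
  exact DifferentiableOn.mul (by fun_prop) (pder_differentiableOn hW hg l)

/-- `s` is a holomorphic local branch on `V` of the inverse of `x ↦ y`. -/
structure IsBranch (n : ℕ) (V : Set (Fin (n - 1) → ℂ))
    (s : (Fin (n - 1) → ℂ) → (Fin (n - 1) → ℂ)) : Prop where
  isOpen : IsOpen V
  subset_torus : V ⊆ torus n
  differentiableOn : DifferentiableOn ℂ s V
  yOfX_eq : ∀ y ∈ V, yOfX n (s y) = y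

theorem ne_zero_of_yOfX_mem_torus {n : ℕ} {x : Fin (n - 1) → ℂ} (hx : yOfX n x ∈ torus n)
    (j : Fin (n - 1)) : x j ≠ 0 := by
  intro h
  refine hx j (Finset.prod_eq_zero (Finset.mem_univ j) ?_)
  rw [h]
  refine zero_zpow _ ?_
  simp [galeMatrix]

theorem IsBranch.ne_zero {n : ℕ} {V : Set (Fin (n - 1) → ℂ)}
    {s : (Fin (n - 1) → ℂ) → (Fin (n - 1) → ℂ)} (h : IsBranch n V s) {y : Fin (n - 1) → ℂ}
    (hy : y ∈ V) (j : Fin (n - 1)) : s y j ≠ 0 :=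
  ne_zero_of_yOfX_mem_torus (by rw [h.yOfX_eq y hy]; exact h.subset_torus hy) j

/-- The logarithmic derivative of `y = ∏ x_j ^ M_{ij}`. -/
theorem IsBranch.sum_galeMatrix_logDeriv {n : ℕ} {V : Set (Fin (n - 1) → ℂ)}
    {s : (Fin (n - 1) → ℂ) → (Fin (n - 1) → ℂ)} (h : IsBranch n V s) {y : Fin (n - 1) → ℂ}
    (hy : y ∈ V) (k i : Fin (n - 1)) :
    ∑ l, innerMatrix n k l * (y i * pder i (fun y => s y l) y / s y l) =
      if k = i then 1 else 0 := by
  set ℓ : ℂ → (Fin (n - 1) → ℂ) := fun t => y + t • Pi.single i 1 with hℓ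
  have hℓ0 : ℓ 0 = y := by simp [hℓ]
  have hsd : DifferentiableAt ℂ s y := h.differentiableOn.differentiableAt (h.isOpen.mem_nhds hy)
  have hsl : ∀ l, DifferentiableAt ℂ (fun y => s y l) y := fun l => by
    exact (differentiableAt_pi.1 hsd) l
  have hℓd : HasDerivAt ℓ (Pi.single i 1) 0 := by
    have := ((hasDerivAt_id (0 : ℂ)).smul_const (Pi.single i (1 : ℂ) : Fin (n - 1) → ℂ)).const_add y
    rw [one_smul] at this
    exact this
  have hσ : ∀ l, HasDerivAt (fun t => s (ℓ t) l) (pder i (fun y => s y l) y) 0 := by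
    intro l
    have h1 : HasFDerivAt (fun y => s y l) (fderiv ℂ (fun y => s y l) y) (ℓ 0) := by
      rw [hℓ0]; exact (hsl l).hasFDerivAt
    exact h1.comp_hasDerivAt 0 hℓd
  have hev : (fun t => ∏ l, (s (ℓ t) l) ^ galeMatrix n k ⟨l + 1, by omega⟩) =ᶠ[𝓝 0]
      fun t => ℓ t k := by
    have : Tendsto ℓ (𝓝 0) (𝓝 y) := by
      have := hℓd.continuousAt.tendsto
      rwa [hℓ0] at this
    filter_upwards [this.eventually (h.isOpen.mem_nhds hy)] with t ht
    exact congrFun (h.yOfX_eq _ ht) k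
  have hld : logDeriv (fun t => ∏ l, (s (ℓ t) l) ^ galeMatrix n k ⟨l + 1, by omega⟩) 0 =
      logDeriv (fun t => ℓ t k) 0 := by
    rw [logDeriv, logDeriv, Pi.div_apply, Pi.div_apply, hev.deriv_eq, hev.eq_of_nhds]
  rw [logDeriv_prod] at hld
  · simp_rw [logDeriv_fun_zpow (hσ _).differentiableAt] at hld
    have hR : HasDerivAt (fun t => ℓ t k) ((Pi.single i (1 : ℂ) : Fin (n - 1) → ℂ) k) 0 :=
      hasDerivAt_pi.1 hℓd k
    simp only [logDeriv, Pi.div_apply, (hσ _).deriv, hR.deriv, hℓ0] at hld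
    have hy0 : y k ≠ 0 := h.subset_torus hy k
    calc _ = y i * ∑ l : Fin (n - 1), (galeMatrix n k ⟨l + 1, by omega⟩ : ℂ) *
          (pder i (fun y => s y l) y / s y l) := by
          rw [Finset.mul_sum]
          refine Finset.sum_congr rfl fun l _ => ?_
          simp only [innerMatrix]
          ring
      _ = y i * ((Pi.single i (1 : ℂ) : Fin (n - 1) → ℂ) k / y k) := by rw [hld]
      _ = _ := by
        by_cases hk : k = i
        · subst hk; simp [hy0]
        · simp [hk]
  · intro l _
    rw [hℓ0]
    exact zpow_ne_zero _ (h.ne_zero hy l)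
  · intro l _
    refine DifferentiableAt.zpow (hσ l).differentiableAt (Or.inl ?_)
    rw [hℓ0]
    exact h.ne_zero hy l

/-- In the co-ordinates `x` the operator `ℷ_j` becomes `opX n j`. The matrix of logarithmic
derivatives of a branch `x = s(y)` is the inverse of `innerMatrix n`. -/
theorem IsBranch.gimel_comp {n : ℕ} {V W : Set (Fin (n - 1) → ℂ)}
    {s : (Fin (n - 1) → ℂ) → (Fin (n - 1) → ℂ)} (h : IsBranch n V s) (hs : Set.MapsTo s V W)
    (hW : IsOpen W) {g : (Fin (n - 1) → ℂ) → ℂ} (hg : DifferentiableOn ℂ g W)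
    {F : (Fin (n - 1) → ℂ) → ℂ} (hF : Set.EqOn F (g ∘ s) V) (j : Fin (n + 1)) :
    Set.EqOn (gimel n j F) (opX n j g ∘ s) V := by
  intro y hy
  have hev : F =ᶠ[𝓝 y] g ∘ s := by
    filter_upwards [h.isOpen.mem_nhds hy] with z hz using hF hz
  have hsd : DifferentiableAt ℂ s y := h.differentiableOn.differentiableAt (h.isOpen.mem_nhds hy)
  have hgd : DifferentiableAt ℂ g (s y) := hg.differentiableAt (hW.mem_nhds (hs hy))
  set N : Matrix (Fin (n - 1)) (Fin (n - 1)) ℂ :=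
    fun l i => y i * pder i (fun y => s y l) y / s y l with hN
  have hMN : innerMatrix n * N = 1 := by
    ext k i
    rw [Matrix.mul_apply, Matrix.one_apply]
    exact h.sum_galeMatrix_logDeriv hy k i
  have hNM : N * innerMatrix n = 1 := mul_eq_one_comm.1 hMN
  have hpd : ∀ i, y i * pder i F y = ∑ l, s y l * pder l g (s y) * N l i := by
    intro i
    rw [pder_congr hev, pder, fderiv_comp y hgd hsd, ContinuousLinearMap.comp_apply,
      fderiv_apply_eq_sum_pder, Finset.mul_sum]
    refine Finset.sum_congr rfl fun l _ => ?_
    have : fderiv ℂ s y (Pi.single i 1) l = pder i (fun y => s y l) y := by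
      rw [pder, fderiv_pi (fun l => (differentiableAt_pi.1 hsd) l)]
      rfl
    rw [this, hN]
    have := h.ne_zero hy l
    field_simp
  have hNg : ∀ l, ∑ i, N l i * (galeMatrix n i j : ℂ) = (wt n j l : ℂ) := by
    intro l
    have hM : ∀ i, (galeMatrix n i j : ℂ) = ∑ m, innerMatrix n i m * (wt n j m : ℂ) := by
      intro i
      have := congrArg (fun q : ℚ => (q : ℂ)) (galeMatrix_eq_sum i j)
      push_cast at this
      exact this
    simp_rw [hM, Finset.mul_sum]
    rw [Finset.sum_comm]
    have : ∀ m, ∑ i, N l i * (innerMatrix n i m * (wt n j m : ℂ)) =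
        (if l = m then 1 else 0) * (wt n j m : ℂ) := by
      intro m
      rw [← Matrix.one_apply, ← hNM, Matrix.mul_apply, Finset.sum_mul]
      exact Finset.sum_congr rfl fun i _ => by ring
    simp_rw [this]
    simp
  change ∑ i, (galeMatrix n i j : ℂ) * (y i * pder i F y) =
    ∑ l, (wt n j l : ℂ) * (s y l * pder l g (s y))
  simp_rw [hpd, Finset.mul_sum]
  rw [Finset.sum_comm]
  refine Finset.sum_congr rfl fun l _ => ?_
  rw [← hNg, Finset.sum_mul]
  exact Finset.sum_congr rfl fun i _ => by ring

theorem IsBranch.fallingGimel_comp {n : ℕ} {V W : Set (Fin (n - 1) → ℂ)}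
    {s : (Fin (n - 1) → ℂ) → (Fin (n - 1) → ℂ)} (h : IsBranch n V s) (hs : Set.MapsTo s V W)
    (hW : IsOpen W) {g : (Fin (n - 1) → ℂ) → ℂ} (hg : DifferentiableOn ℂ g W)
    {F : (Fin (n - 1) → ℂ) → ℂ} (hF : Set.EqOn F (g ∘ s) V) (j : Fin (n + 1)) (p : ℕ) :
    Set.EqOn (fallingGimel n j p F) (fallingX n j p g ∘ s) V ∧
      DifferentiableOn ℂ (fallingX n j p g) W := by
  induction p with
  | zero => exact ⟨hF, hg⟩
  | succ p ih =>
    refine ⟨fun y hy => ?_, ?_⟩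
    · have h1 := h.gimel_comp hs hW ih.2 ih.1 j hy
      have h2 := ih.1 hy
      simp only [fallingGimel, h1, h2]
      rfl
    · exact (opX_differentiableOn hW ih.2 j).sub (ih.2.const_mul _)

theorem IsBranch.gimelProd_comp {n : ℕ} {V W : Set (Fin (n - 1) → ℂ)}
    {s : (Fin (n - 1) → ℂ) → (Fin (n - 1) → ℂ)} (h : IsBranch n V s) (hs : Set.MapsTo s V W)
    (hW : IsOpen W) {g : (Fin (n - 1) → ℂ) → ℂ} (hg : DifferentiableOn ℂ g W)
    (p : Fin (n + 1) → ℕ) :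
    Set.EqOn (gimelProd n p (g ∘ s)) (prodX n p g ∘ s) V := by
  suffices H : ∀ L : List (Fin (n + 1)),
      Set.EqOn (L.foldr (fun j G => fallingGimel n j (p j) G) (g ∘ s))
        (L.foldr (fun j G => fallingX n j (p j) G) g ∘ s) V ∧
      DifferentiableOn ℂ (L.foldr (fun j G => fallingX n j (p j) G) g) W from (H _).1
  intro L
  induction L with
  | nil => exact ⟨fun _ _ => rfl, hg⟩
  | cons j L ih => exact h.fallingGimel_comp hs hW ih.2 ih.1 j (p j)

/-- `y^d = x^{D'(d)}`. -/
theorem prod_yOfX_zpow {n : ℕ} {x : Fin (n - 1) → ℂ} (hx : ∀ l, x l ≠ 0) (d : Fin (n - 1) → ℤ) :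
    ∏ i, yOfX n x i ^ d i = ∏ l, x l ^ dualDegree n d ⟨l + 1, by omega⟩ := by
  simp only [yOfX, dualDegree]
  simp_rw [← Finset.prod_zpow, ← zpow_mul]
  rw [Finset.prod_comm]
  refine Finset.prod_congr rfl fun l _ => ?_
  generalize (Finset.univ : Finset (Fin (n - 1))) = S
  induction S using Finset.induction_on with
  | empty => simp
  | insert i S hi ih => rw [Finset.prod_insert hi, Finset.sum_insert hi, zpow_add₀ (hx l), ih]

/-- `x ↦ y` has a local holomorphic inverse at every point of the torus: on logarithms the map is
linear with matrix `innerMatrix n`. -/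
theorem exists_isBranch {n : ℕ} {W : Set (Fin (n - 1) → ℂ)} (hW : IsOpen W) {x : Fin (n - 1) → ℂ}
    (hxW : x ∈ W) (hx : ∀ l, x l ≠ 0) :
    ∃ V s, IsBranch n V s ∧ Set.MapsTo s V W ∧ yOfX n x ∈ V ∧ s (yOfX n x) = x := by
  set q := yOfX n x with hq
  have hq0 : ∀ i, q i ≠ 0 := fun i => Finset.prod_ne_zero_iff.2 fun l _ => zpow_ne_zero _ (hx l)
  set N := (innerMatrix n)⁻¹ with hN
  have hMN : innerMatrix n * N = 1 :=
    Matrix.mul_nonsing_inv _ (isUnit_iff_ne_zero.2 (innerMatrix_det_ne_zero n))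
  set s : (Fin (n - 1) → ℂ) → (Fin (n - 1) → ℂ) := fun y l =>
    x l * Complex.exp (∑ i, N l i * Complex.log (y i / q i)) with hs
  set V₀ : Set (Fin (n - 1) → ℂ) := {y | ∀ i, y i / q i ∈ Complex.slitPlane} with hV₀
  have hV₀o : IsOpen V₀ := by
    rw [hV₀, Set.ofPred_forall]
    refine isOpen_iInter_of_finite fun i => ?_
    exact Complex.isOpen_slitPlane.preimage (by fun_prop)
  have hsd : DifferentiableOn ℂ s V₀ := by
    refine differentiableOn_pi.2 fun l => ?_
    refine DifferentiableOn.const_mul (DifferentiableOn.cexp ?_) _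
    refine DifferentiableOn.fun_sum fun i _ => DifferentiableOn.const_mul ?_ _
    exact DifferentiableOn.clog (by fun_prop) fun y hy => hy i
  have hqV : q ∈ V₀ := fun i => by rw [div_self (hq0 i)]; exact Complex.one_mem_slitPlane
  have hsq : s q = x := by
    funext l
    simp [hs, div_self (hq0 _)]
  refine ⟨V₀ ∩ s ⁻¹' W, s, ⟨hsd.continuousOn.isOpen_inter_preimage hV₀o hW, ?_,
    hsd.mono Set.inter_subset_left, ?_⟩, fun y hy => hy.2, ⟨hqV, ?_⟩, hsq⟩
  · rintro y ⟨hy, -⟩ i h0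
    have := hy i
    rw [h0, zero_div] at this
    exact Complex.zero_notMem_slitPlane this
  · rintro y ⟨hy, -⟩
    funext k
    have hlog : ∑ l, innerMatrix n k l * ∑ i, N l i * Complex.log (y i / q i) =
        Complex.log (y k / q k) := by
      have := congrFun (congrArg (fun A => A.mulVec fun i => Complex.log (y i / q i)) hMN) k
      rw [← Matrix.mulVec_mulVec, Matrix.one_mulVec] at this
      exact this
    have hyk : y k / q k ≠ 0 := Complex.slitPlane_ne_zero (hy k)
    calc yOfX n (s y) k = (∏ l, x l ^ galeMatrix n k ⟨l + 1, by omega⟩) *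
          ∏ l, Complex.exp (innerMatrix n k l * ∑ i, N l i * Complex.log (y i / q i)) := by
          rw [yOfX, ← Finset.prod_mul_distrib]
          refine Finset.prod_congr rfl fun l _ => ?_
          simp only [hs, innerMatrix]
          rw [mul_zpow, ← Complex.exp_int_mul]
      _ = q k * (y k / q k) := by
          rw [← Complex.exp_sum, hlog, Complex.exp_log hyk]; rfl
      _ = y k := by field_simp [hq0 k]
  · rw [Set.mem_preimage, hsq]; exact hxW

/-! ### Power series in several variables and the operators `ℷ_j` -/

/-- The monomial `x^k`. -/
def mon {m : ℕ} (x : Fin m → ℂ) (k : Fin m → ℕ) : ℂ := ∏ l, x l ^ k l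

/-- The sum of the power series with coefficients `c`. -/
def ser {m : ℕ} (c : (Fin m → ℕ) → ℂ) (x : Fin m → ℂ) : ℂ := ∑' k, c k * mon x k

/-- The power series with coefficients `c` converges absolutely on every closed polydisc of
radius less than `R`. -/
def ConvergesOn {m : ℕ} (R : ℝ) (c : (Fin m → ℕ) → ℂ) : Prop :=
  ∀ ρ : ℝ, 0 ≤ ρ → ρ < R → Summable fun k => ‖c k‖ * ρ ^ (∑ l, k l)

theorem norm_mon_le {m : ℕ} {x : Fin m → ℂ} {ρ : ℝ} (hx : ‖x‖ ≤ ρ) (k : Fin m → ℕ) :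
    ‖mon x k‖ ≤ ρ ^ (∑ l, k l) := by
  rw [mon, norm_prod, ← Finset.prod_pow_eq_pow_sum]
  refine Finset.prod_le_prod (fun _ _ => norm_nonneg _) fun l _ => ?_
  rw [norm_pow]
  gcongr
  exact (norm_le_pi_norm x l).trans hx

theorem mon_add {m : ℕ} (x : Fin m → ℂ) (k k' : Fin m → ℕ) :
    mon x (k + k') = mon x k * mon x k' := by
  simp [mon, pow_add, Finset.prod_mul_distrib]

theorem ConvergesOn.summable {m : ℕ} {R : ℝ} {c : (Fin m → ℕ) → ℂ} (hc : ConvergesOn R c)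
    {x : Fin m → ℂ} (hx : ‖x‖ < R) : Summable fun k => c k * mon x k := by
  refine Summable.of_norm_bounded (hc ‖x‖ (norm_nonneg _) hx) fun k => ?_
  rw [norm_mul]
  gcongr
  exact norm_mon_le le_rfl k

/-- Factors of linear growth in the index do not change the polydisc of convergence. -/
theorem ConvergesOn.mul_of_linear_bound {m : ℕ} {R C : ℝ} {c : (Fin m → ℕ) → ℂ}
    (hc : ConvergesOn R c) {a : (Fin m → ℕ) → ℂ} (ha : ∀ k, ‖a k‖ ≤ C * (∑ l, k l : ℕ)) :
    ConvergesOn R fun k => a k * c k := by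
  intro ρ h0 hρ
  obtain ⟨ρ', h1, h2⟩ := exists_between hρ
  have hρ' : 0 < ρ' := h0.trans_lt h1
  have ht := tendsto_self_mul_const_pow_of_lt_one (r := ρ / ρ') (by positivity)
    ((div_lt_one hρ').2 h1)
  obtain ⟨B, hB⟩ := ht.bddAbove_range
  have hB' : ∀ N : ℕ, N * ρ ^ N ≤ B * ρ' ^ N := by
    intro N
    have := hB ⟨N, rfl⟩
    simp only [div_pow] at this
    have hp : 0 < ρ' ^ N := by positivity
    calc N * ρ ^ N = (N * (ρ ^ N / ρ' ^ N)) * ρ' ^ N := by field_simp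
      _ ≤ B * ρ' ^ N := by gcongr
  have hC : 0 ≤ |C| := abs_nonneg C
  refine Summable.of_nonneg_of_le (fun k => by positivity) (fun k => ?_)
    ((hc ρ' hρ'.le h2).mul_left (|C| * B))
  rw [norm_mul]
  calc ‖a k‖ * ‖c k‖ * ρ ^ (∑ l, k l)
      ≤ (|C| * (∑ l, k l : ℕ)) * ‖c k‖ * ρ ^ (∑ l, k l) := by
        gcongr
        exact (ha k).trans (by gcongr; exact le_abs_self C)
    _ = |C| * ‖c k‖ * ((∑ l, k l : ℕ) * ρ ^ (∑ l, k l)) := by ring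
    _ ≤ |C| * ‖c k‖ * (B * ρ' ^ (∑ l, k l)) := by
        refine mul_le_mul_of_nonneg_left (hB' _) (by positivity)
    _ = |C| * B * (‖c k‖ * ρ' ^ (∑ l, k l)) := by ring

theorem hasFDerivAt_mon {m : ℕ} (k : Fin m → ℕ) (x : Fin m → ℂ) :
    HasFDerivAt (fun x => mon x k) (∑ i, (∏ j ∈ Finset.univ.erase i, x j ^ k j) •
      ((k i * x i ^ (k i - 1)) • ContinuousLinearMap.proj (R := ℂ) (φ := fun _ => ℂ) i)) x := by
  unfold mon
  refine HasFDerivAt.finsetProd fun i _ => ?_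
  exact (hasDerivAt_pow (k i) (x i)).comp_hasFDerivAt x
    (ContinuousLinearMap.proj (R := ℂ) (φ := fun _ => ℂ) i).hasFDerivAt

theorem pder_mon {m : ℕ} (k : Fin m → ℕ) (x : Fin m → ℂ) (l : Fin m) :
    pder l (fun x => mon x k) x =
      (∏ j ∈ Finset.univ.erase l, x j ^ k j) * (k l * x l ^ (k l - 1)) := by
  rw [pder, (hasFDerivAt_mon k x).fderiv]
  simp [Pi.single_apply]

theorem mul_pder_mon {m : ℕ} (k : Fin m → ℕ) (x : Fin m → ℂ) (l : Fin m) :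
    x l * pder l (fun x => mon x k) x = k l * mon x k := by
  rw [pder_mon, mon, ← Finset.prod_erase_mul Finset.univ _ (Finset.mem_univ l)]
  rcases Nat.eq_zero_or_pos (k l) with h | h
  · simp [h]
  · obtain ⟨q, hq⟩ : ∃ q, k l = q + 1 := ⟨k l - 1, by omega⟩
    rw [hq]
    simp only [Nat.add_sub_cancel]
    ring

theorem pder_mon_zero {m : ℕ} (k : Fin m → ℕ) (l : Fin m) :
    pder l (fun x => mon x k) 0 = if k = Pi.single l 1 then 1 else 0 := by
  rw [pder_mon]
  split_ifs with h
  · subst h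
    rw [Finset.prod_eq_one]
    · simp
    · intro j hj
      rw [Pi.single_eq_of_ne (Finset.ne_of_mem_erase hj)]
      simp
  · by_contra hne
    apply h
    obtain ⟨h1, h2⟩ := mul_ne_zero_iff.1 hne
    obtain ⟨h3, h4⟩ := mul_ne_zero_iff.1 h2
    funext j
    by_cases hj : j = l
    · subst hj
      have h5 : k j ≠ 0 := by exact_mod_cast h3
      have h6 : k j - 1 = 0 := by
        by_contra h7
        exact h4 (by simp [zero_pow h7])
      rw [Pi.single_eq_same]
      omega
    · rw [Pi.single_eq_of_ne hj]
      by_contra h7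
      refine (Finset.prod_ne_zero_iff.1 h1 j (Finset.mem_erase.2 ⟨hj, Finset.mem_univ _⟩)) ?_
      simp [zero_pow h7]

/-- A power series may be differentiated term by term; the derivatives of the monomials are
bounded by Cauchy's estimate on a slightly larger polydisc. -/
theorem ConvergesOn.hasFDerivAt {m : ℕ} {R : ℝ} {c : (Fin m → ℕ) → ℂ} (hc : ConvergesOn R c)
    {x : Fin m → ℂ} (hx : ‖x‖ < R) :
    HasFDerivAt (ser c) (∑' k, c k • fderiv ℂ (fun x => mon x k) x) x ∧
      Summable fun k => c k • fderiv ℂ (fun x => mon x k) x := by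
  obtain ⟨ρ, h1, h2⟩ := exists_between hx
  obtain ⟨ρ', h3, h4⟩ := exists_between h2
  have hρ : 0 < ρ := (norm_nonneg x).trans_lt h1
  have hd : ∀ k : Fin m → ℕ, Differentiable ℂ fun x : Fin m → ℂ => mon x k :=
    fun k x => (hasFDerivAt_mon k x).differentiableAt
  have hsum := (hc ρ' (hρ.trans h3).le h4).mul_right (((ρ' - ρ) / 2)⁻¹)
  have hbd : ∀ k : Fin m → ℕ, ∀ y ∈ Metric.ball (0 : Fin m → ℂ) ρ,
      ‖c k • fderiv ℂ (fun x => mon x k) y‖ ≤ ‖c k‖ * ρ' ^ (∑ l, k l) * ((ρ' - ρ) / 2)⁻¹ := by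
    intro k y hy
    rw [mem_ball_zero_iff] at hy
    rw [norm_smul, mul_assoc, ← div_eq_mul_inv]
    gcongr
    refine norm_fderiv_le_of_bounded_ball (sub_pos.2 h3) (hd k).differentiableOn fun z hz => ?_
    refine norm_mon_le ?_ k
    rw [mem_ball_iff_norm] at hz
    calc ‖z‖ = ‖y + (z - y)‖ := by congr 1; abel
      _ ≤ ‖y‖ + ‖z - y‖ := norm_add_le _ _
      _ ≤ ρ' := by linarith
  have hxb : x ∈ Metric.ball (0 : Fin m → ℂ) ρ := by simpa using h1
  refine ⟨?_, Summable.of_norm_bounded hsum fun k => hbd k x hxb⟩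
  exact hasFDerivAt_tsum_of_isPreconnected (f := fun k x => c k * mon x k) hsum Metric.isOpen_ball
    (convex_ball _ _).isPreconnected
    (fun k y _ => ((hd k y).hasFDerivAt.const_mul (c k))) hbd hxb (hc.summable hx) hxb

theorem ConvergesOn.differentiableOn {m : ℕ} {R : ℝ} {c : (Fin m → ℕ) → ℂ}
    (hc : ConvergesOn R c) : DifferentiableOn ℂ (ser c) (Metric.ball 0 R) := fun x hx =>
  (hc.hasFDerivAt (by simpa using hx)).1.differentiableAt.differentiableWithinAt

theorem ConvergesOn.hasSum_pder {m : ℕ} {R : ℝ} {c : (Fin m → ℕ) → ℂ} (hc : ConvergesOn R c)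
    {x : Fin m → ℂ} (hx : ‖x‖ < R) (l : Fin m) :
    HasSum (fun k => c k * pder l (fun x => mon x k) x) (pder l (ser c) x) := by
  obtain ⟨h1, h2⟩ := hc.hasFDerivAt hx
  have := h2.hasSum.mapL (ContinuousLinearMap.apply ℂ ℂ (Pi.single l (1 : ℂ)))
  rw [pder, h1.fderiv]
  simpa [pder] using this

theorem ConvergesOn.hasSum_mul_pder {m : ℕ} {R : ℝ} {c : (Fin m → ℕ) → ℂ} (hc : ConvergesOn R c)
    {x : Fin m → ℂ} (hx : ‖x‖ < R) (l : Fin m) :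
    HasSum (fun k => (k l * c k) * mon x k) (x l * pder l (ser c) x) := by
  have h := (hc.hasSum_pder hx l).mul_left (x l)
  simp only [mul_left_comm (x l), mul_pder_mon] at h
  simpa only [mul_assoc, mul_left_comm (c _)] using h

theorem ser_zero {m : ℕ} (c : (Fin m → ℕ) → ℂ) : ser c 0 = c 0 := by
  rw [ser, tsum_eq_single 0]
  · simp [mon]
  · intro k hk
    obtain ⟨j, hj⟩ := Function.ne_iff.1 hk
    have : mon (0 : Fin m → ℂ) k = 0 :=
      Finset.prod_eq_zero (Finset.mem_univ j) (by simp [zero_pow (show k j ≠ 0 from hj)])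
    rw [this, mul_zero]

theorem ConvergesOn.pder_zero {m : ℕ} {R : ℝ} (hR : 0 < R) {c : (Fin m → ℕ) → ℂ}
    (hc : ConvergesOn R c) (l : Fin m) : pder l (ser c) 0 = c (Pi.single l 1) := by
  rw [← (hc.hasSum_pder (x := 0) (by simpa using hR) l).tsum_eq, tsum_eq_single (Pi.single l 1)]
  · simp [pder_mon_zero]
  · intro k hk
    simp [pder_mon_zero, hk]

theorem ConvergesOn.sum {m : ℕ} {ι : Type*} {R : ℝ} {c : ι → (Fin m → ℕ) → ℂ} (S : Finset ι)
    (w : ι → ℂ) (hc : ∀ i ∈ S, ConvergesOn R (c i)) :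
    ConvergesOn R fun k => ∑ i ∈ S, w i * c i k := by
  intro ρ h0 hρ
  have h1 : Summable fun k => ∑ i ∈ S, ‖w i‖ * (‖c i k‖ * ρ ^ (∑ l, k l)) :=
    summable_sum fun i hi => (hc i hi ρ h0 hρ).mul_left _
  refine Summable.of_nonneg_of_le (fun k => by positivity) (fun k => ?_) h1
  calc ‖∑ i ∈ S, w i * c i k‖ * ρ ^ (∑ l, k l)
      ≤ (∑ i ∈ S, ‖w i * c i k‖) * ρ ^ (∑ l, k l) := by
        gcongr
        exact norm_sum_le _ _
    _ = _ := by
        rw [Finset.sum_mul]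
        exact Finset.sum_congr rfl fun i _ => by rw [norm_mul, mul_assoc]

theorem ser_sum {m : ℕ} {ι : Type*} {R : ℝ} {c : ι → (Fin m → ℕ) → ℂ} (S : Finset ι)
    (w : ι → ℂ) (hc : ∀ i ∈ S, ConvergesOn R (c i)) {x : Fin m → ℂ} (hx : ‖x‖ < R) :
    ser (fun k => ∑ i ∈ S, w i * c i k) x = ∑ i ∈ S, w i * ser (c i) x := by
  have : HasSum (fun k => ∑ i ∈ S, w i * (c i k * mon x k)) (∑ i ∈ S, w i * ser (c i) x) :=
    hasSum_sum fun i hi => ((hc i hi).summable hx).hasSum.mul_left _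
  rw [← this.tsum_eq, ser]
  congr 1
  funext k
  rw [Finset.sum_mul]
  exact Finset.sum_congr rfl fun i _ => by ring

/-- The eigenvalue of `ℷ_j` on `x^k`: for `j = 0` and `j = n` this is `D_0(k)` and `D_n(k)`, and
for the other `j` it is the exponent of `x_j`. -/
def deg (n : ℕ) (j : Fin (n + 1)) (k : Fin (n - 1) → ℕ) : ℚ := ∑ l, wt n j l * k l

theorem deg_add {n : ℕ} (j : Fin (n + 1)) (k k' : Fin (n - 1) → ℕ) :
    deg n j (k + k') = deg n j k + deg n j k' := by
  simp [deg, mul_add, Finset.sum_add_distrib]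

theorem deg_inner {n : ℕ} (l : Fin (n - 1)) (k : Fin (n - 1) → ℕ) :
    deg n ⟨l + 1, by omega⟩ k = k l := by
  have hl := l.2
  rw [deg, Finset.sum_eq_single l]
  · simp [wt, show (l : ℕ) + 1 ≠ n by omega]
  · intro i _ hi
    have : (l : ℕ) ≠ i := fun h => hi (Fin.ext h.symm)
    simp [wt, show (l : ℕ) + 1 ≠ n by omega, this]
  · simp

theorem ConvergesOn.deg_mul {n : ℕ} {R : ℝ} {c : (Fin (n - 1) → ℕ) → ℂ} (hc : ConvergesOn R c)
    (j : Fin (n + 1)) : ConvergesOn R fun k => (deg n j k : ℂ) * c k := by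
  refine hc.mul_of_linear_bound (C := ∑ l, ‖(wt n j l : ℂ)‖) fun k => ?_
  rw [deg]
  push_cast
  refine (norm_sum_le _ _).trans ?_
  rw [Finset.sum_mul]
  refine Finset.sum_le_sum fun l _ => ?_
  rw [norm_mul]
  gcongr
  simp only [Complex.norm_natCast]
  exact Finset.single_le_sum (f := fun i => (k i : ℝ)) (fun i _ => by positivity)
    (Finset.mem_univ l)

theorem ConvergesOn.opX_ser {n : ℕ} {R : ℝ} {c : (Fin (n - 1) → ℕ) → ℂ} (hc : ConvergesOn R c)
    (j : Fin (n + 1)) :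
    Set.EqOn (opX n j (ser c)) (ser fun k => (deg n j k : ℂ) * c k) (Metric.ball 0 R) := by
  intro x hx
  rw [mem_ball_zero_iff] at hx
  have : HasSum (fun k => ∑ l, (wt n j l : ℂ) * ((k l * c k) * mon x k)) (opX n j (ser c) x) :=
    hasSum_sum fun l _ => (hc.hasSum_mul_pder hx l).mul_left _
  rw [← this.tsum_eq, ser]
  congr 1
  funext k
  rw [deg]
  push_cast
  rw [Finset.sum_mul, Finset.sum_mul]
  exact Finset.sum_congr rfl fun l _ => by ring

/-- The falling factorial `q (q - 1) ⋯ (q - p + 1)`. -/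
def ff (q : ℚ) (p : ℕ) : ℚ := ∏ m ∈ Finset.range p, (q - m)

theorem ff_natCast_eq_zero {q p : ℕ} (h : q < p) : ff q p = 0 :=
  Finset.prod_eq_zero (Finset.mem_range.2 h) (sub_self _)

theorem opX_congr {n : ℕ} {f g : (Fin (n - 1) → ℂ) → ℂ} {O : Set (Fin (n - 1) → ℂ)}
    (hO : IsOpen O) (h : Set.EqOn f g O) (j : Fin (n + 1)) :
    Set.EqOn (opX n j f) (opX n j g) O := by
  intro x hx
  have : f =ᶠ[𝓝 x] g := by filter_upwards [hO.mem_nhds hx] with z hz using h hz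
  simp only [opX, pder_congr this]

theorem ConvergesOn.fallingX_ser {n : ℕ} {R : ℝ} {c : (Fin (n - 1) → ℕ) → ℂ}
    (hc : ConvergesOn R c) {f : (Fin (n - 1) → ℂ) → ℂ} (hf : Set.EqOn f (ser c) (Metric.ball 0 R))
    (j : Fin (n + 1)) (p : ℕ) :
    ConvergesOn R (fun k => (ff (deg n j k) p : ℂ) * c k) ∧
    Set.EqOn (fallingX n j p f) (ser fun k => (ff (deg n j k) p : ℂ) * c k)
      (Metric.ball 0 R) := by
  induction p with
  | zero => simpa [ff, fallingX] using ⟨hc, hf⟩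
  | succ p ih =>
    obtain ⟨h1, h2⟩ := ih
    have h3 := h1.deg_mul j
    have hco : (fun k => (ff (deg n j k) (p + 1) : ℂ) * c k) = fun k => ∑ i : Fin 2,
        (![1, -(p : ℂ)] i) * (![fun k => (deg n j k : ℂ) * ((ff (deg n j k) p : ℂ) * c k),
          fun k => (ff (deg n j k) p : ℂ) * c k] i k) := by
      funext k
      rw [ff, Finset.prod_range_succ, ← ff]
      simp [Fin.sum_univ_two]
      ring
    have hcs : ∀ i ∈ (Finset.univ : Finset (Fin 2)), ConvergesOn R
        (![fun k => (deg n j k : ℂ) * ((ff (deg n j k) p : ℂ) * c k),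
          fun k => (ff (deg n j k) p : ℂ) * c k] i) := by
      intro i _
      fin_cases i
      exacts [h3, h1]
    rw [hco]
    refine ⟨ConvergesOn.sum _ _ hcs, fun x hx => ?_⟩
    rw [ser_sum _ _ hcs (by simpa using hx)]
    simp only [fallingX, Fin.sum_univ_two, opX_congr Metric.isOpen_ball h2 j hx, h2 hx,
      h1.opX_ser j hx]
    simp
    ring

theorem ConvergesOn.prodX_ser {n : ℕ} {R : ℝ} {c : (Fin (n - 1) → ℕ) → ℂ} (hc : ConvergesOn R c)
    (p : Fin (n + 1) → ℕ) :
    Set.EqOn (prodX n p (ser c)) (ser fun k => (∏ j, (ff (deg n j k) (p j) : ℂ)) * c k)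
      (Metric.ball 0 R) := by
  have H : ∀ L : List (Fin (n + 1)),
      ConvergesOn R (fun k => (L.map fun j => (ff (deg n j k) (p j) : ℂ)).prod * c k) ∧
      Set.EqOn (L.foldr (fun j G => fallingX n j (p j) G) (ser c))
        (ser fun k => (L.map fun j => (ff (deg n j k) (p j) : ℂ)).prod * c k)
        (Metric.ball 0 R) := by
    intro L
    induction L with
    | nil => simpa using ⟨hc, fun _ _ => rfl⟩
    | cons j L ih =>
      simpa [mul_assoc] using ih.1.fallingX_ser ih.2 j (p j)
  have := (H (List.finRange (n + 1))).2
  simp only [← List.ofFn_eq_map, List.prod_ofFn] at this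
  exact this

/-- The entries of `p` in the places `1, …, n-1`. -/
def innerPart (n : ℕ) (p : Fin (n + 1) → ℕ) : Fin (n - 1) → ℕ := fun i => p ⟨i + 1, by omega⟩

/-- The recursion for the coefficients of a power series which expresses the GKZ system. For the
equation with index `d`, `p` and `q` are the positive and the negative part of `D'(d)`. -/
def CoeffRel (n : ℕ) (c : (Fin (n - 1) → ℕ) → ℂ) : Prop :=
  ∀ (p q : Fin (n + 1) → ℕ) (d : Fin (n - 1) → ℤ), (∀ j, (p j : ℤ) - q j = dualDegree n d j) →
    ∀ l : Fin (n - 1) → ℕ,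
    (∏ j, (ff (deg n j (l + innerPart n p)) (p j) : ℂ)) *
        c (l + innerPart n p) =
      (∏ j, (ff (deg n j (l + innerPart n q)) (q j) : ℂ)) *
        c (l + innerPart n q)

theorem CoeffRel.sum {n : ℕ} {ι : Type*} {c : ι → (Fin (n - 1) → ℕ) → ℂ} (S : Finset ι)
    (w : ι → ℂ) (hc : ∀ i ∈ S, CoeffRel n (c i)) :
    CoeffRel n fun k => ∑ i ∈ S, w i * c i k := by
  intro p q d h l
  simp only [Finset.mul_sum]
  refine Finset.sum_congr rfl fun i hi => ?_
  rw [mul_left_comm, hc i hi p q d h l, mul_left_comm]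

/-- The terms of index not divisible by `x^p` are annihilated by `∏_j ∏_m (ℷ_j - m)`. -/
theorem ser_ff_eq {n : ℕ} (c : (Fin (n - 1) → ℕ) → ℂ) (p : Fin (n + 1) → ℕ)
    (x : Fin (n - 1) → ℂ) :
    ser (fun k => (∏ j, (ff (deg n j k) (p j) : ℂ)) * c k) x =
      mon x (innerPart n p) *
        ser (fun l => (∏ j, (ff (deg n j (l + innerPart n p)) (p j) : ℂ)) *
          c (l + innerPart n p)) x := by
  set P : Fin (n - 1) → ℕ := innerPart n p with hP
  have hinj : Function.Injective fun l : Fin (n - 1) → ℕ => l + P := fun a b h =>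
    add_right_cancel h
  rw [ser, ser, ← tsum_mul_left, ← hinj.tsum_eq]
  · congr 1
    funext l
    rw [mon_add]
    ring
  · intro k hk
    refine ⟨fun l => k l - P l, ?_⟩
    funext l
    simp only [Pi.add_apply]
    have : P l ≤ k l := by
      by_contra hlt
      apply hk
      have : (∏ j, (ff (deg n j k) (p j) : ℂ)) = 0 := by
        refine Finset.prod_eq_zero (Finset.mem_univ ⟨l + 1, by omega⟩) ?_
        rw [deg_inner, ff_natCast_eq_zero (by simpa [hP, innerPart] using hlt)]
        simp
      simp [this]
    omega

/-- On a power series the equation with index `d` compares coefficients, because `y^d` is the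
monomial `∏_l x_l^{D'_l(d)}` and the monomials are eigenvectors of all `ℷ_j`. -/
theorem isGKZSolution_ser {n : ℕ} {R : ℝ} {c : (Fin (n - 1) → ℕ) → ℂ} (hc : ConvergesOn R c)
    (hrel : CoeffRel n c) {W : Set (Fin (n - 1) → ℂ)} (hW : IsOpen W)
    (hWR : W ⊆ Metric.ball 0 R) : IsGKZSolution n W (ser c) := by
  refine ⟨hc.differentiableOn.mono hWR, fun V s hV hVt hs hmaps hy => ?_⟩
  have hb : IsBranch n V s := ⟨hV, hVt, hs, hy⟩
  have hd := hc.differentiableOn.mono hWR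
  refine ⟨hd.comp hs hmaps, fun d y hyV => ?_⟩
  rw [hb.gimelProd_comp hmaps hW hd _ hyV, hb.gimelProd_comp hmaps hW hd _ hyV]
  simp only [Function.comp_apply]
  have hsy := hWR (hmaps hyV)
  rw [hc.prodX_ser _ hsy, hc.prodX_ser _ hsy]
  have hne := hb.ne_zero hyV
  have hyd : ∏ i, y i ^ d i = ∏ l, s y l ^ dualDegree n d ⟨l + 1, by omega⟩ := by
    rw [← prod_yOfX_zpow hne, hy y hyV]
  rw [hyd, ser_ff_eq, ser_ff_eq, ← mul_assoc]
  congr 1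
  · rw [mon, mon, ← Finset.prod_mul_distrib]
    refine Finset.prod_congr rfl fun l _ => ?_
    rw [← zpow_natCast, ← zpow_natCast, ← zpow_add₀ (hne l)]
    congr 1
    simp only [innerPart]
    omega
  · congr 1
    funext l
    exact hrel _ _ d (fun j => by omega) l

/-! ### The coefficients of the mirror series -/

/-- The coefficient of `x^k` in `f^r`. -/
def mirrorCoeff (n r : ℕ) (k : Fin (n - 1) → ℕ) : ℂ :=
  if Int.fract (-degLast n k) = (r : ℚ) / n then
    (∏ i, (1 / ((k i).factorial : ℂ))) *
      ((Real.Gamma (Int.fract (degZero n k) : ℚ) / Real.Gamma (1 + degZero n k : ℚ) : ℝ) : ℂ) *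
      ((Real.Gamma (Int.fract (degLast n k) : ℚ) / Real.Gamma (1 + degLast n k : ℚ) : ℝ) : ℂ)
  else 0

theorem mirrorTerm_eq (n r : ℕ) (x : Fin (n - 1) → ℂ) (k : Fin (n - 1) → ℕ) :
    mirrorTerm n r x k = mirrorCoeff n r k * mon x k := by
  rw [mirrorTerm, mirrorCoeff]
  split_ifs
  · simp only [div_eq_mul_inv, Finset.prod_mul_distrib, mon]
    simp
    ring
  · simp

theorem mirrorSeries_eq_ser (n r : ℕ) : mirrorSeries n r = ser (mirrorCoeff n r) := by
  funext x
  simp only [mirrorSeries, ser, mirrorTerm_eq]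

theorem deg_zero_eq {n : ℕ} (k : Fin (n - 1) → ℕ) : deg n 0 k = degZero n k := by
  simp only [deg, degZero, wt, Fin.val_zero, if_true, Finset.mul_sum]
  exact Finset.sum_congr rfl fun l _ => by ring

theorem deg_last_eq {n : ℕ} (hn : n ≠ 0) (k : Fin (n - 1) → ℕ) :
    deg n (Fin.last n) k = degLast n k := by
  simp only [deg, degLast, wt, Fin.val_last, hn, if_true, if_false, Finset.mul_sum]
  exact Finset.sum_congr rfl fun l _ => by ring

theorem degZero_add_degLast {n : ℕ} (hn : n ≠ 0) (k : Fin (n - 1) → ℕ) :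
    degZero n k + degLast n k = -((∑ l, k l : ℕ) : ℚ) := by
  have : (n : ℚ) ≠ 0 := by exact_mod_cast hn
  rw [degZero, degLast, ← mul_add, ← Finset.sum_add_distrib]
  push_cast
  rw [neg_mul, Finset.mul_sum]
  congr 1
  refine Finset.sum_congr rfl fun l _ => ?_
  field_simp
  ring

theorem prod_fin_eq {M : Type*} [CommMonoid M] {n : ℕ} (hn : n ≠ 0) (f : Fin (n + 1) → M) :
    ∏ j, f j = f 0 * (∏ l : Fin (n - 1), f ⟨l + 1, by omega⟩) * f (Fin.last n) := by
  obtain ⟨m, rfl⟩ := Nat.exists_eq_succ_of_ne_zero hn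
  rw [Fin.prod_univ_succ, Fin.prod_univ_castSucc, ← mul_assoc]
  rfl

/-- The value of the entire function `1/Γ` at `1 + q`. At the poles of `Γ` it is `0`, as it should
be, since there `Real.Gamma` takes the value `0`. -/
def invGamma (q : ℚ) : ℝ := (Real.Gamma (1 + q : ℚ))⁻¹

theorem mul_invGamma (q : ℚ) : (q : ℝ) * invGamma q = invGamma (q - 1) := by
  rw [invGamma, invGamma]
  rcases eq_or_ne q 0 with h | h
  · subst h
    simp [Real.Gamma_zero]
  · have hq : (q : ℝ) ≠ 0 := by exact_mod_cast h
    have : Real.Gamma (1 + q : ℚ) = q * Real.Gamma q := by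
      push_cast
      rw [add_comm, Real.Gamma_add_one hq]
    rw [this]
    have h2 : ((1 + (q - 1) : ℚ) : ℝ) = q := by push_cast; ring
    rw [h2, mul_inv]
    field_simp

theorem ff_mul_invGamma (q : ℚ) (p : ℕ) : (ff q p : ℝ) * invGamma q = invGamma (q - p) := by
  induction p with
  | zero => simp [ff]
  | succ p ih =>
    rw [ff, Finset.prod_range_succ, ← ff]
    push_cast
    have := mul_invGamma (q - p)
    push_cast at this
    rw [mul_right_comm, ih, mul_comm, this]
    congr 1
    ring

theorem invGamma_natCast (k : ℕ) : invGamma k = (k.factorial : ℝ)⁻¹ := by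
  rw [invGamma]
  push_cast
  rw [add_comm, Real.Gamma_nat_eq_factorial]

/-- The factorials in the coefficients of `f^r` are values of `Γ` as well; apart from factors that
depend only on fractional parts, all indices `j = 0, …, n` enter in the same way. -/
theorem mirrorCoeff_eq {n : ℕ} (hn : n ≠ 0) (r : ℕ) (k : Fin (n - 1) → ℕ) :
    mirrorCoeff n r k = if Int.fract (-deg n (Fin.last n) k) = (r : ℚ) / n then
      ((Real.Gamma (Int.fract (deg n 0 k) : ℚ) * Real.Gamma (Int.fract (deg n (Fin.last n) k) : ℚ) *
        ∏ j, invGamma (deg n j k) : ℝ) : ℂ) else 0 := by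
  rw [mirrorCoeff, deg_last_eq hn, deg_zero_eq]
  split_ifs
  · rw [prod_fin_eq hn, deg_last_eq hn, deg_zero_eq]
    simp only [deg_inner, invGamma_natCast]
    rw [invGamma, invGamma]
    push_cast
    simp only [div_eq_mul_inv, one_mul]
    ring
  · rfl

/-- The recursion follows from `(q - m) / Γ(1 + q - m) = 1 / Γ(q - m)`, applied to every factor
`1 / Γ(1 + deg n j k)`: both sides become the same product of values of `1/Γ`. -/
theorem mirrorCoeff_rel {n : ℕ} (hn : n ≠ 0) (r : ℕ) : CoeffRel n (mirrorCoeff n r) := by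
  intro p q d hpq l
  have hdeg : ∀ j, deg n j (l + innerPart n p) =
      deg n j (l + innerPart n q) + ((p j : ℤ) - q j : ℤ) := by
    intro j
    have h := dualDegree_eq_sum d j
    simp only [← hpq] at h
    rw [deg_add, deg_add, h]
    push_cast
    simp only [mul_sub, Finset.sum_sub_distrib]
    simp only [deg, innerPart]
    ring
  have hfr : ∀ j, Int.fract (deg n j (l + innerPart n p)) =
      Int.fract (deg n j (l + innerPart n q)) := fun j => by
    rw [hdeg j, Int.fract_add_intCast]
  have hfrn : ∀ j, Int.fract (-deg n j (l + innerPart n p)) =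
      Int.fract (-deg n j (l + innerPart n q)) := fun j => by
    rw [hdeg j, neg_add, ← Int.cast_neg, Int.fract_add_intCast]
  rw [mirrorCoeff_eq hn, mirrorCoeff_eq hn, hfrn, hfr, hfr]
  split_ifs
  · have key : ∀ p : Fin (n + 1) → ℕ, ∀ k : Fin (n - 1) → ℕ, ∀ a : ℝ,
        (∏ j, (ff (deg n j k) (p j) : ℂ)) * ((a * ∏ j, invGamma (deg n j k) : ℝ) : ℂ) =
          ((a * ∏ j, invGamma (deg n j k - p j) : ℝ) : ℂ) := by
      intro p k a
      simp only [← ff_mul_invGamma, Finset.prod_mul_distrib]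
      push_cast
      ring
    rw [key, key]
    congr 2
    refine Finset.prod_congr rfl fun j _ => ?_
    rw [hdeg j]
    push_cast
    congr 1
    ring
  · simp

theorem abs_Gamma_div_Gamma_sub_le {f : ℝ} (h0 : 0 < f) (h1 : f < 1) (N : ℕ) :
    |Real.Gamma f / Real.Gamma (f - N)| ≤ N.factorial := by
  induction N with
  | zero =>
    have := (Real.Gamma_pos_of_pos h0).ne'
    simp [this]
  | succ N ih =>
    have hN : (0 : ℝ) ≤ N := Nat.cast_nonneg N
    have hne : f - (N + 1 : ℕ) ≠ 0 := by
      push_cast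
      intro h
      linarith
    have : Real.Gamma (f - N) = (f - (N + 1 : ℕ)) * Real.Gamma (f - (N + 1 : ℕ)) := by
      rw [← Real.Gamma_add_one hne]
      congr 1
      push_cast
      ring
    have hG : Real.Gamma f / Real.Gamma (f - (N + 1 : ℕ)) =
        (f - (N + 1 : ℕ)) * (Real.Gamma f / Real.Gamma (f - N)) := by
      rw [this]
      field_simp
    rw [hG, abs_mul, Nat.factorial_succ]
    push_cast
    gcongr
    rw [abs_le]
    constructor <;> linarith

theorem abs_Gamma_fract_div_Gamma_le {q : ℚ} (hq : q < 0) (hfr : Int.fract q ≠ 0) :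
    |Real.Gamma (Int.fract q : ℚ) / Real.Gamma (1 + q : ℚ)| ≤ ((-⌊q⌋ - 1).toNat).factorial := by
  have hfl : ⌊q⌋ < 0 := Int.floor_lt.2 (by simpa using hq)
  have h1 : ((1 + q : ℚ) : ℝ) = (Int.fract q : ℚ) - ((-⌊q⌋ - 1).toNat : ℕ) := by
    have h2 : (((-⌊q⌋ - 1).toNat : ℕ) : ℝ) = -⌊q⌋ - 1 := by
      rw [← Int.cast_natCast, Int.toNat_of_nonneg (by omega)]
      push_cast
      ring
    rw [h2, Int.fract]
    push_cast
    ring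
  rw [h1]
  refine abs_Gamma_div_Gamma_sub_le ?_ ?_ _
  · exact_mod_cast lt_of_le_of_ne (Int.fract_nonneg q) (Ne.symm hfr)
  · exact_mod_cast Int.fract_lt_one q

theorem factorial_sum_mul_prod_inv_le {m : ℕ} (k : Fin m → ℕ) :
    ((∑ l, k l).factorial : ℝ) * ∏ l, ((k l).factorial : ℝ)⁻¹ ≤ (m : ℝ) ^ (∑ l, k l) := by
  have h1 : ((∑ l, k l).factorial : ℝ) * ∏ l, ((k l).factorial : ℝ)⁻¹ =
      Nat.multinomial Finset.univ k := by
    have := Nat.multinomial_spec Finset.univ k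
    rw [← this]
    push_cast
    rw [Finset.prod_inv_distrib, mul_comm, ← mul_assoc, inv_mul_cancel₀, one_mul]
    exact Finset.prod_ne_zero_iff.2 fun l _ => by exact_mod_cast (k l).factorial_ne_zero
  rw [h1]
  have h2 := Finset.sum_pow_eq_sum_piAntidiag (Finset.univ : Finset (Fin m)) (fun _ => (1 : ℕ))
    (∑ l, k l)
  simp only [Finset.sum_const, Finset.card_univ, Fintype.card_fin, smul_eq_mul, mul_one, one_pow,
    Finset.prod_const_one, Nat.cast_id] at h2
  have h3 : Nat.multinomial Finset.univ k ≤ m ^ (∑ l, k l) := by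
    rw [h2]
    refine Finset.single_le_sum (f := fun k => Nat.multinomial Finset.univ k)
      (fun _ _ => Nat.zero_le _) ?_
    simp
  exact_mod_cast h3

/-- Each ratio of values of `Γ` is bounded by a factorial, and the product of the two factorials by
`(∑ k_l)!`; what remains is at most a multinomial coefficient. -/
theorem norm_mirrorCoeff_le {n r : ℕ} (hr : 1 ≤ r) (hrn : r < n) (k : Fin (n - 1) → ℕ) :
    ‖mirrorCoeff n r k‖ ≤ ((n - 1 : ℕ) : ℝ) ^ (∑ l, k l) := by
  rw [mirrorCoeff]
  split_ifs with hfr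
  swap
  · simp only [norm_zero]
    positivity
  have hn : n ≠ 0 := by omega
  have hnQ : (0 : ℚ) < n := by exact_mod_cast Nat.pos_of_ne_zero hn
  have hrQ : (0 : ℚ) < (r : ℚ) / n := by positivity
  set a := degZero n k with ha
  set b := degLast n k with hb
  have hab : a + b = -((∑ l, k l : ℕ) : ℚ) := degZero_add_degLast hn k
  have ha0 : a ≤ 0 := by
    rw [ha, degZero, neg_mul, neg_nonpos]
    refine mul_nonneg (by positivity) (Finset.sum_nonneg fun l _ => mul_nonneg ?_ (by positivity))
    have := l.2
    have h : ((l : ℕ) + 1 : ℚ) ≤ n := by exact_mod_cast (by omega : (l : ℕ) + 1 ≤ n)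
    linarith
  have hb0 : b ≤ 0 := by
    rw [hb, degLast, neg_mul, neg_nonpos]
    exact mul_nonneg (by positivity) (Finset.sum_nonneg fun l _ => by positivity)
  have hbf : Int.fract b ≠ 0 := by
    intro h
    obtain ⟨z, hz⟩ := Int.fract_eq_zero_iff.1 h
    rw [← hz, ← Int.cast_neg, Int.fract_intCast] at hfr
    exact hrQ.ne hfr
  have haf : Int.fract a ≠ 0 := by
    intro h
    obtain ⟨z, hz⟩ := Int.fract_eq_zero_iff.1 h
    apply hbf
    rw [Int.fract_eq_zero_iff]
    refine ⟨-(∑ l, k l : ℕ) - z, ?_⟩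
    push_cast at hab ⊢
    linarith
  have hsum : (-⌊a⌋ - 1).toNat + (-⌊b⌋ - 1).toNat ≤ ∑ l, k l := by
    have h1 : ⌊a⌋ < 0 := Int.floor_lt.2 (by
      rcases ha0.lt_or_eq with h | h
      · simpa using h
      · exact absurd (by rw [h]; simp) haf)
    have h2 : ⌊b⌋ < 0 := Int.floor_lt.2 (by
      rcases hb0.lt_or_eq with h | h
      · simpa using h
      · exact absurd (by rw [h]; simp) hbf)
    have h3 : (-((∑ l, k l : ℕ) : ℤ) : ℚ) < ((⌊a⌋ + ⌊b⌋ + 2 : ℤ) : ℚ) := by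
      have := Int.lt_floor_add_one a
      have := Int.lt_floor_add_one b
      push_cast at hab ⊢
      linarith
    have h4 : -((∑ l, k l : ℕ) : ℤ) < ⌊a⌋ + ⌊b⌋ + 2 := by exact_mod_cast h3
    omega
  have ha1 : a < 0 := lt_of_le_of_ne ha0 fun h => haf (by rw [h]; simp)
  have hb1 : b < 0 := lt_of_le_of_ne hb0 fun h => hbf (by rw [h]; simp)
  have hA := abs_Gamma_fract_div_Gamma_le ha1 haf
  have hB := abs_Gamma_fract_div_Gamma_le hb1 hbf
  rw [norm_mul, norm_mul, Complex.norm_real, Complex.norm_real, Real.norm_eq_abs, Real.norm_eq_abs,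
    norm_prod]
  have hf : ∀ i, ‖(1 / ((k i).factorial : ℂ))‖ = ((k i).factorial : ℝ)⁻¹ := by
    intro i
    simp
  simp only [hf]
  have hfac : (((-⌊a⌋ - 1).toNat).factorial : ℝ) * ((-⌊b⌋ - 1).toNat).factorial ≤
      ((∑ l, k l).factorial : ℝ) := by
    have h1 := Nat.le_of_dvd (Nat.factorial_pos _)
      (Nat.factorial_mul_factorial_dvd_factorial_add (-⌊a⌋ - 1).toNat (-⌊b⌋ - 1).toNat)
    exact_mod_cast h1.trans (Nat.factorial_le hsum)
  refine le_trans ?_ (factorial_sum_mul_prod_inv_le k)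
  rw [mul_assoc, mul_comm]
  gcongr
  exact (mul_le_mul hA hB (abs_nonneg _) (by positivity)).trans hfac

theorem summable_pow_sum {m : ℕ} {q : ℝ} (h0 : 0 ≤ q) (h1 : q < 1) :
    Summable fun k : Fin m → ℕ => q ^ (∑ l, k l) := by
  induction m with
  | zero => exact Summable.of_finite
  | succ m ih =>
    rw [← (Fin.consEquiv fun _ : Fin (m + 1) => ℕ).summable_iff]
    have := (summable_geometric_of_lt_one h0 h1).mul_of_nonneg ih (fun _ => by positivity)
      (fun _ => by positivity)
    refine this.congr fun p => ?_
    simp [Fin.consEquiv, Fin.sum_univ_succ, pow_add]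

theorem mirrorCoeff_convergesOn {n r : ℕ} (hr : 1 ≤ r) (hrn : r < n) :
    ConvergesOn (1 / n) (mirrorCoeff n r) := by
  intro ρ h0 hρ
  have hn : (0 : ℝ) < n := by exact_mod_cast (by omega : 0 < n)
  have hq : ((n - 1 : ℕ) : ℝ) * ρ < 1 := by
    rw [lt_div_iff₀ hn] at hρ
    refine lt_of_le_of_lt ?_ hρ
    rw [mul_comm]
    gcongr
    omega
  refine Summable.of_nonneg_of_le (fun k => by positivity) (fun k => ?_)
    (summable_pow_sum (m := n - 1) (by positivity) hq)
  rw [mul_pow]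
  gcongr
  exact norm_mirrorCoeff_le hr hrn k

/-- The coefficients of the constant function `1`. -/
def constCoeff (n : ℕ) (k : Fin (n - 1) → ℕ) : ℂ := if k = 0 then 1 else 0

theorem constCoeff_convergesOn (n : ℕ) (R : ℝ) : ConvergesOn R (constCoeff n) := by
  intro ρ _ _
  refine summable_of_ne_finset_zero (s := {0}) fun k hk => ?_
  simp [constCoeff, Finset.notMem_singleton.1 hk]

theorem ser_constCoeff {n : ℕ} (x : Fin (n - 1) → ℂ) : ser (constCoeff n) x = 1 := by
  rw [ser, tsum_eq_single 0]
  · simp [constCoeff, mon]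
  · intro k hk
    simp [constCoeff, hk]

/-- The rows of `M` have sum zero; hence so does `D'(d)`. -/
theorem sum_galeMatrix {n : ℕ} (i : Fin (n - 1)) : ∑ j, galeMatrix n i j = 0 := by
  have hi := i.2
  have hsplit : ∀ j : Fin (n + 1), galeMatrix n i j = (if j = ⟨i, by omega⟩ then 1 else 0) +
      (if j = ⟨i + 1, by omega⟩ then -2 else 0) + (if j = ⟨i + 2, by omega⟩ then 1 else 0) := by
    intro j
    simp only [galeMatrix, Fin.ext_iff]
    split_ifs <;> omega
  simp [hsplit, Finset.sum_add_distrib]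

theorem constCoeff_rel (n : ℕ) : CoeffRel n (constCoeff n) := by
  intro p q d hpq l
  -- a factor `ℷ_j` annihilates constants, so both sides vanish unless there are no factors
  have key : ∀ p : Fin (n + 1) → ℕ, p ≠ 0 →
      (∏ j, (ff (deg n j (l + innerPart n p)) (p j) : ℂ)) *
        constCoeff n (l + innerPart n p) = 0 := by
    intro p hp
    obtain ⟨j, hj⟩ := Function.ne_iff.1 hp
    by_cases h : l + innerPart n p = 0
    · have : (∏ j, (ff (deg n j (l + innerPart n p)) (p j) : ℂ)) = 0 := by
        refine Finset.prod_eq_zero (Finset.mem_univ j) ?_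
        have hd : deg n j (l + innerPart n p) = (0 : ℕ) := by rw [h]; simp [deg]
        rw [hd, ff_natCast_eq_zero (Nat.pos_of_ne_zero hj)]
        simp
      rw [this, zero_mul]
    · simp [constCoeff, h]
  have hsum : ∑ j, (dualDegree n d j) = 0 := by
    simp only [dualDegree]
    rw [Finset.sum_comm]
    refine Finset.sum_eq_zero fun i _ => ?_
    rw [← Finset.sum_mul]
    rw [sum_galeMatrix, zero_mul]
  by_cases hp : p = 0
  · by_cases hq : q = 0
    · rw [hp, hq]
    · exfalso
      apply hq
      simp only [← hpq, hp] at hsum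
      funext j
      have : ∑ j, (q j : ℤ) = 0 := by simpa using hsum
      have := (Finset.sum_eq_zero_iff_of_nonneg (fun j _ => by positivity)).1 this j
        (Finset.mem_univ j)
      exact_mod_cast this
  · by_cases hq : q = 0
    · exfalso
      apply hp
      simp only [← hpq, hq] at hsum
      funext j
      have : ∑ j, (p j : ℤ) = 0 := by simpa using hsum
      have := (Finset.sum_eq_zero_iff_of_nonneg (fun j _ => by positivity)).1 this j
        (Finset.mem_univ j)
      exact_mod_cast this
    · rw [key p hp, key q hq]

/-! ### The second-order part of the GKZ system -/

/-- The second-order GKZ equations at the point `x`, as a condition on the first derivatives `g1`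
and the second derivatives `g2` of a function. In homogeneous co-ordinates `x_0, …, x_n` the
derivative `∂_a ∂_b` of a solution depends only on `a + b`; `H s` stands for its value for
`a + b = s`. The derivatives along `x_0` and `x_n` are eliminated by homogeneity. -/
def JetSystem (n : ℕ) (x g1 : Fin (n - 1) → ℂ) (g2 : Fin (n - 1) → Fin (n - 1) → ℂ) : Prop :=
  ∃ H : ℕ → ℂ, (∀ a b : Fin (n - 1), g2 a b = H (a + b + 2)) ∧
    (∀ a : Fin (n - 1), n * H (a + 1) +
      ∑ l : Fin (n - 1), ((n : ℂ) - ((l : ℕ) + 1)) * x l * H (l + a + 2) =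
        -((n : ℂ) - ((a : ℕ) + 1)) * g1 a) ∧
    (n * H n + ∑ l : Fin (n - 1), ((n : ℂ) - ((l : ℕ) + 1)) * x l * H (n + l + 1) = 0) ∧
    (∀ a : Fin (n - 1), n * H (n + a + 1) +
      ∑ l : Fin (n - 1), (((l : ℕ) : ℂ) + 1) * x l * H (l + a + 2) =
        -(((a : ℕ) : ℂ) + 1) * g1 a)

theorem JetSystem.sub {n : ℕ} {x g1 g1' : Fin (n - 1) → ℂ} {g2 g2' : Fin (n - 1) → Fin (n - 1) → ℂ}
    (h : JetSystem n x g1 g2) (h' : JetSystem n x g1' g2') :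
    JetSystem n x (g1 - g1') (g2 - g2') := by
  obtain ⟨H, h1, h2, h3, h4⟩ := h
  obtain ⟨H', h1', h2', h3', h4'⟩ := h'
  refine ⟨H - H', fun a b => by simp [h1, h1'], fun a => ?_, ?_, fun a => ?_⟩
  · simp only [Pi.sub_apply, mul_sub, Finset.sum_sub_distrib]
    linear_combination h2 a - h2' a
  · simp only [Pi.sub_apply, mul_sub, Finset.sum_sub_distrib]
    linear_combination h3 - h3'
  · simp only [Pi.sub_apply, mul_sub, Finset.sum_sub_distrib]
    linear_combination h4 a - h4' a

/-- Near the origin the linear system for `H` is a small perturbation of an invertible one, so that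
the second derivatives are bounded by the first derivatives. -/
theorem JetSystem.norm_le {n : ℕ} {x g1 : Fin (n - 1) → ℂ} {g2 : Fin (n - 1) → Fin (n - 1) → ℂ}
    (h : JetSystem n x g1 g2) (hx : ‖x‖ ≤ 1 / (2 * n)) (a b : Fin (n - 1)) :
    ‖g2 a b‖ ≤ 2 * ‖g1‖ := by
  obtain ⟨H, h1, h2, h3, h4⟩ := h
  have hn : 2 ≤ n := by have := a.2; omega
  have hn0 : (0 : ℝ) < n := by exact_mod_cast (by omega : 0 < n)
  -- the equation for the largest `H s` has diagonal coefficient `n`, and the other coefficients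
  -- have sum at most `n / 2`
  obtain ⟨s, hs, hmax⟩ := Finset.exists_max_image (Finset.Icc 1 (2 * n - 1)) (fun s => ‖H s‖)
    ⟨1, by simp; omega⟩
  have hle : ∀ t, 1 ≤ t → t ≤ 2 * n - 1 → ‖H t‖ ≤ ‖H s‖ := fun t h h' =>
    hmax t (Finset.mem_Icc.2 ⟨h, h'⟩)
  have hl : ∀ l : Fin (n - 1), ((l : ℕ) : ℝ) + 1 ≤ n := fun l => by
    have := l.2
    exact_mod_cast (by omega : (l : ℕ) + 1 ≤ n)
  have hsum : ∀ (w : Fin (n - 1) → ℂ) (t : Fin (n - 1) → ℕ), (∀ l, ‖w l‖ ≤ n) →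
      (∀ l, 1 ≤ t l ∧ t l ≤ 2 * n - 1) → ‖∑ l, w l * x l * H (t l)‖ ≤ n * (‖H s‖ / 2) := by
    intro w t hw ht
    calc ‖∑ l, w l * x l * H (t l)‖ ≤ ∑ l : Fin (n - 1), n * (1 / (2 * n)) * ‖H s‖ := by
          refine norm_sum_le_of_le _ fun l _ => ?_
          rw [norm_mul, norm_mul]
          gcongr
          · exact hw l
          · exact (norm_le_pi_norm x l).trans hx
          · exact hle _ (ht l).1 (ht l).2
      _ = ((n - 1 : ℕ) : ℝ) * (‖H s‖ / 2) := by
          rw [Finset.sum_const, Finset.card_univ, Fintype.card_fin, nsmul_eq_mul]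
          field_simp
      _ ≤ n * (‖H s‖ / 2) := by gcongr; omega
  have hw1 : ∀ l : Fin (n - 1), ‖(n : ℂ) - ((l : ℕ) + 1)‖ ≤ n := by
    intro l
    have h : (n : ℂ) - ((l : ℕ) + 1) = (((n : ℝ) - ((l : ℕ) + 1) : ℝ) : ℂ) := by push_cast; rfl
    rw [h, Complex.norm_real, Real.norm_eq_abs, abs_of_nonneg (by linarith [hl l])]
    have : (0 : ℝ) ≤ (l : ℕ) := Nat.cast_nonneg _
    linarith
  have hw2 : ∀ l : Fin (n - 1), ‖((l : ℕ) : ℂ) + 1‖ ≤ n := by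
    intro l
    have h : ((l : ℕ) : ℂ) + 1 = ((((l : ℕ) : ℝ) + 1 : ℝ) : ℂ) := by push_cast; rfl
    rw [h, Complex.norm_real, Real.norm_eq_abs, abs_of_nonneg (by positivity)]
    exact hl l
  have hnorm : ‖(n : ℂ)‖ = n := by simp
  have key : ∀ (S w g : ℂ), n * H s + S = -w * g → ‖S‖ ≤ n * (‖H s‖ / 2) → ‖w‖ ≤ n →
      ‖g‖ ≤ ‖g1‖ → ‖H s‖ ≤ 2 * ‖g1‖ := by
    intro S w g he hS hw hg
    have h5 : (n : ℂ) * H s = -w * g - S := by linear_combination he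
    have h6 : n * ‖H s‖ ≤ n * ‖g1‖ + n * (‖H s‖ / 2) := by
      calc n * ‖H s‖ = ‖(n : ℂ) * H s‖ := by rw [norm_mul, hnorm]
        _ ≤ ‖-w * g‖ + ‖S‖ := by rw [h5]; exact norm_sub_le _ _
        _ ≤ _ := by
          rw [norm_mul, norm_neg]
          gcongr
    have h7 : n * ‖H s‖ ≤ n * (‖g1‖ + ‖H s‖ / 2) := by linarith
    have := le_of_mul_le_mul_left h7 hn0
    linarith
  have hH : ‖H s‖ ≤ 2 * ‖g1‖ := by
    have hs1 := (Finset.mem_Icc.1 hs).1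
    have hs2 := (Finset.mem_Icc.1 hs).2
    rcases lt_trichotomy s n with hlt | heq | hgt
    · obtain ⟨c, hc⟩ : ∃ c : Fin (n - 1), (c : ℕ) + 1 = s := ⟨⟨s - 1, by omega⟩, by simp; omega⟩
      refine key _ _ (g1 c) (hc ▸ h2 c) (hsum _ _ hw1 fun l => ?_) (hw1 c) (norm_le_pi_norm g1 c)
      have := l.2
      have := c.2
      omega
    · refine key _ 0 0 (by rw [heq]; simpa using h3) (hsum _ _ hw1 fun l => ?_) (by simp)
        (by simp)
      have := l.2
      omega
    · obtain ⟨c, hc⟩ : ∃ c : Fin (n - 1), n + (c : ℕ) + 1 = s :=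
        ⟨⟨s - n - 1, by omega⟩, by simp; omega⟩
      refine key _ _ (g1 c) (hc ▸ h4 c) (hsum _ _ hw2 fun l => ?_) (hw2 c) (norm_le_pi_norm g1 c)
      have := l.2
      have := c.2
      omega
  rw [h1]
  have := a.2
  have := b.2
  exact (hle _ (by omega) (by omega)).trans hH

/-- The partial derivatives of `g` at `x` satisfy the second-order GKZ equations. -/
def SecondOrder (n : ℕ) (g : (Fin (n - 1) → ℂ) → ℂ) (x : Fin (n - 1) → ℂ) : Prop :=
  JetSystem n x (fun a => pder a g x) fun a b => pder a (pder b g) x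

theorem pder_sub {m : ℕ} {f g : (Fin m → ℂ) → ℂ} {x : Fin m → ℂ} (hf : DifferentiableAt ℂ f x)
    (hg : DifferentiableAt ℂ g x) (i : Fin m) :
    pder i (fun x => f x - g x) x = pder i f x - pder i g x := by
  rw [pder, fderiv_fun_sub hf hg]
  rfl

theorem SecondOrder.sub {n : ℕ} {f g : (Fin (n - 1) → ℂ) → ℂ} {O : Set (Fin (n - 1) → ℂ)}
    (hO : IsOpen O) (hf : DifferentiableOn ℂ f O) (hg : DifferentiableOn ℂ g O)
    {x : Fin (n - 1) → ℂ} (hx : x ∈ O) (h : SecondOrder n f x) (h' : SecondOrder n g x) :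
    SecondOrder n (fun x => f x - g x) x := by
  have h1 : ∀ y ∈ O, ∀ i, pder i (fun x => f x - g x) y = pder i f y - pder i g y :=
    fun y hy i => pder_sub (hf.differentiableAt (hO.mem_nhds hy))
      (hg.differentiableAt (hO.mem_nhds hy)) i
  have h2 : ∀ a b, pder a (pder b fun x => f x - g x) x =
      pder a (pder b f) x - pder a (pder b g) x := by
    intro a b
    have hev : (pder b fun x => f x - g x) =ᶠ[𝓝 x] fun x => pder b f x - pder b g x := by
      filter_upwards [hO.mem_nhds hx] with y hy using h1 y hy b
    rw [pder_congr hev, pder_sub ((pder_differentiableOn hO hf b).differentiableAt (hO.mem_nhds hx))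
      ((pder_differentiableOn hO hg b).differentiableAt (hO.mem_nhds hx))]
  have := JetSystem.sub h h'
  rw [SecondOrder]
  simp only [h1 x hx, h2]
  exact this

theorem dense_torus (n : ℕ) : Dense (torus n) := by
  have : torus n = Set.univ.pi fun _ : Fin (n - 1) => ({0}ᶜ : Set ℂ) := by
    ext x
    simp [torus]
  rw [this]
  exact dense_pi _ fun _ _ => dense_compl_singleton 0

/-- A function whose second derivatives are controlled by its first derivatives, and whose value
and first derivatives vanish at one point, is zero, by Grönwall's inequality. -/
theorem eqOn_zero_of_norm_pder_pder_le {m : ℕ} {u : (Fin m → ℂ) → ℂ} {p : Fin m → ℂ} {ε : ℝ}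
    (hε : 0 < ε) (hu : DifferentiableOn ℂ u (Metric.ball p ε))
    (hbd : ∀ x ∈ Metric.ball p ε, ∀ a b, ‖pder a (pder b u) x‖ ≤ 2 * ‖fun c => pder c u x‖)
    (h0 : u p = 0) (h1 : ∀ a, pder a u p = 0) : Set.EqOn u 0 (Metric.ball p ε) := by
  have hp : p ∈ Metric.ball p ε := Metric.mem_ball_self hε
  -- Grönwall for the gradient along the segment from `p` to `q`
  have hzero : ∀ q ∈ Metric.ball p ε, (fun c => pder c u q) = 0 := by
    intro q hq
    set ℓ : ℝ → (Fin m → ℂ) := fun t => p + t • (q - p) with hℓ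
    have hmem : ∀ t ∈ Set.Icc (0 : ℝ) 1, ℓ t ∈ Metric.ball p ε := by
      intro t ht
      exact (convex_ball p ε).add_smul_sub_mem hp hq ht
    have hℓd : ∀ t, HasDerivAt ℓ (q - p) t := by
      intro t
      have := ((hasDerivAt_id t).smul_const (q - p)).const_add p
      rw [one_smul] at this
      exact this
    have hv : ∀ t ∈ Set.Icc (0 : ℝ) 1, HasDerivAt (fun t => fun c => pder c u (ℓ t))
        (fun c => ∑ b, (q - p) b * pder b (pder c u) (ℓ t)) t := by
      intro t ht
      refine hasDerivAt_pi.2 fun c => ?_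
      have hd := ((pder_differentiableOn Metric.isOpen_ball hu c).differentiableAt
        (Metric.isOpen_ball.mem_nhds (hmem t ht))).hasFDerivAt
      have := (hd.restrictScalars ℝ).comp_hasDerivAt t (hℓd t)
      rw [ContinuousLinearMap.coe_restrictScalars', fderiv_apply_eq_sum_pder] at this
      exact this
    have := eq_zero_of_abs_deriv_le_mul_abs_self_of_eq_zero_right
      (f := fun t => fun c => pder c u (ℓ t))
      (f' := fun t c => ∑ b, (q - p) b * pder b (pder c u) (ℓ t)) (K := ∑ b, ‖(q - p) b‖ * 2)
      (a := 0) (b := 1) (fun t ht => (hv t ht).continuousAt.continuousWithinAt)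
      (fun t ht => (hv t (Set.Ico_subset_Icc_self ht)).hasDerivWithinAt)
      (by funext c; simp [hℓ, h1]) (fun t ht => ?_) 1 (by simp)
    · simpa [hℓ] using this
    · refine (pi_norm_le_iff_of_nonneg (by positivity)).2 fun c => ?_
      rw [Finset.sum_mul]
      refine norm_sum_le_of_le _ fun b _ => ?_
      rw [norm_mul, mul_assoc]
      gcongr
      exact hbd _ (hmem t (Set.Ico_subset_Icc_self ht)) b c
  intro q hq
  have hf : Set.EqOn (fderiv ℂ u) 0 (Metric.ball p ε) := by
    intro z hz
    have hz0 : ∀ i, pder i u z = 0 := fun i => congrFun (hzero z hz) i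
    ext v
    simp [fderiv_apply_eq_sum_pder, hz0]
  have := Metric.isOpen_ball.is_const_of_fderiv_eq_zero (convex_ball p ε).isPreconnected hu hf hq hp
  rw [this, h0]
  rfl

/-- Solutions of the second-order GKZ equations near the origin are determined by their `1`-jet at
a point. -/
theorem eqOn_zero_of_secondOrder {n : ℕ} {u : (Fin (n - 1) → ℂ) → ℂ} {p : Fin (n - 1) → ℂ} {ε : ℝ}
    (hε : 0 < ε) (hball : Metric.ball p ε ⊆ Metric.ball 0 (1 / (2 * n)))
    (hu : DifferentiableOn ℂ u (Metric.ball p ε))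
    (hsec : ∀ x ∈ Metric.ball p ε ∩ torus n, SecondOrder n u x)
    (h0 : u p = 0) (h1 : ∀ a, pder a u p = 0) : Set.EqOn u 0 (Metric.ball p ε) := by
  refine eqOn_zero_of_norm_pder_pder_le hε hu (fun x hx a b => ?_) h0 h1
  -- the bound on the torus extends to the ball by continuity
  have hcl := (dense_torus n).open_subset_closure_inter (Metric.isOpen_ball (x := p) (ε := ε)) hx
  have hc1 : ∀ c, ContinuousAt (pder c u) x := fun c =>
    ((pder_differentiableOn Metric.isOpen_ball hu c).differentiableAt
      (Metric.isOpen_ball.mem_nhds hx)).continuousAt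
  have hc2 : ContinuousAt (pder a (pder b u)) x :=
    ((pder_differentiableOn Metric.isOpen_ball
      (pder_differentiableOn Metric.isOpen_ball hu b) a).differentiableAt
      (Metric.isOpen_ball.mem_nhds hx)).continuousAt
  refine ContinuousWithinAt.closure_le (f := fun x => ‖pder a (pder b u) x‖)
    (g := fun x => 2 * ‖fun c => pder c u x‖) hcl
    hc2.norm.continuousWithinAt ?_ fun y hy => ?_
  · exact ((continuousAt_pi.2 hc1).norm.const_mul 2).continuousWithinAt
  · refine (hsec y hy).norm_le ?_ a b
    have := hball hy.1
    rw [mem_ball_zero_iff] at this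
    exact this.le

/-- The equations `∂_a ∂_b = ∂_{a-1} ∂_{b+1}` move every second derivative to one along `x_0` or
`x_n`; `E₀ a`, `Eₙ a` and `E₀ₙ` are the derivatives `∂_0 ∂_a`, `∂_a ∂_n` and `∂_0 ∂_n`, which
homogeneity expresses by derivatives along the inner co-ordinates. -/
theorem jetSystem_of_chain {n : ℕ} {x g1 : Fin (n - 1) → ℂ} {g2 : Fin (n - 1) → Fin (n - 1) → ℂ}
    (hn : n ≠ 0) (hsymm : ∀ a b, g2 a b = g2 b a) {E₀ Eₙ : Fin (n - 1) → ℂ} {E₀ₙ : ℂ}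
    (hE₀ : ∀ a, E₀ a = (wt n 0 a : ℂ) * g1 a + ∑ l, (wt n 0 l : ℂ) * (x l * g2 l a))
    (hEₙ : ∀ a, Eₙ a = (wt n (Fin.last n) a : ℂ) * g1 a +
      ∑ l, (wt n (Fin.last n) l : ℂ) * (x l * g2 a l))
    (hE₀ₙ : E₀ₙ = ∑ l, (wt n 0 l : ℂ) * (x l * Eₙ l))
    (h00 : ∀ a b : Fin (n - 1), (a : ℕ) = 0 → (b : ℕ) + 2 = n → g2 a b = E₀ₙ)
    (h0 : ∀ a b c : Fin (n - 1), (a : ℕ) = 0 → (c : ℕ) = b + 1 → g2 a b = E₀ c)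
    (hlast : ∀ a b c : Fin (n - 1), (a : ℕ) ≤ b → (c : ℕ) + 1 = a → (b : ℕ) + 2 = n →
      g2 a b = Eₙ c)
    (hinner : ∀ a b a' b' : Fin (n - 1), (a : ℕ) ≤ b → (a' : ℕ) + 1 = a → (b' : ℕ) = b + 1 →
      g2 a b = g2 a' b') : JetSystem n x g1 g2 := by
  have hnC : (n : ℂ) ≠ 0 := by exact_mod_cast hn
  set H : ℕ → ℂ := fun s => if h : 1 ≤ s ∧ s < n then E₀ ⟨s - 1, by omega⟩ else
    if h : n < s ∧ s < 2 * n then Eₙ ⟨s - n - 1, by omega⟩ else E₀ₙ with hH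
  have hH0 : ∀ a : Fin (n - 1), H (a + 1) = E₀ a := by
    intro a
    have := a.2
    simp only [hH]
    rw [dif_pos (by omega)]
    rfl
  have hHn : ∀ a : Fin (n - 1), H (n + a + 1) = Eₙ a := by
    intro a
    have := a.2
    simp only [hH]
    rw [dif_neg (by omega), dif_pos (by omega)]
    congr 1
    ext
    simp
    omega
  have hH0n : H n = E₀ₙ := by
    simp only [hH]
    rw [dif_neg (by omega), dif_neg (by omega)]
  have hle : ∀ (s : ℕ) (a b : Fin (n - 1)), (a : ℕ) = s → (a : ℕ) ≤ b →
      g2 a b = H (a + b + 2) := by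
    intro s
    induction s with
    | zero =>
      intro a b ha hab
      have := b.2
      by_cases hb : (b : ℕ) + 2 = n
      · rw [h00 a b ha hb, ← hH0n]
        congr 1
        omega
      · rw [h0 a b ⟨b + 1, by omega⟩ ha rfl, ← hH0]
        congr 1
        simp
        omega
    | succ s ih =>
      intro a b ha hab
      have := b.2
      have := a.2
      by_cases hb : (b : ℕ) + 2 = n
      · rw [hlast a b ⟨s, by omega⟩ hab (by simp; omega) hb, ← hHn]
        congr 1
        simp
        omega
      · rw [hinner a b ⟨s, by omega⟩ ⟨b + 1, by omega⟩ hab (by simp; omega) rfl,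
          ih _ _ rfl (by simp; omega)]
        congr 1
        simp
        omega
  have hall : ∀ a b : Fin (n - 1), g2 a b = H (a + b + 2) := by
    intro a b
    rcases le_total (a : ℕ) b with h | h
    · exact hle _ a b rfl h
    · rw [hsymm, hle _ b a rfl h]
      congr 1
      omega
  have hw0 : ∀ l : Fin (n - 1), (wt n 0 l : ℂ) = -((n : ℂ) - ((l : ℕ) + 1)) / n := by
    intro l
    simp [wt]
  have hwn : ∀ l : Fin (n - 1), (wt n (Fin.last n) l : ℂ) = -(((l : ℕ) : ℂ) + 1) / n := by
    intro l
    simp [wt, hn]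
  refine ⟨H, hall, fun a => ?_, ?_, fun a => ?_⟩
  · simp only [← hall]
    rw [hH0, hE₀]
    simp only [hw0]
    rw [mul_add, Finset.mul_sum, add_assoc, ← Finset.sum_add_distrib, Finset.sum_eq_zero]
    · field_simp
      ring
    · intro l _
      field_simp
      ring
  · simp only [hHn]
    rw [hH0n, hE₀ₙ, Finset.mul_sum, ← Finset.sum_add_distrib]
    refine Finset.sum_eq_zero fun l _ => ?_
    rw [hw0]
    field_simp
    ring
  · simp only [← hall]
    rw [hHn, hEₙ]
    simp only [hwn]
    rw [mul_add, Finset.mul_sum, add_assoc, ← Finset.sum_add_distrib, Finset.sum_eq_zero]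
    · field_simp
      ring
    · intro l _
      rw [hsymm a l]
      field_simp
      ring

/-! ### Solutions of the GKZ system satisfy the second-order equations -/

theorem pder_opX {n : ℕ} {g : (Fin (n - 1) → ℂ) → ℂ} {O : Set (Fin (n - 1) → ℂ)}
    (hO : IsOpen O) (hg : DifferentiableOn ℂ g O) {x : Fin (n - 1) → ℂ} (hx : x ∈ O)
    (j : Fin (n + 1)) (i : Fin (n - 1)) :
    pder i (opX n j g) x = (wt n j i : ℂ) * pder i g x +
      ∑ m, (wt n j m : ℂ) * (x m * pder i (pder m g) x) := by
  have hd : ∀ m, DifferentiableAt ℂ (pder m g) x := fun m =>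
    (pder_differentiableOn hO hg m).differentiableAt (hO.mem_nhds hx)
  have hp : ∀ m, HasFDerivAt (fun x : Fin (n - 1) → ℂ => x m)
      (ContinuousLinearMap.proj (R := ℂ) (φ := fun _ => ℂ) m) x := fun m =>
    (ContinuousLinearMap.proj (R := ℂ) (φ := fun _ : Fin (n - 1) => ℂ) m).hasFDerivAt
  have h : HasFDerivAt (opX n j g) (∑ m, (wt n j m : ℂ) • (x m • fderiv ℂ (pder m g) x +
      pder m g x • ContinuousLinearMap.proj (R := ℂ) (φ := fun _ => ℂ) m)) x :=
    HasFDerivAt.fun_sum fun m _ => ((hp m).mul (hd m).hasFDerivAt).const_mul _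
  rw [pder, h.fderiv]
  simp only [sum_apply, smul_apply, add_apply, ContinuousLinearMap.proj_apply, smul_eq_mul,
    mul_add, Finset.sum_add_distrib]
  rw [add_comm]
  congr 1
  simp [Pi.single_apply]

theorem opX_opX {n : ℕ} {g : (Fin (n - 1) → ℂ) → ℂ} {O : Set (Fin (n - 1) → ℂ)}
    (hO : IsOpen O) (hg : DifferentiableOn ℂ g O) {x : Fin (n - 1) → ℂ} (hx : x ∈ O)
    (j j' : Fin (n + 1)) :
    opX n j (opX n j' g) x = ∑ i, (wt n j i : ℂ) * (x i * ((wt n j' i : ℂ) * pder i g x +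
      ∑ m, (wt n j' m : ℂ) * (x m * pder i (pder m g) x))) := by
  rw [opX]
  exact Finset.sum_congr rfl fun i _ => by rw [pder_opX hO hg hx]

theorem wt_inner {n : ℕ} (c i : Fin (n - 1)) :
    wt n ⟨c + 1, by omega⟩ i = if i = c then 1 else 0 := by
  have := c.2
  simp only [wt, Fin.ext_iff]
  rw [if_neg (by omega), if_neg (by omega)]
  simp [eq_comm]

theorem sum_wt_inner {n : ℕ} (c : Fin (n - 1)) (f : Fin (n - 1) → ℂ) :
    ∑ i, (wt n ⟨c + 1, by omega⟩ i : ℂ) * f i = f c := by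
  rw [Finset.sum_eq_single c]
  · simp [wt_inner]
  · intro i _ hi
    simp [wt_inner, hi]
  · simp

theorem foldr_fallingX_of_eq_zero {n : ℕ} {p : Fin (n + 1) → ℕ} {g : (Fin (n - 1) → ℂ) → ℂ}
    {L : List (Fin (n + 1))} (hp : ∀ h ∈ L, p h = 0) :
    L.foldr (fun j G => fallingX n j (p j) G) g = g := by
  induction L with
  | nil => rfl
  | cons h L ih =>
    rw [List.foldr_cons, ih fun k hk => hp k (List.mem_cons_of_mem _ hk), hp h List.mem_cons_self]
    rfl

theorem foldr_fallingX_of_single {n : ℕ} {p : Fin (n + 1) → ℕ} {g : (Fin (n - 1) → ℂ) → ℂ}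
    {L : List (Fin (n + 1))} (hL : L.Pairwise (· < ·)) {l : Fin (n + 1)} (hl : l ∈ L)
    (hp : ∀ h ∈ L, h ≠ l → p h = 0) :
    L.foldr (fun j G => fallingX n j (p j) G) g = fallingX n l (p l) g := by
  induction L with
  | nil => simp at hl
  | cons h L ih =>
    obtain ⟨h1, h2⟩ := List.pairwise_cons.1 hL
    rw [List.foldr_cons]
    by_cases hhl : h = l
    · subst hhl
      rw [foldr_fallingX_of_eq_zero fun k hk => hp k (List.mem_cons_of_mem _ hk) (h1 k hk).ne']
    · rw [ih h2 ((List.mem_cons.1 hl).resolve_left fun e => hhl e.symm)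
        fun k hk => hp k (List.mem_cons_of_mem _ hk), hp h List.mem_cons_self hhl]
      rfl

theorem foldr_fallingX_of_pair {n : ℕ} {p : Fin (n + 1) → ℕ} {g : (Fin (n - 1) → ℂ) → ℂ}
    {L : List (Fin (n + 1))} (hL : L.Pairwise (· < ·)) {j l : Fin (n + 1)} (hjl : j < l)
    (hj : j ∈ L) (hl : l ∈ L) (hp : ∀ h ∈ L, h ≠ j → h ≠ l → p h = 0) :
    L.foldr (fun j G => fallingX n j (p j) G) g = fallingX n j (p j) (fallingX n l (p l) g) := by
  induction L with
  | nil => simp at hl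
  | cons h L ih =>
    obtain ⟨h1, h2⟩ := List.pairwise_cons.1 hL
    rw [List.foldr_cons]
    by_cases hhj : h = j
    · subst hhj
      rw [foldr_fallingX_of_single h2 ((List.mem_cons.1 hl).resolve_left fun e => hjl.ne' e)
        fun k hk hkl => hp k (List.mem_cons_of_mem _ hk) (h1 k hk).ne' hkl]
    · have hj' : j ∈ L := (List.mem_cons.1 hj).resolve_left fun e => hhj e.symm
      have hhl : h ≠ l := ((h1 j hj').trans hjl).ne
      rw [ih h2 hj' ((List.mem_cons.1 hl).resolve_left fun e => hhl e.symm)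
        fun k hk => hp k (List.mem_cons_of_mem _ hk), hp h List.mem_cons_self hhj hhl]
      rfl

theorem prodX_of_pair {n : ℕ} {p : Fin (n + 1) → ℕ} {g : (Fin (n - 1) → ℂ) → ℂ}
    {j l : Fin (n + 1)} (hjl : j < l) (hp : ∀ h, p h = (if h = j then 1 else 0) +
      if h = l then 1 else 0) : prodX n p g = opX n j (opX n l g) := by
  rw [prodX, foldr_fallingX_of_pair (List.pairwise_lt_finRange _) hjl (List.mem_finRange _)
    (List.mem_finRange _) fun h _ h1 h2 => by simp [hp, h1, h2], hp j, hp l]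
  have h1 : ∀ (j : Fin (n + 1)) (f : (Fin (n - 1) → ℂ) → ℂ), fallingX n j 1 f = opX n j f := by
    intro j f
    funext x
    simp [fallingX]
  simp [hjl.ne, hjl.ne', h1]

theorem prodX_of_double {n : ℕ} {p : Fin (n + 1) → ℕ} {g : (Fin (n - 1) → ℂ) → ℂ}
    {j : Fin (n + 1)} (hp : ∀ h, p h = if h = j then 2 else 0) :
    prodX n p g = fun x => opX n j (opX n j g) x - opX n j g x := by
  rw [prodX, foldr_fallingX_of_single (List.pairwise_lt_finRange _) (List.mem_finRange j)
    fun h _ h1 => by simp [hp, h1], hp j]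
  funext x
  simp [fallingX]

/-- The vector `d = -(e_a + ⋯ + e_b)` gives the equation `∂_a ∂_b = ∂_{a-1} ∂_{b+1}`. -/
theorem dualDegree_neg_interval {n : ℕ} (a b : Fin (n - 1)) (hab : (a : ℕ) ≤ b)
    (j : Fin (n + 1)) :
    dualDegree n (fun i => if (a : ℕ) ≤ i ∧ (i : ℕ) ≤ b then -1 else 0) j =
      (if (j : ℕ) = a + 1 then 1 else 0) + (if (j : ℕ) = b + 1 then 1 else 0) -
      (if (j : ℕ) = a then 1 else 0) - (if (j : ℕ) = b + 2 then 1 else 0) := by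
  set F : ℕ → ℤ := fun i => (if (j : ℕ) = i then 1 else 0) - (if (j : ℕ) = i + 1 then 1 else 0)
    with hF
  have h1 : ∀ i : Fin (n - 1), galeMatrix n i j * (if (a : ℕ) ≤ i ∧ (i : ℕ) ≤ b then -1 else 0) =
      (fun i : ℕ => if (a : ℕ) ≤ i ∧ i ≤ b then F (i + 1) - F i else 0) i := by
    intro i
    simp only [galeMatrix, hF]
    split_ifs <;> omega
  have h2 : ∀ N : ℕ, ∑ i ∈ Finset.range N,
      (if (a : ℕ) ≤ i ∧ i ≤ b then F (i + 1) - F i else 0) =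
      if N ≤ a then 0 else F (min N (b + 1)) - F a := by
    intro N
    induction N with
    | zero => simp
    | succ N ih =>
      rw [Finset.sum_range_succ, ih]
      rcases lt_trichotomy N a with h | h | h
      · rw [if_pos (by omega), if_neg (by omega), if_pos (by omega)]
        rfl
      · rw [if_pos (by omega), if_pos (by omega), if_neg (by omega), min_eq_left (by omega), h]
        ring
      · rw [if_neg (show ¬N ≤ a by omega), if_neg (show ¬N + 1 ≤ a by omega)]
        by_cases hb : N ≤ b
        · rw [if_pos (show (a : ℕ) ≤ N ∧ N ≤ b by omega), min_eq_left (by omega),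
            min_eq_left (by omega)]
          ring
        · rw [if_neg (show ¬((a : ℕ) ≤ N ∧ N ≤ b) by omega), min_eq_right (by omega),
            min_eq_right (by omega)]
          ring
  rw [dualDegree, Finset.sum_congr rfl fun i _ => h1 i,
    Fin.sum_univ_eq_sum_range (fun i : ℕ => if (a : ℕ) ≤ i ∧ i ≤ b then F (i + 1) - F i else 0), h2]
  have := a.2
  have := b.2
  rw [if_neg (by omega), min_eq_right (by omega)]
  simp only [hF]
  ring

/-- The co-ordinate `x_j` for `0 ≤ j ≤ n`, with `x_0 = x_n = 1`. -/
def zc {n : ℕ} (x : Fin (n - 1) → ℂ) (j : ℕ) : ℂ :=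
  ∏ l : Fin (n - 1), if (l : ℕ) + 1 = j then x l else 1

theorem zc_inner {n : ℕ} (x : Fin (n - 1) → ℂ) (c : Fin (n - 1)) : zc x (c + 1) = x c := by
  rw [zc, Finset.prod_eq_single c]
  · simp
  · intro l _ hl
    rw [if_neg]
    intro h
    exact hl (Fin.ext (by omega))
  · simp

theorem zc_zero {n : ℕ} (x : Fin (n - 1) → ℂ) : zc x 0 = 1 :=
  Finset.prod_eq_one fun l _ => if_neg (by omega)

theorem zc_last {n : ℕ} (x : Fin (n - 1) → ℂ) : zc x n = 1 :=
  Finset.prod_eq_one fun l _ => if_neg (by have := l.2; omega)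

theorem zc_ne_zero {n : ℕ} {x : Fin (n - 1) → ℂ} (hx : x ∈ torus n) (j : ℕ) : zc x j ≠ 0 :=
  Finset.prod_ne_zero_iff.2 fun l _ => by split_ifs <;> simp [hx l]

/-- The GKZ equation `∂_a ∂_b = ∂_{a-1} ∂_{b+1}`, multiplied by `x_{a-1} x_{b+1}`. -/
theorem IsGKZSolution.mul_pder_pder {n : ℕ} {g : (Fin (n - 1) → ℂ) → ℂ}
    {W : Set (Fin (n - 1) → ℂ)} (hW : IsOpen W) (hg : IsGKZSolution n W g)
    {x : Fin (n - 1) → ℂ} (hx : x ∈ W) (hxt : x ∈ torus n) (a b : Fin (n - 1))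
    (hab : (a : ℕ) ≤ b) :
    zc x a * zc x (b + 2) * pder a (pder b g) x =
      opX n ⟨a, by omega⟩ (opX n ⟨b + 2, by omega⟩ g) x := by
  obtain ⟨hgd, hgs⟩ := hg
  obtain ⟨V, s, hb, hmaps, hyV, hsy⟩ := exists_isBranch hW hx hxt
  set d : Fin (n - 1) → ℤ := fun i => if (a : ℕ) ≤ i ∧ (i : ℕ) ≤ b then -1 else 0 with hd
  have heq := (hgs V s hb.isOpen hb.subset_torus hb.differentiableOn hmaps hb.yOfX_eq).2 d _ hyV
  rw [hb.gimelProd_comp hmaps hW hgd _ hyV, hb.gimelProd_comp hmaps hW hgd _ hyV,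
    Function.comp_apply, Function.comp_apply, hsy, prod_yOfX_zpow hxt] at heq
  have hD := dualDegree_neg_interval a b hab
  have ha2 := a.2
  have hb2 := b.2
  have hright : prodX n (fun j => (-dualDegree n d j).toNat) g =
      opX n ⟨a, by omega⟩ (opX n ⟨b + 2, by omega⟩ g) := by
    refine prodX_of_pair (Fin.mk_lt_mk.2 (by omega)) fun h => ?_
    rw [hD]
    simp only [Fin.ext_iff]
    split_ifs <;> omega
  have hleft : prodX n (fun j => (dualDegree n d j).toNat) g x =
      x a * x b * pder a (pder b g) x := by
    by_cases hlt : (a : ℕ) < b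
    · rw [prodX_of_pair (j := ⟨a + 1, by omega⟩) (l := ⟨b + 1, by omega⟩)
        (Fin.mk_lt_mk.2 (by omega)), opX_opX hW hgd hx, sum_wt_inner, sum_wt_inner, wt_inner,
        if_neg (by intro h; rw [h] at hlt; omega)]
      · push_cast
        ring
      · intro h
        rw [hD]
        simp only [Fin.ext_iff]
        split_ifs <;> omega
    · obtain rfl : a = b := Fin.ext (by omega)
      rw [prodX_of_double (j := ⟨a + 1, by omega⟩)]
      · simp only []
        rw [opX_opX hW hgd hx, sum_wt_inner, sum_wt_inner, opX, sum_wt_inner, wt_inner, if_pos rfl]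
        push_cast
        ring
      · intro h
        rw [hD]
        simp only [Fin.ext_iff]
        split_ifs <;> omega
  have hzc : zc x a * zc x (b + 2) *
      ∏ l : Fin (n - 1), x l ^ dualDegree n d ⟨l + 1, by omega⟩ = x a * x b := by
    rw [← zc_inner x a, ← zc_inner x b]
    simp only [zc, ← Finset.prod_mul_distrib]
    refine Finset.prod_congr rfl fun l _ => ?_
    rw [hD]
    have hxl : x l ≠ 0 := hxt l
    have hite : ∀ (P : Prop) [Decidable P],
        (if P then x l else 1) = x l ^ (if P then 1 else 0 : ℤ) := by
      intro P _
      split_ifs <;> simp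
    rw [hite, hite, hite, hite, ← zpow_add₀ hxl, ← zpow_add₀ hxl, ← zpow_add₀ hxl]
    congr 1
    ring
  rw [hleft, hright] at heq
  have hP : x a * x b ≠ 0 := mul_ne_zero (hxt a) (hxt b)
  refine mul_left_cancel₀ hP ?_
  calc x a * x b * (zc x a * zc x (b + 2) * pder a (pder b g) x)
      = zc x a * zc x (b + 2) * (x a * x b * pder a (pder b g) x) := by ring
    _ = _ := by rw [heq, ← mul_assoc, hzc]

theorem IsGKZSolution.secondOrder {n : ℕ} {g : (Fin (n - 1) → ℂ) → ℂ}
    {W : Set (Fin (n - 1) → ℂ)} (hn : n ≠ 0) (hW : IsOpen W) (hg : IsGKZSolution n W g)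
    {x : Fin (n - 1) → ℂ} (hx : x ∈ W) (hxt : x ∈ torus n) : SecondOrder n g x := by
  have hkey := fun a b => hg.mul_pder_pder hW hx hxt a b
  have hgd := hg.1
  have hsymm : ∀ a b, pder a (pder b g) x = pder b (pder a g) x :=
    fun a b => pder_comm hW hgd hx a b
  have hz := zc_ne_zero hxt
  refine jetSystem_of_chain hn hsymm (fun _ => rfl) (fun _ => rfl) rfl ?_ ?_ ?_ ?_
  · intro a b ha hb
    have h := hkey a b (by omega)
    have e1 : (⟨a, by omega⟩ : Fin (n + 1)) = 0 := Fin.ext ha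
    have e2 : (⟨b + 2, by omega⟩ : Fin (n + 1)) = Fin.last n := Fin.ext hb
    rw [e1, e2, ha, hb, zc_zero, zc_last, one_mul, one_mul, opX_opX hW hgd hx] at h
    rw [h]
  · intro a b c ha hc
    have h := hkey a b (by omega)
    have e1 : (⟨a, by omega⟩ : Fin (n + 1)) = 0 := Fin.ext ha
    have e2 : (⟨b + 2, by omega⟩ : Fin (n + 1)) = ⟨c + 1, by omega⟩ := Fin.ext (by simp; omega)
    have e3 : (b : ℕ) + 2 = c + 1 := by omega
    rw [e1, e2, e3, ha, zc_zero, one_mul, opX_opX hW hgd hx, zc_inner] at h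
    refine mul_left_cancel₀ (hxt c) (h.trans ?_)
    simp only [sum_wt_inner]
    simp only [wt_inner]
    rw [mul_add, Finset.mul_sum]
    simp only [mul_add, Finset.sum_add_distrib]
    congr 1
    · rw [Finset.sum_eq_single c]
      · simp
        ring
      · intro i _ hi
        simp [hi]
      · simp
    · exact Finset.sum_congr rfl fun i _ => by ring
  · intro a b c hab hc hb
    have h := hkey a b hab
    have e1 : (⟨a, by omega⟩ : Fin (n + 1)) = ⟨c + 1, by omega⟩ := Fin.ext hc.symm
    have e2 : (⟨b + 2, by omega⟩ : Fin (n + 1)) = Fin.last n := Fin.ext hb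
    rw [e1, e2, hb, ← hc, zc_inner, zc_last, mul_one, opX_opX hW hgd hx, sum_wt_inner] at h
    exact mul_left_cancel₀ (hxt c) h
  · intro a b a' b' hab ha hb
    have h := hkey a b hab
    have e1 : (⟨a, by omega⟩ : Fin (n + 1)) = ⟨a' + 1, by omega⟩ := Fin.ext ha.symm
    have e2 : (⟨b + 2, by omega⟩ : Fin (n + 1)) = ⟨b' + 1, by omega⟩ := Fin.ext (by simp; omega)
    have e3 : (b : ℕ) + 2 = b' + 1 := by omega
    rw [e1, e2, e3, ← ha, zc_inner, zc_inner, opX_opX hW hgd hx, sum_wt_inner, sum_wt_inner,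
      wt_inner, if_neg (by intro h; rw [h] at ha; omega)] at h
    refine mul_left_cancel₀ (mul_ne_zero (hxt a') (hxt b')) (h.trans ?_)
    push_cast
    ring

/-! ### Logarithms of the roots -/

/-- `w_n κ^n + ∑_i w_i x_i κ^i` for `κ = exp λ` and weights `w`. -/
def expSum (n : ℕ) (w : ℕ → ℂ) (x : Fin (n - 1) → ℂ) (lam : ℂ) : ℂ :=
  w n * Complex.exp lam ^ n +
    ∑ l : Fin (n - 1), w (l + 1) * x l * Complex.exp lam ^ ((l : ℕ) + 1)

theorem eval_mirrorPoly (n : ℕ) (x : Fin (n - 1) → ℂ) (c : ℂ) :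
    (mirrorPoly n x).eval c = c ^ n + ∑ l : Fin (n - 1), x l * c ^ ((l : ℕ) + 1) + 1 := by
  simp [mirrorPoly, eval_finsetSum]

theorem eval_mirrorPoly_exp (n : ℕ) (x : Fin (n - 1) → ℂ) (lam : ℂ) :
    (mirrorPoly n x).eval (Complex.exp lam) = expSum n 1 x lam + 1 := by
  simp [eval_mirrorPoly, expSum]

theorem hasDerivAt_exp_pow (j : ℕ) (z : ℂ) :
    HasDerivAt (fun t : ℂ => Complex.exp t ^ j) (j * Complex.exp z ^ j) z := by
  have h1 : (fun t : ℂ => Complex.exp t ^ j) = fun t => Complex.exp (j * t) := by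
    funext t
    rw [Complex.exp_nat_mul]
  rw [h1, ← Complex.exp_nat_mul]
  have := ((hasDerivAt_id z).const_mul (j : ℂ)).cexp
  simpa [mul_comm] using this

/-- The derivative of `expSum` as a function of `(x, λ)`. -/
theorem hasFDerivAt_expSum (n : ℕ) (w : ℕ → ℂ) (v : (Fin (n - 1) → ℂ) × ℂ) :
    HasFDerivAt (fun v : (Fin (n - 1) → ℂ) × ℂ => expSum n w v.1 v.2)
      ((∑ l : Fin (n - 1), (w (l + 1) * Complex.exp v.2 ^ ((l : ℕ) + 1)) •
        (ContinuousLinearMap.proj (R := ℂ) (φ := fun _ => ℂ) l).comp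
          (ContinuousLinearMap.fst ℂ (Fin (n - 1) → ℂ) ℂ)) +
        expSum n (fun j => j * w j) v.1 v.2 •
          ContinuousLinearMap.snd ℂ (Fin (n - 1) → ℂ) ℂ) v := by
  have he : ∀ j : ℕ, HasFDerivAt (fun v : (Fin (n - 1) → ℂ) × ℂ => Complex.exp v.2 ^ j)
      ((j * Complex.exp v.2 ^ j) • ContinuousLinearMap.snd ℂ (Fin (n - 1) → ℂ) ℂ) v := by
    intro j
    exact (hasDerivAt_exp_pow j v.2).comp_hasFDerivAt v hasFDerivAt_snd
  have hp : ∀ l : Fin (n - 1), HasFDerivAt (fun v : (Fin (n - 1) → ℂ) × ℂ => v.1 l)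
      ((ContinuousLinearMap.proj (R := ℂ) (φ := fun _ => ℂ) l).comp
          (ContinuousLinearMap.fst ℂ (Fin (n - 1) → ℂ) ℂ)) v := fun l =>
    ((ContinuousLinearMap.proj (R := ℂ) (φ := fun _ : Fin (n - 1) => ℂ) l).comp
          (ContinuousLinearMap.fst ℂ (Fin (n - 1) → ℂ) ℂ)).hasFDerivAt
  have h := ((he n).const_mul (w n)).add (HasFDerivAt.fun_sum (u := Finset.univ)
    fun (l : Fin (n - 1)) _ => ((hp l).const_mul (w (l + 1))).mul (he (l + 1)))
  refine h.congr_fderiv ?_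
  ext u
  · simp [sum_apply]
    exact Finset.sum_congr rfl fun i _ => by ring
  · simp [sum_apply, expSum]
    ring_nf
    congr 1
    exact Finset.sum_congr rfl fun i _ => by ring

theorem hasFDerivAt_expSum_comp {n : ℕ} (w : ℕ → ℂ) {f : (Fin (n - 1) → ℂ) → ℂ}
    {x : Fin (n - 1) → ℂ} (hf : DifferentiableAt ℂ f x) :
    HasFDerivAt (fun x => expSum n w x (f x))
      ((∑ l : Fin (n - 1), (w (l + 1) * Complex.exp (f x) ^ ((l : ℕ) + 1)) •
        ContinuousLinearMap.proj (R := ℂ) (φ := fun _ => ℂ) l) +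
        expSum n (fun j => j * w j) x (f x) • fderiv ℂ f x) x := by
  have h := (hasFDerivAt_expSum n w (x, f x)).comp x
    ((hasFDerivAt_id x).prodMk hf.hasFDerivAt)
  refine HasFDerivAt.congr_fderiv (f := fun x => expSum n w x (f x)) h ?_
  ext u
  simp [sum_apply]

theorem pder_expSum {n : ℕ} (w : ℕ → ℂ) {f : (Fin (n - 1) → ℂ) → ℂ} {x : Fin (n - 1) → ℂ}
    (hf : DifferentiableAt ℂ f x) (a : Fin (n - 1)) :
    pder a (fun x => expSum n w x (f x)) x =
      w (a + 1) * Complex.exp (f x) ^ ((a : ℕ) + 1) +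
        expSum n (fun j => j * w j) x (f x) * pder a f x := by
  rw [pder, (hasFDerivAt_expSum_comp w hf).fderiv]
  simp [sum_apply, Pi.single_apply, pder]

/-- A logarithm of a simple root of the mirror polynomial, holomorphic on `O`. -/
structure IsRootLog (n : ℕ) (O : Set (Fin (n - 1) → ℂ)) (f : (Fin (n - 1) → ℂ) → ℂ) : Prop where
  differentiableOn : DifferentiableOn ℂ f O
  root : ∀ x ∈ O, expSum n 1 x (f x) + 1 = 0
  simple : ∀ x ∈ O, expSum n (fun j => j) x (f x) ≠ 0

theorem IsRootLog.pder_eq {n : ℕ} {O : Set (Fin (n - 1) → ℂ)} {f : (Fin (n - 1) → ℂ) → ℂ}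
    (h : IsRootLog n O f) (hO : IsOpen O) {x : Fin (n - 1) → ℂ} (hx : x ∈ O) (a : Fin (n - 1)) :
    pder a f x = -Complex.exp (f x) ^ ((a : ℕ) + 1) / expSum n (fun j => j) x (f x) := by
  have hd := h.differentiableOn.differentiableAt (hO.mem_nhds hx)
  have h1 := pder_expSum 1 hd a
  have hev : (fun x => expSum n 1 x (f x)) =ᶠ[𝓝 x] fun _ => -1 := by
    filter_upwards [hO.mem_nhds hx] with y hy
    linear_combination h.root y hy
  have h2 : pder a (fun _ : Fin (n - 1) → ℂ => (-1 : ℂ)) x = 0 := by simp [pder]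
  rw [pder_congr hev, h2] at h1
  simp only [Pi.one_apply, mul_one, one_mul] at h1
  rw [eq_div_iff (h.simple x hx)]
  linear_combination -h1

/-- Apart from the factor `κ^{a+b}`, which is the point of the formula, the second derivative
depends on `a` and `b` only through `a + b`. -/
theorem IsRootLog.pder_pder_eq {n : ℕ} {O : Set (Fin (n - 1) → ℂ)} {f : (Fin (n - 1) → ℂ) → ℂ}
    (h : IsRootLog n O f) (hO : IsOpen O) {x : Fin (n - 1) → ℂ} (hx : x ∈ O)
    (a b : Fin (n - 1)) :
    pder a (pder b f) x = Complex.exp (f x) ^ ((a : ℕ) + b + 2) *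
      (((a + b + 2 : ℕ) : ℂ) * expSum n (fun j => j) x (f x) -
        expSum n (fun j => (j : ℂ) * j) x (f x)) / expSum n (fun j => j) x (f x) ^ 3 := by
  have hd := h.differentiableOn.differentiableAt (hO.mem_nhds hx)
  have hE := h.simple x hx
  have h1 := (hasFDerivAt_expSum_comp (fun j => (j : ℂ)) hd).differentiableAt
  have h2 := pder_expSum (fun j => (j : ℂ)) hd a
  have hpd := (pder_differentiableOn hO h.differentiableOn b).differentiableAt (hO.mem_nhds hx)
  -- differentiate the identity `E ∂_b f = -κ^b`
  have hev : (fun y => expSum n (fun j => (j : ℂ)) y (f y) * pder b f y) =ᶠ[𝓝 x]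
      fun y => -Complex.exp (f y) ^ ((b : ℕ) + 1) := by
    filter_upwards [hO.mem_nhds hx] with y hy
    rw [h.pder_eq hO hy, mul_div_cancel₀ _ (h.simple y hy)]
  have h3 := (h1.hasFDerivAt.mul hpd.hasFDerivAt)
  have h4 := ((hasDerivAt_exp_pow ((b : ℕ) + 1) (f x)).comp_hasFDerivAt x hd.hasFDerivAt).neg
  have h5 := congrArg (fun L : (Fin (n - 1) → ℂ) →L[ℂ] ℂ => L (Pi.single a 1))
    ((h3.congr_of_eventuallyEq hev.symm).unique h4)
  have e1 : fderiv ℂ (fun x => expSum n (fun j => (j : ℂ)) x (f x)) x (Pi.single a 1) =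
    pder a (fun x => expSum n (fun j => (j : ℂ)) x (f x)) x := rfl
  have e2 : fderiv ℂ f x (Pi.single a 1) = pder a f x := rfl
  have e3 : fderiv ℂ (pder b f) x (Pi.single a 1) = pder a (pder b f) x := rfl
  simp only [add_apply, neg_apply, smul_apply, smul_eq_mul, e1, e2, e3, h2,
    h.pder_eq hO hx] at h5
  push_cast at h5 ⊢
  rw [eq_div_iff (pow_ne_zero 3 hE)]
  generalize expSum n (fun j => (j : ℂ) * j) x (f x) = E' at h5 ⊢
  generalize expSum n (fun j => (j : ℂ)) x (f x) = E at h5 hE ⊢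
  field_simp at h5
  linear_combination h5

/-- The sums in the second-order system reduce to the sums `∑ j^e x_j κ^j`, `e = 0, 1, 2`. The
equation for `κ` expresses them by `κ^n` and its first two logarithmic derivatives `E`, `E'`. -/
theorem IsRootLog.secondOrder {n : ℕ} {O : Set (Fin (n - 1) → ℂ)} {f : (Fin (n - 1) → ℂ) → ℂ}
    (h : IsRootLog n O f) (hO : IsOpen O) {x : Fin (n - 1) → ℂ} (hx : x ∈ O) :
    SecondOrder n f x := by
  set κ := Complex.exp (f x) with hκ
  set E := expSum n (fun j => (j : ℂ)) x (f x) with hE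
  set E' := expSum n (fun j => (j : ℂ) * j) x (f x) with hE'
  set S₀ := ∑ l : Fin (n - 1), x l * κ ^ ((l : ℕ) + 1) with hS₀
  set S₁ := ∑ l : Fin (n - 1), (((l : ℕ) : ℂ) + 1) * (x l * κ ^ ((l : ℕ) + 1)) with hS₁
  set S₂ := ∑ l : Fin (n - 1), (((l : ℕ) : ℂ) + 1) ^ 2 * (x l * κ ^ ((l : ℕ) + 1)) with hS₂
  have hE0 : E ≠ 0 := h.simple x hx
  have hpd : ∀ a, pder a f x = -κ ^ ((a : ℕ) + 1) / E := fun a => h.pder_eq hO hx a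
  have r0 : κ ^ n + S₀ + 1 = 0 := by
    have := h.root x hx
    simpa [expSum] using this
  have r1 : E = n * κ ^ n + S₁ := by
    rw [hE, expSum, hS₁]
    push_cast
    congr 1
    exact Finset.sum_congr rfl fun l _ => by ring
  have r2 : E' = n ^ 2 * κ ^ n + S₂ := by
    rw [hE', expSum, hS₂]
    push_cast
    congr 1
    · ring
    · exact Finset.sum_congr rfl fun l _ => by ring
  set H : ℕ → ℂ := fun s => κ ^ s * (s * E - E') / E ^ 3 with hH
  have hsum : ∀ (α β : ℂ) (s : ℕ) (t : Fin (n - 1) → ℕ), (∀ l, t l = l + 1 + s) →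
      ∑ l : Fin (n - 1), (α + β * (((l : ℕ) : ℂ) + 1)) * x l * H (t l) =
      κ ^ s / E ^ 3 * ((α * s * E - α * E') * S₀ + (α * E + β * s * E - β * E') * S₁ +
        β * E * S₂) := by
    intro α β s t ht
    rw [hS₀, hS₁, hS₂, Finset.mul_sum, Finset.mul_sum, Finset.mul_sum, ← Finset.sum_add_distrib,
      ← Finset.sum_add_distrib, Finset.mul_sum]
    refine Finset.sum_congr rfl fun l _ => ?_
    rw [ht, hH]
    simp only []
    push_cast
    rw [pow_add]
    field_simp
    ring
  have hS₀' : S₀ = -1 - κ ^ n := by linear_combination r0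
  have hS₁' : S₁ = E - n * κ ^ n := by linear_combination -r1
  have hS₂' : S₂ = E' - n ^ 2 * κ ^ n := by linear_combination -r2
  have hleft : ∀ (s : ℕ) (t : Fin (n - 1) → ℕ), (∀ l, t l = l + 1 + s) →
      n * H s + ∑ l : Fin (n - 1), ((n : ℂ) - ((l : ℕ) + 1)) * x l * H (t l) =
        (n - s) * κ ^ s / E := by
    intro s t ht
    have := hsum n (-1) s t ht
    simp only [neg_one_mul, ← sub_eq_add_neg] at this
    rw [this, hS₀', hS₁', hS₂', hH]
    field_simp
    ring
  refine ⟨H, fun a b => h.pder_pder_eq hO hx a b, fun a => ?_, ?_, fun a => ?_⟩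
  · rw [hleft (a + 1) _ fun l => by omega]
    beta_reduce
    rw [hpd]
    push_cast
    ring
  · rw [hleft n _ fun l => by omega]
    simp
  · have := hsum 0 1 (a + 1) (fun l => l + a + 2) fun l => by omega
    simp only [zero_add, one_mul] at this
    beta_reduce
    rw [this, hS₁', hS₂', hpd, hH]
    beta_reduce
    push_cast
    rw [show n + (a : ℕ) + 1 = n + (a + 1) by omega, pow_add]
    field_simp
    ring

/-! ### The roots at the origin and their continuation -/

/-- The value at `0` of `log κ_i`. -/
def logConst (n : ℕ) (i : Fin n) : ℂ := (2 * (i : ℕ) + 1) * Real.pi * Complex.I / n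

theorem zeta_pow (n k : ℕ) : zeta n ^ k = Complex.exp (k * (Real.pi * Complex.I / n)) := by
  rw [zeta, ← Complex.exp_nat_mul]

theorem exp_logConst (n : ℕ) (i : Fin n) :
    Complex.exp (logConst n i) = zeta n ^ (2 * (i : ℕ) + 1) := by
  rw [zeta_pow, logConst]
  congr 1
  push_cast
  ring

theorem exp_logConst_pow {n : ℕ} (i : Fin n) : Complex.exp (logConst n i) ^ n = -1 := by
  have hn : (n : ℂ) ≠ 0 := by
    have := i.2
    exact_mod_cast (by omega : n ≠ 0)
  rw [← Complex.exp_nat_mul, logConst]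
  have : (n : ℂ) * ((2 * (i : ℕ) + 1) * Real.pi * Complex.I / n) =
      Real.pi * Complex.I + (i : ℕ) * (2 * Real.pi * Complex.I) := by
    field_simp
    ring
  rw [this, Complex.exp_add, Complex.exp_pi_mul_I, Complex.exp_nat_mul_two_pi_mul_I, mul_one]

theorem isPrimitiveRoot_zeta_sq {n : ℕ} (hn : n ≠ 0) : IsPrimitiveRoot (zeta n ^ 2) n := by
  have h := Complex.isPrimitiveRoot_exp n hn
  rw [zeta_pow]
  convert h using 2
  push_cast
  ring

theorem zeta_ne_zero (n : ℕ) : zeta n ≠ 0 := Complex.exp_ne_zero _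

theorem zeta_pow_injective (n : ℕ) :
    Function.Injective fun i : Fin n => zeta n ^ (2 * (i : ℕ) + 1) := by
  intro i j h
  have hn : n ≠ 0 := by have := i.2; omega
  simp only [pow_succ, pow_mul] at h
  have h' := mul_right_cancel₀ (zeta_ne_zero n) h
  simp only [← pow_succ, ← pow_mul] at h'
  exact Fin.ext ((isPrimitiveRoot_zeta_sq hn).pow_inj i.2 j.2 (by simpa [pow_mul] using h'))

theorem expSum_zero_logConst {n : ℕ} (i : Fin n) :
    expSum n (fun j => j) (0 : Fin (n - 1) → ℂ) (logConst n i) = -n := by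
  simp [expSum, exp_logConst_pow]

/-- The logarithm of the root of the mirror polynomial near `ζ^{2i+1}`, from the implicit function
theorem, which also gives its local uniqueness. -/
theorem exists_isRootLog {n : ℕ} (i : Fin n) :
    ∃ f : (Fin (n - 1) → ℂ) → ℂ, (∀ᶠ r in 𝓝[>] (0 : ℝ), IsRootLog n (Metric.ball 0 r) f) ∧
      f 0 = logConst n i ∧
      ∀ᶠ v in 𝓝 ((0 : Fin (n - 1) → ℂ), logConst n i),
        expSum n 1 v.1 v.2 + 1 = 0 → v.2 = f v.1 := by
  have hn : (n : ℂ) ≠ 0 := by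
    have := i.2
    exact_mod_cast (by omega : n ≠ 0)
  set u : (Fin (n - 1) → ℂ) × ℂ := (0, logConst n i) with hu
  set F : (Fin (n - 1) → ℂ) × ℂ → ℂ := fun v => expSum n 1 v.1 v.2 + 1 with hF
  have hFu : F u = 0 := by
    simp [hF, hu, expSum, exp_logConst_pow]
  have hcd : ContDiff ℂ 1 F := by
    simp only [hF, expSum]
    fun_prop
  have hinv : (fderiv ℂ F u ∘L .inr ℂ (Fin (n - 1) → ℂ) ℂ).IsInvertible := by
    refine ⟨ContinuousLinearEquiv.unitsEquivAut ℂ (Units.mk0 (-n : ℂ) (neg_ne_zero.2 hn)), ?_⟩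
    have h := (hasFDerivAt_expSum n 1 u).add_const (1 : ℂ)
    have h' : HasFDerivAt F _ u := h
    rw [h'.fderiv]
    ext
    simp [sum_apply, hu]
    simpa using (expSum_zero_logConst i).symm
  have hca : ContDiffAt ℂ 1 F u := hcd.contDiffAt
  set f := hca.implicitFunction one_ne_zero hinv with hf
  have hf0 : f 0 = logConst n i := hca.implicitFunction_apply_self one_ne_zero hinv
  have hfd : ContDiffAt ℂ 1 f 0 := hca.contDiffAt_implicitFunction one_ne_zero hinv
  refine ⟨f, ?_, hf0, ?_⟩
  · have h1 : ∀ᶠ x in 𝓝 (0 : Fin (n - 1) → ℂ), F (x, f x) = 0 := by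
      have := hca.eventually_apply_implicitFunction one_ne_zero hinv
      rwa [hFu] at this
    have h2 : ∀ᶠ x in 𝓝 (0 : Fin (n - 1) → ℂ), DifferentiableAt ℂ f x := by
      filter_upwards [hfd.eventually (by simp)] with x hx using hx.differentiableAt one_ne_zero
    have h3 : ∀ᶠ x in 𝓝 (0 : Fin (n - 1) → ℂ), expSum n (fun j => j) x (f x) ≠ 0 := by
      have hc : ContinuousAt (fun x => expSum n (fun j => (j : ℂ)) x (f x)) 0 :=
        (hasFDerivAt_expSum_comp _ h2.self_of_nhds).continuousAt
      refine hc.eventually_ne ?_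
      rw [hf0, expSum_zero_logConst]
      exact neg_ne_zero.2 hn
    obtain ⟨r, hr, h⟩ := Metric.eventually_nhds_iff_ball.1 (h1.and (h2.and h3))
    filter_upwards [Ioo_mem_nhdsGT hr] with s hs
    have hsub : Metric.ball (0 : Fin (n - 1) → ℂ) s ⊆ Metric.ball 0 r :=
      Metric.ball_subset_ball hs.2.le
    exact ⟨fun x hx => (h x (hsub hx)).2.1.differentiableWithinAt, fun x hx => (h x (hsub hx)).1,
      fun x hx => (h x (hsub hx)).2.2⟩
  · filter_upwards [hca.eventually_apply_eq_iff_implicitFunction one_ne_zero hinv] with v hv h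
    exact (hv.1 (by rw [hFu]; exact h)).symm

/-! ### The roots and the coefficients of the mirror polynomial -/

theorem mirrorPoly_eq_add (n : ℕ) (x : Fin (n - 1) → ℂ) :
    mirrorPoly n x = X ^ n + (∑ i : Fin (n - 1), C (x i) * X ^ ((i : ℕ) + 1) + 1) := by
  rw [mirrorPoly, add_assoc]

theorem degree_mirrorPoly_lower {n : ℕ} (hn : n ≠ 0) (x : Fin (n - 1) → ℂ) :
    (∑ i : Fin (n - 1), C (x i) * X ^ ((i : ℕ) + 1) + 1 : ℂ[X]).degree < n := by
  refine (degree_add_le _ _).trans_lt (max_lt ?_ ?_)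
  · refine (degree_sum_le _ _).trans_lt ((Finset.sup_lt_iff ?_).2 fun i _ => ?_)
    · exact WithBot.bot_lt_coe n
    · refine (degree_C_mul_X_pow_le _ _).trans_lt ?_
      have := i.2
      exact_mod_cast (by omega : (i : ℕ) + 1 < n)
  · rw [degree_one]
    exact_mod_cast Nat.pos_of_ne_zero hn

theorem mirrorPoly_monic {n : ℕ} (hn : n ≠ 0) (x : Fin (n - 1) → ℂ) : (mirrorPoly n x).Monic := by
  rw [mirrorPoly_eq_add]
  exact monic_X_pow_add (degree_mirrorPoly_lower hn x)

theorem natDegree_mirrorPoly {n : ℕ} (hn : n ≠ 0) (x : Fin (n - 1) → ℂ) :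
    (mirrorPoly n x).natDegree = n := by
  rw [mirrorPoly_eq_add]
  refine natDegree_eq_of_degree_eq_some ?_
  rw [degree_add_eq_left_of_degree_lt, degree_X_pow]
  rw [degree_X_pow]
  exact degree_mirrorPoly_lower hn x

theorem coeff_mirrorPoly_succ {n : ℕ} (x : Fin (n - 1) → ℂ) (i : Fin (n - 1)) :
    (mirrorPoly n x).coeff (i + 1) = x i := by
  have := i.2
  simp only [mirrorPoly, coeff_add, coeff_X_pow, finsetSum_coeff, coeff_C_mul, coeff_one]
  rw [if_neg (by omega), if_neg (by omega), Finset.sum_eq_single i]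
  · simp
  · intro j _ hj
    rw [if_neg]
    · simp
    · intro h
      exact hj (Fin.ext (by omega))
  · simp

theorem coeff_mirrorPoly_zero {n : ℕ} (hn : n ≠ 0) (x : Fin (n - 1) → ℂ) :
    (mirrorPoly n x).coeff 0 = 1 := by
  simp only [mirrorPoly, coeff_add, coeff_X_pow, finsetSum_coeff, coeff_C_mul, coeff_one]
  rw [if_neg (by omega), Finset.sum_eq_zero]
  · simp
  · intro j _
    simp

/-- Vieta's formulas for the mirror polynomial. -/
theorem mirrorPoly_coeff_eq {n : ℕ} (hn : n ≠ 0) {x : Fin (n - 1) → ℂ} {c : Fin n → ℂ}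
    (h : (mirrorPoly n x).roots = Finset.univ.val.map c) {k : ℕ} (hk : k ≤ n) :
    (mirrorPoly n x).coeff k = (-1) ^ (n - k) * elemSymm (n - k) c := by
  have hcard : Multiset.card (mirrorPoly n x).roots = (mirrorPoly n x).natDegree := by
    rw [h, natDegree_mirrorPoly hn]
    simp
  rw [coeff_eq_esymm_roots_of_card hcard (by rwa [natDegree_mirrorPoly hn]),
    mirrorPoly_monic hn, natDegree_mirrorPoly hn, h, one_mul]
  rfl

theorem elemSymm_self {n : ℕ} (c : Fin n → ℂ) : elemSymm n c = ∏ k, c k := by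
  rw [elemSymm, Finset.esymm_map_val]
  have : Finset.powersetCard n (Finset.univ : Finset (Fin n)) = {Finset.univ} := by
    have := Finset.powersetCard_self (Finset.univ : Finset (Fin n))
    rwa [Finset.card_univ, Fintype.card_fin] at this
  rw [this, Finset.sum_singleton]

/-- A polynomial with the right elementary symmetric functions of its roots is the mirror
polynomial. -/
theorem mirrorPoly_eq_prod {n : ℕ} (hn : n ≠ 0) {x : Fin (n - 1) → ℂ} {c : Fin n → ℂ}
    (hc : ∏ k, c k = (-1) ^ n)
    (hx : ∀ i : Fin (n - 1), x i = (-1) ^ (n - ((i : ℕ) + 1)) * elemSymm (n - ((i : ℕ) + 1)) c) :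
    mirrorPoly n x = ∏ k, (X - C (c k)) := by
  have hcard : Multiset.card ((Finset.univ : Finset (Fin n)).val.map c) = n := by simp
  have hP : (∏ k, (X - C (c k)) : ℂ[X]) =
      (((Finset.univ : Finset (Fin n)).val.map c).map fun t => X - C t).prod := by
    rw [Multiset.map_map]
    rfl
  have hdeg : (∏ k, (X - C (c k)) : ℂ[X]).natDegree = n := by
    rw [natDegree_finsetProd_X_sub_C_eq_card]
    simp
  ext j
  rcases lt_or_ge n j with hj | hj
  · rw [coeff_eq_zero_of_natDegree_lt (by rwa [natDegree_mirrorPoly hn]),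
      coeff_eq_zero_of_natDegree_lt (by rwa [hdeg])]
  · have h1 : (∏ k, (X - C (c k)) : ℂ[X]).coeff j = (-1) ^ (n - j) * elemSymm (n - j) c := by
      rw [hP, Multiset.prod_X_sub_C_coeff _ (by rwa [hcard]), hcard]
      rfl
    rw [h1]
    rcases Nat.eq_zero_or_pos j with h0 | h0
    · subst h0
      rw [coeff_mirrorPoly_zero hn, Nat.sub_zero, elemSymm_self, hc, ← mul_pow]
      simp
    · rcases hj.eq_or_lt with hjn | hjn
      · subst hjn
        have := (mirrorPoly_monic hn x).coeff_natDegree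
        rw [natDegree_mirrorPoly hn] at this
        rw [this]
        rw [elemSymm, Finset.esymm_map_val]
        simp
      · have := coeff_mirrorPoly_succ x ⟨j - 1, by omega⟩
        rw [hx] at this
        simp only [Nat.sub_add_cancel h0] at this
        exact this

theorem roots_mirrorPoly_eq {n : ℕ} (hn : n ≠ 0) {x : Fin (n - 1) → ℂ} {c : Fin n → ℂ}
    (hinj : Function.Injective c) (hc : ∀ i, (mirrorPoly n x).eval (c i) = 0) :
    (mirrorPoly n x).roots = Finset.univ.val.map c := by
  have hnd : (Finset.univ.val.map c).Nodup := Finset.univ.nodup.map hinj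
  symm
  refine Multiset.eq_of_le_of_card_le ((Multiset.le_iff_subset hnd).2 ?_) ?_
  · intro z hz
    obtain ⟨i, _, rfl⟩ := Multiset.mem_map.1 hz
    exact (mem_roots (mirrorPoly_monic hn x).ne_zero).2 (hc i)
  · refine (card_roots' _).trans ?_
    rw [natDegree_mirrorPoly hn]
    simp

/-- The holomorphic logarithms of all roots, on a common polydisc. -/
theorem exists_rootLogs {n : ℕ} (hn : 2 ≤ n) :
    ∃ (Λ : Fin n → (Fin (n - 1) → ℂ) → ℂ) (r : ℝ), 0 < r ∧ r ≤ 1 / (2 * n) ∧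
      (∀ i, IsRootLog n (Metric.ball 0 r) (Λ i)) ∧ (∀ i, Λ i 0 = logConst n i) ∧
      (∀ i, ∀ᶠ v in 𝓝 ((0 : Fin (n - 1) → ℂ), logConst n i),
        expSum n 1 v.1 v.2 + 1 = 0 → v.2 = Λ i v.1) ∧
      ∀ x ∈ Metric.ball (0 : Fin (n - 1) → ℂ) r,
        (mirrorPoly n x).roots = Finset.univ.val.map fun i => Complex.exp (Λ i x) := by
  have hn0 : n ≠ 0 := by omega
  choose Λ h1 h2 h3 using fun i : Fin n => exists_isRootLog i
  have hcont : ∀ i, ContinuousAt (Λ i) 0 := by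
    intro i
    obtain ⟨r, hr, hr'⟩ := ((h1 i).and self_mem_nhdsWithin).exists
    exact (hr.differentiableOn.differentiableAt (Metric.ball_mem_nhds 0 hr')).continuousAt
  have hinj : ∀ᶠ x in 𝓝 (0 : Fin (n - 1) → ℂ),
      Function.Injective fun i => Complex.exp (Λ i x) := by
    have : ∀ i j : Fin n, i ≠ j → ∀ᶠ x in 𝓝 (0 : Fin (n - 1) → ℂ),
        Complex.exp (Λ i x) ≠ Complex.exp (Λ j x) := by
      intro i j hij
      refine ((hcont i).cexp.prodMk (hcont j).cexp).eventually
        (isOpen_ne_fun continuous_fst continuous_snd |>.mem_nhds ?_)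
      simp only [Set.mem_ofPred_eq, h2, exp_logConst]
      exact fun h => hij (zeta_pow_injective n h)
    have := eventually_all.2 fun i => eventually_all.2 fun j =>
      eventually_imp_distrib_left.2 (this i j)
    filter_upwards [this] with x hx i j hij
    by_contra hne
    exact hx i j hne hij
  obtain ⟨s, hs, hsb⟩ := Metric.eventually_nhds_iff_ball.1 hinj
  have hpos : (0 : ℝ) < 1 / (2 * n) := by positivity
  obtain ⟨r, hr1, hr2⟩ := ((eventually_all.2 h1).and
    (Ioo_mem_nhdsGT (lt_min hs hpos))).exists
  have hsub : Metric.ball (0 : Fin (n - 1) → ℂ) r ⊆ Metric.ball 0 s :=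
    Metric.ball_subset_ball (hr2.2.le.trans (min_le_left _ _))
  refine ⟨Λ, r, hr2.1, hr2.2.le.trans (min_le_right _ _), hr1, h2, h3, fun x hx => ?_⟩
  refine roots_mirrorPoly_eq hn0 (hsb x (hsub hx)) fun i => ?_
  rw [eval_mirrorPoly_exp]
  exact (hr1 i).root x hx

/-- Near `0`, every numbering of the roots is given by the logarithms of the roots. -/
theorem IsRootNumbering.eventually_eq {n : ℕ} {κ : Fin n → (Fin (n - 1) → ℂ) → ℂ}
    (hn : n ≠ 0) (hκ : IsRootNumbering n κ) {Λ : Fin n → (Fin (n - 1) → ℂ) → ℂ}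
    (hΛ : ∀ i, ∀ᶠ v in 𝓝 ((0 : Fin (n - 1) → ℂ), logConst n i),
        expSum n 1 v.1 v.2 + 1 = 0 → v.2 = Λ i v.1) :
    ∀ᶠ x in 𝓝 (0 : Fin (n - 1) → ℂ), ∀ i, κ i x = Complex.exp (Λ i x) := by
  refine eventually_all.2 fun i => ?_
  have he : zeta n ^ (2 * (i : ℕ) + 1) ≠ 0 := pow_ne_zero _ (zeta_ne_zero n)
  -- a logarithm of `κ i` near `logConst n i`, not assumed continuous away from `0`
  set ℓ : (Fin (n - 1) → ℂ) → ℂ := fun x =>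
    logConst n i + Complex.log (κ i x / zeta n ^ (2 * (i : ℕ) + 1)) with hℓ
  have hq : Tendsto (fun x => κ i x / zeta n ^ (2 * (i : ℕ) + 1)) (𝓝 0) (𝓝 1) := by
    have := (hκ.2 i).div_const (zeta n ^ (2 * (i : ℕ) + 1))
    rwa [div_self he] at this
  have hlim : Tendsto ℓ (𝓝 0) (𝓝 (logConst n i)) := by
    have := (hq.clog Complex.one_mem_slitPlane).const_add (logConst n i)
    rwa [Complex.log_one, add_zero] at this
  have hpair : Tendsto (fun x => (x, ℓ x)) (𝓝 (0 : Fin (n - 1) → ℂ)) (𝓝 (0, logConst n i)) :=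
    tendsto_id.prodMk_nhds hlim
  filter_upwards [hpair.eventually (hΛ i), hκ.1, hq.eventually_ne one_ne_zero] with x h1 h2 h3
  have hexp : Complex.exp (ℓ x) = κ i x := by
    simp only [hℓ]
    rw [Complex.exp_add, Complex.exp_log h3, exp_logConst]
    field_simp
  have hroot : (mirrorPoly n x).eval (κ i x) = 0 := by
    have : κ i x ∈ (mirrorPoly n x).roots := by
      rw [h2]
      exact Multiset.mem_map.2 ⟨i, Finset.mem_univ_val i, rfl⟩
    exact (mem_roots (mirrorPoly_monic hn x).ne_zero).1 this
  rw [← hexp, eval_mirrorPoly_exp] at hroot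
  rw [← h1 hroot, hexp]

/-! ### The space of solutions -/

/-- The coefficients of the constant function `1` (index `0`) and of `f^r` (index `r`). -/
def baseCoeff (n : ℕ) (r : Fin n) : (Fin (n - 1) → ℕ) → ℂ :=
  if (r : ℕ) = 0 then constCoeff n else mirrorCoeff n r

/-- The function `w_0 + ∑_r w_r f^r`, as the sum of one power series. -/
def solSer (n : ℕ) (w : Fin n → ℂ) : (Fin (n - 1) → ℂ) → ℂ :=
  ser fun k => ∑ r, w r * baseCoeff n r k

theorem baseCoeff_convergesOn {n : ℕ} (r : Fin n) : ConvergesOn (1 / n) (baseCoeff n r) := by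
  rw [baseCoeff]
  split_ifs with h
  · exact constCoeff_convergesOn n _
  · exact mirrorCoeff_convergesOn (Nat.one_le_iff_ne_zero.2 h) r.2

theorem baseCoeff_rel {n : ℕ} (r : Fin n) : CoeffRel n (baseCoeff n r) := by
  rw [baseCoeff]
  split_ifs with h
  · exact constCoeff_rel n
  · exact mirrorCoeff_rel (by have := r.2; omega) r

theorem baseCoeff_zero {n : ℕ} (r : Fin n) : baseCoeff n r 0 = if (r : ℕ) = 0 then 1 else 0 := by
  rw [baseCoeff]
  split_ifs with h
  · simp [constCoeff]
  · have hn : (n : ℚ) ≠ 0 := by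
      have := r.2
      exact_mod_cast (by omega : n ≠ 0)
    rw [mirrorCoeff, if_neg]
    simpa [degLast, eq_comm] using ⟨h, Nat.cast_ne_zero.1 hn⟩

theorem Gamma_fract_div_Gamma_one_add {q : ℚ} (h1 : -1 < q) (h0 : q < 0) :
    Real.Gamma (Int.fract q : ℚ) / Real.Gamma (1 + q : ℚ) = 1 := by
  have : Int.fract q = 1 + q :=
    Int.fract_eq_iff.2 ⟨by linarith, by linarith, -1, by push_cast; ring⟩
  rw [this]
  refine div_self (Real.Gamma_pos_of_pos ?_).ne'
  exact_mod_cast (by linarith : 0 < 1 + q)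

theorem baseCoeff_single {n : ℕ} (r : Fin n) (l : Fin (n - 1)) :
    baseCoeff n r (Pi.single l 1) = if (r : ℕ) = l + 1 then 1 else 0 := by
  have hl := l.2
  have hn : (0 : ℚ) < n := by exact_mod_cast (by omega : 0 < n)
  have hs : ∀ φ : Fin (n - 1) → ℚ,
      ∑ i, φ i * ((Pi.single l 1 : Fin (n - 1) → ℕ) i : ℚ) = φ l := by
    intro φ
    rw [Finset.sum_eq_single l]
    · simp
    · intro j _ hj
      simp [hj]
    · simp
  have hlast : degLast n (Pi.single l 1) = -(((l : ℕ) + 1) / n) := by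
    rw [degLast, hs]
    ring
  have hzero : degZero n (Pi.single l 1) = -1 + ((l : ℕ) + 1) / n := by
    rw [degZero, hs]
    field_simp
    ring
  have hpos : (0 : ℚ) < ((l : ℕ) + 1) / n := by positivity
  have hlt : (((l : ℕ) : ℚ) + 1) / n < 1 := by
    rw [div_lt_one hn]
    exact_mod_cast (by omega : (l : ℕ) + 1 < n)
  rw [baseCoeff]
  by_cases h : (r : ℕ) = 0
  · rw [if_pos h, if_neg (by omega), constCoeff, if_neg]
    exact Pi.single_ne_zero_iff.2 one_ne_zero
  · have hfr : Int.fract ((((l : ℕ) : ℚ) + 1) / n) = (r : ℕ) / n ↔ (r : ℕ) = l + 1 := by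
      rw [Int.fract_eq_self.2 ⟨hpos.le, hlt⟩, div_left_inj' hn.ne']
      constructor
      · intro h'
        exact_mod_cast h'.symm
      · intro h'
        exact_mod_cast h'.symm
    rw [if_neg h, mirrorCoeff, hlast, hzero, neg_neg]
    refine if_congr hfr ?_ rfl
    rw [Gamma_fract_div_Gamma_one_add (by linarith) (by linarith),
      Gamma_fract_div_Gamma_one_add (by linarith) (by linarith), Finset.prod_eq_one]
    · simp
    · intro j _
      by_cases hj : j = l
      · subst hj
        simp
      · simp [hj]

theorem solSer_convergesOn {n : ℕ} (w : Fin n → ℂ) :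
    ConvergesOn (1 / n) fun k => ∑ r, w r * baseCoeff n r k :=
  ConvergesOn.sum _ _ fun r _ => baseCoeff_convergesOn r

theorem solSer_differentiableOn {n : ℕ} (w : Fin n → ℂ) :
    DifferentiableOn ℂ (solSer n w) (Metric.ball 0 (1 / n)) :=
  (solSer_convergesOn w).differentiableOn

theorem solSer_eq_sum {n : ℕ} (w : Fin n → ℂ) {x : Fin (n - 1) → ℂ}
    (hx : x ∈ Metric.ball 0 (1 / (n : ℝ))) :
    solSer n w x = ∑ r, w r * ser (baseCoeff n r) x :=
  ser_sum _ _ (fun r _ => baseCoeff_convergesOn r) (by simpa using hx)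

theorem isGKZSolution_solSer {n : ℕ} (w : Fin n → ℂ) {W : Set (Fin (n - 1) → ℂ)} (hW : IsOpen W)
    (hWR : W ⊆ Metric.ball 0 (1 / n)) : IsGKZSolution n W (solSer n w) :=
  isGKZSolution_ser (solSer_convergesOn w) (CoeffRel.sum _ _ fun r _ => baseCoeff_rel r) hW hWR

theorem pder_solSer {n : ℕ} (w : Fin n → ℂ) {x : Fin (n - 1) → ℂ}
    (hx : x ∈ Metric.ball 0 (1 / (n : ℝ))) (l : Fin (n - 1)) :
    pder l (solSer n w) x = ∑ r, w r * pder l (ser (baseCoeff n r)) x := by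
  have hev : solSer n w =ᶠ[𝓝 x] fun x => ∑ r, w r * ser (baseCoeff n r) x := by
    filter_upwards [Metric.isOpen_ball.mem_nhds hx] with y hy using solSer_eq_sum w hy
  have hd : HasFDerivAt (fun x => ∑ r, w r * ser (baseCoeff n r) x) _ x :=
    HasFDerivAt.fun_sum (u := Finset.univ) fun r _ =>
      (((baseCoeff_convergesOn r).differentiableOn.differentiableAt
        (Metric.isOpen_ball.mem_nhds hx)).hasFDerivAt.const_mul (w r))
  rw [pder_congr hev, pder, hd.fderiv]
  simp [sum_apply, pder]

/-- The value (index `0`) and the partial derivatives at `p` of a function. -/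
def jet (n : ℕ) (p : Fin (n - 1) → ℂ) (f : (Fin (n - 1) → ℂ) → ℂ) (r : Fin n) : ℂ :=
  if h : (r : ℕ) = 0 then f p else pder ⟨r - 1, by omega⟩ f p

theorem value_eq_of_jet_eq {n : ℕ} (hn : n ≠ 0) {p : Fin (n - 1) → ℂ}
    {f g : (Fin (n - 1) → ℂ) → ℂ} (h : jet n p f = jet n p g) : f p = g p := by
  simpa [jet] using congrFun h ⟨0, Nat.pos_of_ne_zero hn⟩

theorem pder_eq_of_jet_eq {n : ℕ} {p : Fin (n - 1) → ℂ}
    {f g : (Fin (n - 1) → ℂ) → ℂ} (h : jet n p f = jet n p g) (l : Fin (n - 1)) :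
    pder l f p = pder l g p := by
  simpa [jet] using congrFun h ⟨l + 1, by omega⟩

theorem jet_solSer {n : ℕ} (w : Fin n → ℂ) {p : Fin (n - 1) → ℂ}
    (hp : p ∈ Metric.ball 0 (1 / (n : ℝ))) :
    jet n p (solSer n w) = (Matrix.of fun s r => jet n p (ser (baseCoeff n r)) s).mulVec w := by
  funext s
  simp only [Matrix.mulVec, dotProduct, Matrix.of_apply, jet]
  split_ifs with h
  · rw [solSer_eq_sum w hp]
    exact Finset.sum_congr rfl fun r _ => mul_comm _ _
  · rw [pder_solSer w hp]
    exact Finset.sum_congr rfl fun r _ => mul_comm _ _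

/-- The functions `1, f^1, …, f^{n-1}` have independent jets at `0`. -/
theorem jet_solSer_zero {n : ℕ} (w : Fin n → ℂ) : jet n 0 (solSer n w) = w := by
  funext s
  have hs := s.2
  have hn : (0 : ℝ) < 1 / n := by
    have : (0 : ℝ) < n := by exact_mod_cast (by omega : 0 < n)
    positivity
  rw [jet]
  split_ifs with h
  · rw [solSer, ser_zero, Finset.sum_eq_single s]
    · rw [baseCoeff_zero, if_pos h, mul_one]
    · intro r _ hr
      rw [baseCoeff_zero, if_neg, mul_zero]
      exact fun h' => hr (Fin.ext (h'.trans h.symm))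
    · simp
  · rw [solSer, (solSer_convergesOn w).pder_zero hn, Finset.sum_eq_single s]
    · rw [baseCoeff_single, if_pos (by simp; omega), mul_one]
    · intro r _ hr
      rw [baseCoeff_single, if_neg, mul_zero]
      exact fun h' => hr (Fin.ext (by simp at h'; omega))
    · simp

/-- Functions that satisfy the second-order system on a connected open subset of the polydisc are
determined by their jet at one point. -/
theorem eqOn_of_jet_eq {n : ℕ} (hn : n ≠ 0) {W : Set (Fin (n - 1) → ℂ)} (hW : IsOpen W)
    (hc : IsPreconnected W) (hsub : W ⊆ Metric.ball 0 (1 / (2 * n)))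
    {f g : (Fin (n - 1) → ℂ) → ℂ} (hf : DifferentiableOn ℂ f W) (hg : DifferentiableOn ℂ g W)
    (hf' : ∀ x ∈ W, x ∈ torus n → SecondOrder n f x)
    (hg' : ∀ x ∈ W, x ∈ torus n → SecondOrder n g x)
    {p : Fin (n - 1) → ℂ} (hp : p ∈ W) (hjet : jet n p f = jet n p g) : Set.EqOn f g W := by
  obtain ⟨ε, hε, hball⟩ := Metric.isOpen_iff.1 hW p hp
  have hu := hf.sub hg
  have h := eqOn_zero_of_secondOrder (u := fun x => f x - g x) hε (hball.trans hsub)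
    (hu.mono hball)
    (fun x hx => (hf' x (hball hx.1) hx.2).sub hW hf hg (hball hx.1) (hg' x (hball hx.1) hx.2))
    (sub_eq_zero.2 (value_eq_of_jet_eq hn hjet)) fun a => by
      rw [pder_sub (hf.differentiableAt (hW.mem_nhds hp)) (hg.differentiableAt (hW.mem_nhds hp)),
        pder_eq_of_jet_eq hjet, sub_self]
  have := eqOn_zero_of_eventuallyEq_zero (F := fun x => f x - g x) hW hc hu hp
    (by filter_upwards [Metric.ball_mem_nhds p hε] with y hy using h hy)
  exact fun x hx => sub_eq_zero.1 (this hx)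

theorem ball_half_subset (n : ℕ) :
    Metric.ball (0 : Fin (n - 1) → ℂ) (1 / (2 * n)) ⊆ Metric.ball 0 (1 / n) := by
  refine Metric.ball_subset_ball ?_
  rcases Nat.eq_zero_or_pos n with h | h
  · simp [h]
  · have : (0 : ℝ) < n := by exact_mod_cast h
    exact one_div_le_one_div_of_le this (by linarith)

theorem solSer_secondOrder {n : ℕ} (hn : n ≠ 0) (w : Fin n → ℂ) :
    ∀ x ∈ Metric.ball (0 : Fin (n - 1) → ℂ) (1 / n), x ∈ torus n →
      SecondOrder n (solSer n w) x := fun _ hx hxt =>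
  (isGKZSolution_solSer w Metric.isOpen_ball subset_rfl).secondOrder hn Metric.isOpen_ball hx hxt

/-- The functions `1, f^1, …, f^{n-1}` have independent jets at every point of the polydisc. -/
theorem solSer_injective {n : ℕ} (hn : n ≠ 0) {p : Fin (n - 1) → ℂ}
    (hp : p ∈ Metric.ball 0 (1 / (2 * n : ℝ))) {w w' : Fin n → ℂ}
    (h : jet n p (solSer n w) = jet n p (solSer n w')) : w = w' := by
  have hpos : (0 : ℝ) < 1 / (2 * n) := by
    have : (0 : ℝ) < n := by exact_mod_cast Nat.pos_of_ne_zero hn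
    positivity
  have key := eqOn_of_jet_eq hn Metric.isOpen_ball
    (convex_ball (0 : Fin (n - 1) → ℂ) (1 / (2 * n))).isPreconnected subset_rfl
    ((solSer_differentiableOn w).mono (ball_half_subset n))
    ((solSer_differentiableOn w').mono (ball_half_subset n))
    (fun x hx => solSer_secondOrder hn w x (ball_half_subset n hx))
    (fun x hx => solSer_secondOrder hn w' x (ball_half_subset n hx)) hp h
  have hev : solSer n w =ᶠ[𝓝 0] solSer n w' := by
    filter_upwards [Metric.ball_mem_nhds 0 hpos] with y hy using key hy
  rw [← jet_solSer_zero w, ← jet_solSer_zero w']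
  funext s
  rw [jet, jet]
  split_ifs
  · exact hev.self_of_nhds
  · exact pder_congr hev _

/-- Every function satisfying the second-order system is a combination of `1, f^1, …, f^{n-1}`. -/
theorem exists_eqOn_solSer {n : ℕ} (hn : n ≠ 0) {W : Set (Fin (n - 1) → ℂ)} (hW : IsOpen W)
    (hc : IsConnected W) (hsub : W ⊆ Metric.ball 0 (1 / (2 * n)))
    {g : (Fin (n - 1) → ℂ) → ℂ} (hg : DifferentiableOn ℂ g W)
    (hg' : ∀ x ∈ W, x ∈ torus n → SecondOrder n g x) : ∃ w, Set.EqOn g (solSer n w) W := by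
  obtain ⟨p, hp⟩ := hc.nonempty
  have hp' := ball_half_subset n (hsub hp)
  -- the jets at `p` of the `n` known solutions are independent, so they span all jets
  set A := Matrix.of fun s r => jet n p (ser (baseCoeff n r)) s with hA
  have hinj : Function.Injective A.mulVecLin := by
    intro w w' h
    simp only [Matrix.mulVecLin_apply] at h
    rw [← jet_solSer w hp', ← jet_solSer w' hp'] at h
    exact solSer_injective hn (hsub hp) h
  obtain ⟨w, hw⟩ := LinearMap.injective_iff_surjective.1 hinj (jet n p g)
  rw [Matrix.mulVecLin_apply, ← jet_solSer w hp'] at hw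
  exact ⟨w, eqOn_of_jet_eq hn hW hc.isPreconnected hsub hg
    ((solSer_differentiableOn w).mono (hsub.trans (ball_half_subset n))) hg'
    (fun x hx => solSer_secondOrder hn w x (ball_half_subset n (hsub hx))) hp hw.symm⟩

/-! ### The logarithms of the roots as hypergeometric series -/

theorem sum_fin_eq_add {M : Type*} [AddCommMonoid M] {n : ℕ} (hn : n ≠ 0) (F : Fin n → M) :
    ∑ r, F r = F ⟨0, Nat.pos_of_ne_zero hn⟩ + ∑ l : Fin (n - 1), F ⟨l + 1, by omega⟩ := by
  obtain ⟨m, rfl⟩ := Nat.exists_eq_succ_of_ne_zero hn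
  exact Fin.sum_univ_succ F

theorem sum_fin_eq_sum_Icc {M : Type*} [AddCommMonoid M] (n : ℕ) (F : ℕ → M) :
    ∑ l : Fin (n - 1), F (l + 1) = ∑ k ∈ Finset.Icc 1 (n - 1), F k := by
  rw [Fin.sum_univ_eq_sum_range (fun l => F (l + 1)), ← Finset.Ico_add_one_right_eq_Icc,
    Finset.sum_Ico_eq_sum_range]
  exact Finset.sum_congr rfl fun k _ => by rw [add_comm]

/-- The vector `(f^1(x), …, f^{n-1}(x))`. -/
def flatCoord (n : ℕ) (x : Fin (n - 1) → ℂ) : Fin (n - 1) → ℂ := fun l => mirrorSeries n (l + 1) x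

theorem solSer_eq {n : ℕ} (hn : n ≠ 0) (w : Fin n → ℂ) {x : Fin (n - 1) → ℂ}
    (hx : x ∈ Metric.ball 0 (1 / (n : ℝ))) :
    solSer n w x = w ⟨0, Nat.pos_of_ne_zero hn⟩ +
      ∑ l : Fin (n - 1), w ⟨l + 1, by omega⟩ * flatCoord n x l := by
  rw [solSer_eq_sum w hx, sum_fin_eq_add hn]
  simp [baseCoeff, ser_constCoeff, flatCoord, mirrorSeries_eq_ser]

/-- The coefficients of `log κ_i` with respect to `1, f^1, …, f^{n-1}`. -/
def logWeights (n : ℕ) (i : Fin n) : Fin n → ℂ := fun r =>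
  if (r : ℕ) = 0 then logConst n i else 1 / n * zeta n ^ ((2 * (i : ℕ) + 1) * r)

/-- `log κ_k` as a function of the flat co-ordinates. -/
def logOfFlat (n : ℕ) (k : Fin n) (t : Fin (n - 1) → ℂ) : ℂ :=
  logConst n k + 1 / n * ∑ l : Fin (n - 1), zeta n ^ ((2 * (k : ℕ) + 1) * ((l : ℕ) + 1)) * t l

theorem solSer_logWeights {n : ℕ} (i : Fin n) {x : Fin (n - 1) → ℂ}
    (hx : x ∈ Metric.ball 0 (1 / (n : ℝ))) :
    solSer n (logWeights n i) x = logOfFlat n i (flatCoord n x) := by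
  rw [solSer_eq (by have := i.2; omega) _ hx, logOfFlat, Finset.mul_sum]
  simp [logWeights, mul_assoc]

/-- The logarithm of a root has the same jet at `0` as the corresponding hypergeometric series, and
both satisfy the second-order system. -/
theorem IsRootLog.eqOn_solSer {n : ℕ} {r : ℝ} (h0 : 0 < r) (hr : r ≤ 1 / (2 * n)) {i : Fin n}
    {f : (Fin (n - 1) → ℂ) → ℂ} (hf : IsRootLog n (Metric.ball 0 r) f)
    (hf0 : f 0 = logConst n i) : Set.EqOn f (solSer n (logWeights n i)) (Metric.ball 0 r) := by
  have hn : n ≠ 0 := by have := i.2; omega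
  have hsub : Metric.ball (0 : Fin (n - 1) → ℂ) r ⊆ Metric.ball 0 (1 / (2 * n)) :=
    Metric.ball_subset_ball hr
  refine eqOn_of_jet_eq hn Metric.isOpen_ball (convex_ball _ r).isPreconnected hsub
    hf.differentiableOn
    ((solSer_differentiableOn _).mono (hsub.trans (ball_half_subset n)))
    (fun x hx _ => hf.secondOrder Metric.isOpen_ball hx)
    (fun x hx => solSer_secondOrder hn _ x (ball_half_subset n (hsub hx)))
    (Metric.mem_ball_self h0) ?_
  rw [jet_solSer_zero]
  funext s
  rw [jet, logWeights]
  split_ifs with h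
  · exact hf0
  · rw [hf.pder_eq Metric.isOpen_ball (Metric.mem_ball_self h0), hf0, expSum_zero_logConst,
      exp_logConst, ← pow_mul]
    have : (s : ℕ) - 1 + 1 = s := by omega
    simp only [this]
    rw [neg_div_neg_eq]
    ring

/-! ### The differences of the logarithms form a basis -/

/-- The coefficients of `1` (index `0`) and of `log κ_i - log κ_{i-1}` with respect to
`1, f^1, …, f^{n-1}`. -/
def diffWeights (n : ℕ) (i : Fin n) : Fin n → ℂ :=
  if (i : ℕ) = 0 then Pi.single i 1 else logWeights n i - logWeights n ⟨i - 1, by omega⟩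

theorem zeta_sq_pow_ne_one {n k : ℕ} (h0 : k ≠ 0) (hk : k < n) : zeta n ^ (2 * k) ≠ 1 := by
  rw [pow_mul]
  exact (isPrimitiveRoot_zeta_sq (by omega)).pow_ne_one_of_pos_of_lt h0 hk

theorem linearIndependent_diffWeights (n : ℕ) : LinearIndependent ℂ (diffWeights n) := by
  rcases Nat.eq_zero_or_pos n with rfl | hpos
  · exact linearIndependent_empty_type
  obtain ⟨m, rfl⟩ := Nat.exists_eq_succ_of_ne_zero hpos.ne'
  have hm : ((m + 1 : ℕ) : ℂ) ≠ 0 := by exact_mod_cast Nat.succ_ne_zero m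
  rw [Fintype.linearIndependent_iff]
  intro c hc
  rw [Fin.sum_univ_succ] at hc
  -- the components of index `r ≥ 1` form a Vandermonde system in the nodes `ζ^{2i-1}`
  have hV : (fun j : Fin m => c j.succ * zeta (m + 1) ^ (2 * (j : ℕ) + 1)) = 0 := by
    refine Matrix.eq_zero_of_forall_pow_sum_mul_pow_eq_zero
      (f := fun j : Fin m => zeta (m + 1) ^ (2 * (j : ℕ) + 1)) ?_ fun i => ?_
    · exact (zeta_pow_injective (m + 1)).comp (Fin.castSucc_injective m)
    · have h := congrFun hc i.succ
      have hz : zeta (m + 1) ^ (2 * ((i : ℕ) + 1)) - 1 ≠ 0 :=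
        sub_ne_zero.2 (zeta_sq_pow_ne_one (by omega) (by omega))
      have h' : 1 / ((m + 1 : ℕ) : ℂ) * (zeta (m + 1) ^ (2 * ((i : ℕ) + 1)) - 1) *
          ∑ j : Fin m, c j.succ * zeta (m + 1) ^ (2 * (j : ℕ) + 1) *
            (zeta (m + 1) ^ (2 * (j : ℕ) + 1)) ^ (i : ℕ) = 0 := by
        refine Eq.trans ?_ h
        rw [Finset.mul_sum]
        simp only [Pi.add_apply, Pi.smul_apply, Finset.sum_apply, smul_eq_mul, diffWeights,
          Fin.val_zero, if_true, Fin.val_succ, Nat.succ_ne_zero, if_false, Pi.sub_apply, logWeights,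
          Nat.add_sub_cancel]
        rw [Pi.single_eq_of_ne (Fin.succ_ne_zero i), mul_zero, zero_add]
        refine Finset.sum_congr rfl fun j _ => ?_
        ring
      exact (mul_eq_zero.1 h').resolve_left (mul_ne_zero (one_div_ne_zero hm) hz)
  have hs : ∀ j : Fin m, c j.succ = 0 := fun j =>
    (mul_eq_zero.1 (congrFun hV j)).resolve_right (pow_ne_zero _ (zeta_ne_zero _))
  have h0 : c 0 = 0 := by
    have := congrFun hc 0
    simpa [hs, diffWeights] using this
  exact fun i => Fin.cases h0 hs i

/-- The functions `w_0 + ∑_r w_r f^r`, restricted to `W`, as a linear function of `w`. -/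
def solMap (n : ℕ) (W : Set (Fin (n - 1) → ℂ)) : (Fin n → ℂ) →ₗ[ℂ] (W → ℂ) :=
  Fintype.linearCombination ℂ fun r => W.domRestrict (ser (baseCoeff n r))

theorem solMap_apply {n : ℕ} {W : Set (Fin (n - 1) → ℂ)} (hW : W ⊆ Metric.ball 0 (1 / (n : ℝ)))
    (w : Fin n → ℂ) : solMap n W w = W.domRestrict (solSer n w) := by
  funext x
  rw [solMap, Fintype.linearCombination_apply, Finset.sum_apply]
  exact (solSer_eq_sum w (hW x.2)).symm

theorem isBasisOfGKZSolutions_oneAndDifferences {n : ℕ} (hn : n ≠ 0) {W : Set (Fin (n - 1) → ℂ)}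
    (hW : IsOpen W) (hc : IsConnected W) (hsub : W ⊆ Metric.ball 0 (1 / (2 * n)))
    {L : Fin n → (Fin (n - 1) → ℂ) → ℂ}
    (hL : ∀ i, Set.EqOn (L i) (solSer n (logWeights n i)) W) :
    IsBasisOfGKZSolutions n W (oneAndDifferences n L) := by
  have hsub' := hsub.trans (ball_half_subset n)
  have hinj : (solMap n W).ker = ⊥ := by
    refine LinearMap.ker_eq_bot.2 fun w w' h => ?_
    obtain ⟨p, hp⟩ := hc.nonempty
    rw [solMap_apply hsub', solMap_apply hsub'] at h
    have hev : solSer n w =ᶠ[𝓝 p] solSer n w' := by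
      filter_upwards [hW.mem_nhds hp] with x hx using congrFun h ⟨x, hx⟩
    refine solSer_injective hn (hsub hp) ?_
    funext s
    rw [jet, jet]
    split_ifs
    · exact hev.self_of_nhds
    · exact pder_congr hev _
  have hφ : (fun i => W.domRestrict (oneAndDifferences n L i)) = solMap n W ∘ diffWeights n := by
    funext i
    rw [Function.comp_apply, diffWeights]
    split_ifs with h
    · funext x
      rw [solMap, Fintype.linearCombination_apply_single]
      simp [oneAndDifferences, h, baseCoeff, ser_constCoeff]
    · rw [map_sub, solMap_apply hsub', solMap_apply hsub']
      funext x
      simp [oneAndDifferences, h, hL i x.2, hL ⟨i - 1, by omega⟩ x.2]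
  have hli := linearIndependent_diffWeights n
  refine ⟨?_, ?_⟩
  · rw [hφ]
    exact hli.map' _ hinj
  · rw [hφ, Set.range_comp, ← Submodule.map_span,
      hli.span_eq_top_of_card_eq_finrank' (by simp), Submodule.map_top]
    ext h
    constructor
    · rintro ⟨w, rfl⟩
      exact ⟨solSer n w, isGKZSolution_solSer w hW hsub', (solMap_apply hsub' w).symm⟩
    · rintro ⟨g, hg, rfl⟩
      obtain ⟨w, hw⟩ := exists_eqOn_solSer hn hW hc hsub hg.1
        fun x hx hxt => hg.secondOrder hn hW hx hxt
      refine ⟨w, ?_⟩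
      rw [solMap_apply hsub']
      funext x
      exact (hw x.2).symm

/-- Two holomorphic logarithms of the same function on a polydisc agree if they agree at `0`. -/
theorem eqOn_of_exp_eq {m : ℕ} {r : ℝ} (h0 : 0 < r) {f g : (Fin m → ℂ) → ℂ}
    (hf : DifferentiableOn ℂ f (Metric.ball 0 r)) (hg : DifferentiableOn ℂ g (Metric.ball 0 r))
    (hexp : ∀ x ∈ Metric.ball (0 : Fin m → ℂ) r, Complex.exp (f x) = Complex.exp (g x))
    (hfg : f 0 = g 0) : Set.EqOn f g (Metric.ball 0 r) := by
  refine Metric.isOpen_ball.eqOn_of_fderiv_eq (convex_ball _ r).isPreconnected hf hg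
    (fun x hx => ?_) (Metric.mem_ball_self h0) hfg
  have hx' := Metric.isOpen_ball.mem_nhds hx
  have h1 := (hf.differentiableAt hx').hasFDerivAt.cexp
  have h2 := (hg.differentiableAt hx').hasFDerivAt.cexp
  have hev : (fun y => Complex.exp (f y)) =ᶠ[𝓝 x] fun y => Complex.exp (g y) := by
    filter_upwards [hx'] with y hy using hexp y hy
  have h3 := h1.unique (h2.congr_of_eventuallyEq hev)
  rw [hexp x hx] at h3
  exact smul_right_injective _ (Complex.exp_ne_zero _) h3

/-! ### Inversion of the mirror map -/

/-- The point `x` with `x_i = (-1)^{n-i} e_{n-i}(c)`. -/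
def coordOfRoots (n : ℕ) (c : Fin n → ℂ) : Fin (n - 1) → ℂ := fun i =>
  (-1) ^ (n - ((i : ℕ) + 1)) * elemSymm (n - ((i : ℕ) + 1)) c

theorem eq_coordOfRoots {n : ℕ} (hn : n ≠ 0) {x : Fin (n - 1) → ℂ} {c : Fin n → ℂ}
    (h : (mirrorPoly n x).roots = Finset.univ.val.map c) : x = coordOfRoots n c := by
  funext i
  rw [← coeff_mirrorPoly_succ x i, mirrorPoly_coeff_eq hn h (by have := i.2; omega)]
  rfl

theorem continuous_coordOfRoots {n : ℕ} : Continuous (coordOfRoots n) := by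
  refine continuous_pi fun i => ?_
  simp only [coordOfRoots, elemSymm, Finset.esymm_map_val]
  fun_prop

theorem dropZero_inverseMirrorMap (n : ℕ) (τ : Fin n → ℂ) :
    dropZero n (inverseMirrorMap n τ) = coordOfRoots n (kappaOfTau n τ) := by
  funext i
  simp [dropZero, inverseMirrorMap, coordOfRoots]

theorem dropZero_mirrorMap (n : ℕ) (x : Fin n → ℂ) :
    dropZero n (mirrorMap n x) = flatCoord n (dropZero n x) := by
  funext i
  rw [dropZero, mirrorMap, if_neg (Nat.succ_ne_zero _)]
  rfl

theorem kappaOfTau_eq (n : ℕ) (τ : Fin n → ℂ) :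
    kappaOfTau n τ = fun k => Complex.exp (logOfFlat n k (dropZero n τ)) := by
  funext k
  rw [kappaOfTau, logOfFlat, Complex.exp_add, exp_logConst, Finset.mul_sum, Complex.exp_sum]
  simp only [mul_assoc]

theorem eq_of_dropZero_eq {n : ℕ} (hn : n ≠ 0) {x y : Fin n → ℂ}
    (h0 : x ⟨0, Nat.pos_of_ne_zero hn⟩ = y ⟨0, Nat.pos_of_ne_zero hn⟩)
    (h : dropZero n x = dropZero n y) : x = y := by
  obtain ⟨m, rfl⟩ := Nat.exists_eq_succ_of_ne_zero hn
  funext i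
  exact Fin.cases h0 (fun j => congrFun h j) i

theorem logOfFlat_zero {n : ℕ} (k : Fin n) : logOfFlat n k 0 = logConst n k := by
  simp [logOfFlat]

/-- The logarithms of all roots determine the flat co-ordinates, by a Vandermonde determinant. -/
theorem eq_of_logOfFlat_eq {n : ℕ} (hn : n ≠ 0) {s t : Fin (n - 1) → ℂ}
    (h : ∀ k, logOfFlat n k s = logOfFlat n k t) : s = t := by
  have hn' : (n : ℂ) ≠ 0 := by exact_mod_cast hn
  set v : Fin n → ℂ := fun r => if h : (r : ℕ) = 0 then 0 else
    s ⟨r - 1, by omega⟩ - t ⟨r - 1, by omega⟩ with hv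
  have hv0 : v = 0 := by
    refine Matrix.eq_zero_of_forall_index_sum_mul_pow_eq_zero (zeta_pow_injective n) fun k => ?_
    have hk := h k
    rw [logOfFlat, logOfFlat, add_right_inj] at hk
    have hk' := mul_left_cancel₀ (one_div_ne_zero hn') hk
    rw [sum_fin_eq_add hn]
    simp only [hv, dite_true, zero_mul, zero_add, Nat.succ_ne_zero, dite_false,
      Nat.add_sub_cancel, sub_mul, Finset.sum_sub_distrib, ← pow_mul, Fin.eta]
    rw [sub_eq_zero]
    simpa only [mul_comm] using hk'
  funext l
  have := congrFun hv0 ⟨l + 1, by omega⟩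
  simp only [hv, Nat.succ_ne_zero, dite_false, Nat.add_sub_cancel, Fin.eta, Pi.zero_apply] at this
  exact sub_eq_zero.1 this

theorem sum_zeta_pow_eq_zero {n : ℕ} (l : Fin (n - 1)) :
    ∑ k : Fin n, zeta n ^ ((2 * (k : ℕ) + 1) * ((l : ℕ) + 1)) = 0 := by
  have hl := l.2
  have h1 : zeta n ^ (2 * ((l : ℕ) + 1)) ≠ 1 := zeta_sq_pow_ne_one (by omega) (by omega)
  have h2 : (zeta n ^ (2 * ((l : ℕ) + 1))) ^ n = 1 := by
    rw [pow_mul, pow_right_comm, (isPrimitiveRoot_zeta_sq (by omega)).pow_eq_one, one_pow]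
  have h3 : ∀ k : ℕ, zeta n ^ ((2 * k + 1) * ((l : ℕ) + 1)) =
      zeta n ^ ((l : ℕ) + 1) * (zeta n ^ (2 * ((l : ℕ) + 1))) ^ k := by
    intro k
    ring
  simp only [h3]
  rw [← Finset.mul_sum, Fin.sum_univ_eq_sum_range (fun k => (zeta n ^ (2 * ((l : ℕ) + 1))) ^ k),
    geom_sum_eq h1, h2, sub_self, zero_div, mul_zero]

theorem roots_mirrorPoly_zero {n : ℕ} (hn : n ≠ 0) :
    (mirrorPoly n 0).roots = Finset.univ.val.map fun k : Fin n => Complex.exp (logConst n k) := by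
  refine roots_mirrorPoly_eq hn (fun i j h => ?_) fun i => ?_
  · simp only [exp_logConst] at h
    exact zeta_pow_injective n h
  · simp [eval_mirrorPoly, exp_logConst_pow]

/-- The product of the roots does not depend on `t`, because `∑_k ζ^{(2k+1) l} = 0` for
`0 < l < n`. -/
theorem prod_exp_logOfFlat {n : ℕ} (hn : n ≠ 0) (t : Fin (n - 1) → ℂ) :
    ∏ k, Complex.exp (logOfFlat n k t) = (-1) ^ n := by
  have h1 : ∏ k, Complex.exp (logConst n k) = (-1) ^ n := by
    have := mirrorPoly_coeff_eq hn (roots_mirrorPoly_zero hn) (Nat.zero_le n)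
    rw [coeff_mirrorPoly_zero hn, Nat.sub_zero, elemSymm_self] at this
    have h2 : ((-1 : ℂ) ^ n) * (-1) ^ n = 1 := by rw [← mul_pow]; simp
    linear_combination (-1) ^ n * this.symm - (∏ k, Complex.exp (logConst n k)) * h2
  have h2 : ∑ k : Fin n, 1 / (n : ℂ) * ∑ l : Fin (n - 1),
      zeta n ^ ((2 * (k : ℕ) + 1) * ((l : ℕ) + 1)) * t l = 0 := by
    rw [← Finset.mul_sum, Finset.sum_comm]
    simp only [← Finset.sum_mul, sum_zeta_pow_eq_zero, zero_mul, Finset.sum_const_zero, mul_zero]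
  simp only [logOfFlat, Complex.exp_add]
  rw [Finset.prod_mul_distrib, h1, ← Complex.exp_sum, h2, Complex.exp_zero, mul_one]

/-- Near `0`, the flat co-ordinates of the point with roots `exp (logOfFlat n k t)` are `t`. -/
theorem eventually_flatCoord_coordOfRoots {n : ℕ} (hn : n ≠ 0) {r : ℝ} (h0 : 0 < r)
    {Λ : Fin n → (Fin (n - 1) → ℂ) → ℂ}
    (huniq : ∀ i, ∀ᶠ v in 𝓝 ((0 : Fin (n - 1) → ℂ), logConst n i),
      expSum n 1 v.1 v.2 + 1 = 0 → v.2 = Λ i v.1)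
    (hflat : ∀ i, ∀ x ∈ Metric.ball (0 : Fin (n - 1) → ℂ) r,
      Λ i x = logOfFlat n i (flatCoord n x)) :
    ∀ᶠ t in 𝓝 (0 : Fin (n - 1) → ℂ),
      coordOfRoots n (fun k => Complex.exp (logOfFlat n k t)) ∈ Metric.ball 0 r ∧
      flatCoord n (coordOfRoots n fun k => Complex.exp (logOfFlat n k t)) = t := by
  set X : (Fin (n - 1) → ℂ) → Fin (n - 1) → ℂ := fun t =>
    coordOfRoots n fun k => Complex.exp (logOfFlat n k t) with hX
  have hcl : ∀ k, Continuous (logOfFlat n k) := by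
    intro k
    unfold logOfFlat
    fun_prop
  have hcX : Continuous X := continuous_coordOfRoots.comp
    (continuous_pi fun k => Complex.continuous_exp.comp (hcl k))
  have hX0 : X 0 = 0 := by
    simp only [hX, logOfFlat_zero]
    exact (eq_coordOfRoots hn (roots_mirrorPoly_zero hn)).symm
  have hpair : ∀ k, Tendsto (fun t => (X t, logOfFlat n k t)) (𝓝 0) (𝓝 (0, logConst n k)) := by
    intro k
    have := (hcX.prodMk (hcl k)).tendsto 0
    rwa [hX0, logOfFlat_zero] at this
  have hball : ∀ᶠ t in 𝓝 (0 : Fin (n - 1) → ℂ), X t ∈ Metric.ball 0 r :=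
    hcX.continuousAt.eventually_mem (by rw [hX0]; exact Metric.ball_mem_nhds 0 h0)
  filter_upwards [hball, eventually_all.2 fun k => (hpair k).eventually (huniq k)] with t ht hu
  refine ⟨ht, (eq_of_logOfFlat_eq hn fun k => ?_).symm⟩
  rw [← hflat k _ ht]
  refine hu k ?_
  -- the numbers `exp (logOfFlat n k t)` are the roots of the mirror polynomial at `X t`
  rw [← eval_mirrorPoly_exp,
    mirrorPoly_eq_prod (x := X t) hn (prod_exp_logOfFlat hn t) fun i => rfl, eval_prod]
  exact Finset.prod_eq_zero (Finset.mem_univ k) (by simp)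

theorem summable_mirrorTerm {n r : ℕ} (hr : r ∈ Finset.Icc 1 (n - 1)) {x : Fin (n - 1) → ℂ}
    (hx : x ∈ Metric.ball 0 (1 / (n : ℝ))) : Summable (mirrorTerm n r x) := by
  rw [Finset.mem_Icc] at hr
  have := (mirrorCoeff_convergesOn (n := n) hr.1 (by omega)).summable (x := x) (by simpa using hx)
  simpa only [← mirrorTerm_eq] using this

end

end TypeAMirror


open TypeAMirror

theorem propositionA5 (n : ℕ) (hn : 2 ≤ n) :
    (∃ κ, TypeAMirror.IsRootNumbering n κ) ∧
    (∀ κ, TypeAMirror.IsRootNumbering n κ →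
      ∃ r : ℝ, 0 < r ∧
        (∃ L, TypeAMirror.IsLogBranch n (Metric.ball 0 r) κ L) ∧
        (∀ L, TypeAMirror.IsLogBranch n (Metric.ball 0 r) κ L →
          (∀ W : Set (Fin (n - 1) → ℂ), IsOpen W → IsConnected W → W ⊆ Metric.ball 0 r →
            TypeAMirror.IsBasisOfGKZSolutions n W (TypeAMirror.oneAndDifferences n L)) ∧
          (∀ x ∈ Metric.ball (0 : Fin (n - 1) → ℂ) r,
            (∀ k ∈ Finset.Icc 1 (n - 1), Summable (TypeAMirror.mirrorTerm n k x)) ∧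
            ∀ i : Fin n, L i x = (2 * (i : ℕ) + 1) * Real.pi * Complex.I / n +
              1 / n * ∑ k ∈ Finset.Icc 1 (n - 1),
                TypeAMirror.zeta n ^ ((2 * (i : ℕ) + 1) * k) *
                  TypeAMirror.mirrorSeries n k x)) ∧
        (∀ x ∈ Metric.ball (0 : Fin (n - 1) → ℂ) r, ∀ i : Fin (n - 1),
          x i = (-1) ^ (n - ((i : ℕ) + 1)) *
            TypeAMirror.elemSymm (n - ((i : ℕ) + 1)) fun k => κ k x)) ∧
    (∃ r : ℝ, 0 < r ∧
      (∀ x : Fin n → ℂ, TypeAMirror.dropZero n x ∈ Metric.ball 0 r →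
        (∀ k ∈ Finset.Icc 1 (n - 1),
          Summable (TypeAMirror.mirrorTerm n k (TypeAMirror.dropZero n x))) ∧
        TypeAMirror.inverseMirrorMap n (TypeAMirror.mirrorMap n x) = x) ∧
      ∃ ρ : ℝ, 0 < ρ ∧
        ∀ τ : Fin n → ℂ, TypeAMirror.dropZero n τ ∈ Metric.ball 0 ρ →
          TypeAMirror.dropZero n (TypeAMirror.inverseMirrorMap n τ) ∈ Metric.ball 0 r ∧
          TypeAMirror.mirrorMap n (TypeAMirror.inverseMirrorMap n τ) = τ) := by
  have hn0 : n ≠ 0 := by omega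
  obtain ⟨Λ, r₀, hr₀, hr₀', hlog, hΛ0, huniq, hroots⟩ := exists_rootLogs hn
  have hhalf : Metric.ball (0 : Fin (n - 1) → ℂ) r₀ ⊆ Metric.ball 0 (1 / (2 * n)) :=
    Metric.ball_subset_ball hr₀'
  have hfull := hhalf.trans (ball_half_subset n)
  have hser : ∀ i, Set.EqOn (Λ i) (solSer n (logWeights n i)) (Metric.ball 0 r₀) := fun i =>
    (hlog i).eqOn_solSer hr₀ hr₀' (hΛ0 i)
  have hflat : ∀ i, ∀ x ∈ Metric.ball (0 : Fin (n - 1) → ℂ) r₀,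
      Λ i x = logOfFlat n i (flatCoord n x) := fun i x hx => by
    rw [hser i hx, solSer_logWeights i (hfull hx)]
  refine ⟨⟨fun i x => Complex.exp (Λ i x), ?_, fun i => ?_⟩, fun κ hκ => ?_, r₀, hr₀,
    fun x hx => ⟨fun k hk => summable_mirrorTerm hk (hfull hx), ?_⟩, ?_⟩
  · filter_upwards [Metric.ball_mem_nhds 0 hr₀] with x hx using hroots x hx
  · have hc := ((hlog i).differentiableOn.differentiableAt
      (Metric.ball_mem_nhds 0 hr₀)).continuousAt.cexp.tendsto
    rwa [hΛ0, exp_logConst] at hc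
  · obtain ⟨s, hs, hsb⟩ := Metric.eventually_nhds_iff_ball.1
      (hκ.1.and (hκ.eventually_eq hn0 huniq))
    have hsub : Metric.ball (0 : Fin (n - 1) → ℂ) (min r₀ s) ⊆ Metric.ball 0 r₀ :=
      Metric.ball_subset_ball (min_le_left _ _)
    have hsub' : Metric.ball (0 : Fin (n - 1) → ℂ) (min r₀ s) ⊆ Metric.ball 0 s :=
      Metric.ball_subset_ball (min_le_right _ _)
    refine ⟨min r₀ s, lt_min hr₀ hs, ⟨Λ, fun i => ⟨(hlog i).differentiableOn.mono hsub,
      fun x hx => ((hsb x (hsub' hx)).2 i).symm, hΛ0 i⟩⟩, fun L hL => ?_, fun x hx i => ?_⟩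
    · have hLΛ : ∀ i, Set.EqOn (L i) (Λ i) (Metric.ball 0 (min r₀ s)) := fun i =>
        eqOn_of_exp_eq (lt_min hr₀ hs) (hL i).1 ((hlog i).differentiableOn.mono hsub)
          (fun x hx => by rw [(hL i).2.1 x hx, (hsb x (hsub' hx)).2 i])
          ((hL i).2.2.trans (hΛ0 i).symm)
      refine ⟨fun W hW hc hWr => ?_, fun x hx => ⟨fun k hk => ?_, fun i => ?_⟩⟩
      · exact isBasisOfGKZSolutions_oneAndDifferences hn0 hW hc (hWr.trans (hsub.trans hhalf))
          fun i x hx => (hLΛ i (hWr hx)).trans (hser i (hsub (hWr hx)))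
      · exact summable_mirrorTerm hk (hfull (hsub hx))
      · rw [hLΛ i hx, hflat i x (hsub hx), logOfFlat, logConst, ← sum_fin_eq_sum_Icc n
          fun k => zeta n ^ ((2 * (i : ℕ) + 1) * k) * mirrorSeries n k x]
        rfl
    · exact congrFun (eq_coordOfRoots hn0 (hsb x (hsub' hx)).1) i
  · refine eq_of_dropZero_eq hn0 (by simp [inverseMirrorMap, mirrorMap]) ?_
    rw [dropZero_inverseMirrorMap, kappaOfTau_eq, dropZero_mirrorMap]
    simp only [← hflat _ _ hx]
    exact (eq_coordOfRoots hn0 (hroots _ hx)).symm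
  · obtain ⟨ρ, hρ, hρb⟩ := Metric.eventually_nhds_iff_ball.1
      (eventually_flatCoord_coordOfRoots hn0 hr₀ huniq hflat)
    refine ⟨ρ, hρ, fun τ hτ => ?_⟩
    obtain ⟨h1, h2⟩ := hρb _ hτ
    rw [← kappaOfTau_eq, ← dropZero_inverseMirrorMap] at h1 h2
    refine ⟨h1, eq_of_dropZero_eq hn0 (by simp [inverseMirrorMap, mirrorMap]) ?_⟩
    rw [dropZero_mirrorMap, h2]
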